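/- Let $C$ be a compact connected Riemann surface of genus $g\ge 2$ with a system of holomorphic coordinates $z_\alpha:U_\alpha\to\mathbb{C}$, $C=\bigcup_\alpha U_\alpha$, and let $K=K_C$ be its canonical bundle. Fix a theta characteristic $K^{1/2}$, given by holomorphic transition functions $\xi_{\alpha\beta}$ on $U_\alpha\cap U_\beta$ with $\xi_{\alpha\beta}\xi_{\beta\gamma}=\xi_{\alpha\gamma}$ and $\xi_{\alpha\beta}^2=dz_\beta/dz_\alpha$. A vector bundle with transition functions $g_{\alpha\beta}$ has as sections the families $s_\alpha$ with $s_\alpha=g_{\alpha\beta}s_\beta$. The coordinates are called projective if on every connected subset of $U_\alpha\cap U_\beta$ (so on all of $U_\alpha\cap U_\beta$, if it is connected) $z_\alpha=(az_\beta+b)/(cz_\beta+d)$ for some constants $a,b,c,d$ with $ad-bc=1$. Write $\partial_\beta=d/dz_\beta$, $\partial_\beta\log\xi_{\alpha\beta}=\xi_{\alpha\beta}^{-1}\partial_\beta\xi_{\alpha\beta}$, $X_-=\begin{bmatrix}0&0\\1&0\end{bmatrix}$, $X_+=\begin{bmatrix}0&1\\0&0\end{bmatrix}$. For $q\in H^0(C,K^{\otimes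 2})$, $q=q_\alpha dz_\alpha^2$, put $\phi_\alpha(q)=X_-+q_\alpha X_+$ and write $\phi(q)$ for the field with local expressions $\phi_\alpha(q)\,dz_\alpha$. For $\hbar\in\mathbb{C}$ define $$g_{\alpha\beta}^\hbar=\begin{bmatrix}\xi_{\alpha\beta}&0\\0&\xi_{\alpha\beta}^{-1}\end{bmatrix}\begin{bmatrix}1&-\hbar\,\partial_\beta\log\xi_{\alpha\beta}\\0&1\end{bmatrix}.$$ An $SL_2(\mathbb{C})$-connection (resp. $SL_2(\mathbb{C})$-Higgs bundle) is given by transition functions of determinant $1$ together with a holomorphic connection (resp. an $\mathcal{O}_C$-linear map $\phi:E\to E\otimes K$) whose local matrices are trace-free. A connection is irreducible if the image of its holonomy representation is Zariski dense in $SL_2(\mathbb{C})$. An $SL_2(\mathbb{C})$-oper is an irreducible holomorphic $SL_2(\mathbb{C})$-connection $(E,\nabla)$ for which there is a holomorphic line subbundle $F\subset E$ such that the map $F\to(E/F)\otimes K$ induced by $\nabla$ is an isomorphism of $\mathcal{O}_C$-modules. A Higgs bundle $(E,\phi)$ is stable if every $\phi$-invariant holomorphic line subbundle has negative degree. Then: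 1. $\{\hbar\,\partial_\beta\log\xi_{\alpha\beta}\,dz_\beta\}$ is a $1$-cocycle with values in $K$. For every $\hbar$ the $g_{\alpha\beta}^\hbar$ satisfy $g_{\alpha\beta}^\hbar g_{\beta\gamma}^\hbar=g_{\alpha\gamma}^\hbar$ and define a holomorphic vector bundle $E_\hbar$, which is an extension $0\to K^{1/2}\to E_\hbar\to K^{-1/2}\to 0$ by means of the first and the second coordinate. The $g_{\alpha\beta}^\hbar$ are holomorphic in $(x,\hbar)$, and for $\hbar\ne0$ the extension is non-trivial (it does not split). 2. For every $\hbar\ne 0$, the local operators $d-\frac1\hbar X_-dz_\alpha$ define a global holomorphic connection $\nabla^\hbar(0)$ in $E_\hbar$ if and only if the coordinates are projective. Suppose from now on that the coordinates are projective, and let $q\in H^0(C,K^{\otimes 2})$. 3. For every $\hbar\neq0$, the local operators $d-\frac1\hbar\phi_\alpha(q)dz_\alpha$ define a global holomorphic connection $\nabla^\hbar(q)$ in $E_\hbar$, and $(E_\hbar,\nabla^\hbar(q))$ is an $SL_2(\mathbb{C})$-oper. 4. For every $\hbar\in\mathbb{C}$ the local operators $\hbar d-\phi_\alpha(q)dz_\alpha$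 define a global $\hbar$-connection $E_\hbar\to E_\hbar\otimes K$, which is $\hbar\nabla^\hbar(q)$ if $\hbar\neq0$. At $\hbar=0$ it is the Higgs pair $(E_0,-\phi(q))$, where $E_0=K^{1/2}\oplus K^{-1/2}$; the $SL_2(\mathbb{C})$-Higgs bundles $(E_0,\pm\phi(q))$ are stable. At $\hbar=1$ it is the $SL_2(\mathbb{C})$-oper $(E_1,\nabla^1(q))$. 5. There are holomorphic gauge transformations $T_\hbar:E_\hbar\to E_1$ ($\hbar\neq 0$) such that, as $|\hbar|\to\infty$, the connections $T_\hbar\circ\nabla^\hbar(q)\circ T_\hbar^{-1}$ on $E_1$ converge to $\nabla^1(0)$ (locally uniform convergence of the connection matrices on each $U_\alpha$). This limit corresponds to the fixed point of $\mathbb{C}^*$ on the Hitchin section $\{(E_0,\phi(q))\}$: one has $(E_0,\lambda\phi(q))\cong(E_0,\phi(q))$ for all $\lambda\in\mathbb{C}^*$ if and only if $q=0$. -/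

import Mathlib

open Set Filter Topology
open scoped Manifold ContDiff Matrix

noncomputable section

/-! ## Coordinates on a Riemann surface

`C` is a Riemann surface (a complex manifold modelled on `ℂ`). A coordinate system is a family
`z α` of holomorphic charts whose domains `U_α = (z α).source` cover `C`. -/

section Coordinates

variable {C : Type*} [TopologicalSpace C] [ChartedSpace ℂ C] {ι : Type*}
variable {F : Type*} [NormedAddCommGroup F] [NormedSpace ℂ F]

/-- The genus of a Riemann surface: the dimension of the space of holomorphic `1`-forms, that is,
of holomorphic sections of the cotangent bundle `Hom(TC, ℂ)`. -/
def genus (C : Type*) [TopologicalSpace C] [ChartedSpace ℂ C] [IsManifold 𝓘(ℂ, ℂ) ω C] : ℕ :=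
  Module.finrank ℂ
    (ContMDiffSection 𝓘(ℂ, ℂ) (ℂ →L[ℂ] ℂ) ω
      (fun x : C => TangentSpace 𝓘(ℂ, ℂ) x →L[ℂ] Bundle.Trivial C ℂ x))

/-- A system of holomorphic coordinates `z_α : U_α → ℂ` whose domains cover `C`. -/
structure IsCoordinateSystem (z : ι → OpenPartialHomeomorph C ℂ) : Prop where
  holomorphic : ∀ α, z α ∈ IsManifold.maximalAtlas 𝓘(ℂ, ℂ) ω C
  covers : ∀ x, ∃ α, x ∈ (z α).source

/-- Holomorphic maps from a subset of `C` to a complex normed space. -/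
def HolOn (f : C → F) (V : Set C) : Prop :=
  MDifferentiableOn 𝓘(ℂ, ℂ) 𝓘(ℂ, F) f V

/-- Holomorphic matrix-valued functions. -/
def HolMatrixOn {m n : Type*} (M : C → Matrix m n ℂ) (V : Set C) : Prop :=
  ∀ i j, HolOn (fun x => M x i j) V

/-- The derivative `df/de` of `f` with respect to the coordinate `e`, at the point `x`. -/
def coordDeriv (e : OpenPartialHomeomorph C ℂ) (f : C → F) (x : C) : F :=
  deriv (f ∘ e.symm) (e x)

/-- The transition functions `dz_β / dz_α` of the canonical bundle `K_C`: the coefficients of a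
`1`-form `f_α dz_α = f_β dz_β` satisfy `f_α = (dz_β / dz_α) f_β`. -/
def canonicalCocycle (z : ι → OpenPartialHomeomorph C ℂ) (α β : ι) (x : C) : ℂ :=
  coordDeriv (z α) (z β) x

/-- The coordinates are projective: the coordinate changes are fractional linear transformations
given by (locally constant) elements of `SL₂(ℂ)`. The same element serves on any connected part of
an overlap, hence on the entire overlap if that is connected. -/
def IsProjective (z : ι → OpenPartialHomeomorph C ℂ) : Prop :=
  ∀ α β, ∀ V ⊆ (z α).source ∩ (z β).source, IsPreconnected V →
    ∃ f : Matrix.SpecialLinearGroup (Fin 2) ℂ, ∀ x ∈ V,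
      f.1 1 0 * z β x + f.1 1 1 ≠ 0 ∧
      z α x = (f.1 0 0 * z β x + f.1 0 1) / (f.1 1 0 * z β x + f.1 1 1)

/-- A theta characteristic `K_C^{1/2}`: transition functions `ξ_αβ` of a holomorphic line bundle
with `ξ_αβ ^ 2 = dz_β / dz_α`. -/
structure IsThetaCharacteristic (z : ι → OpenPartialHomeomorph C ℂ) (ξ : ι → ι → C → ℂ) :
    Prop where
  holomorphic : ∀ α β, HolOn (ξ α β) ((z α).source ∩ (z β).source)
  cocycle : ∀ α β γ, ∀ x ∈ (z α).source ∩ (z β).source ∩ (z γ).source,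
    ξ α β x * ξ β γ x = ξ α γ x
  sq : ∀ α β, ∀ x ∈ (z α).source ∩ (z β).source, ξ α β x ^ 2 = canonicalCocycle z α β x

/-- A holomorphic quadratic differential `q ∈ H⁰(C, K_C^{⊗2})`, `q = q_α dz_α²` on `U_α`. -/
structure IsQuadraticDifferential (z : ι → OpenPartialHomeomorph C ℂ) (q : ι → C → ℂ) :
    Prop where
  holomorphic : ∀ α, HolOn (q α) (z α).source
  transition : ∀ α β, ∀ x ∈ (z α).source ∩ (z β).source,
    q α x = canonicalCocycle z α β x ^ 2 * q β x

/-- Čech `1`-cocycles with values in `K_C`; `c α β` is the coefficient, with respect to `dz_β`, of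
a `1`-form on `U_α ∩ U_β`. -/
structure IsCanonicalOneCocycle (z : ι → OpenPartialHomeomorph C ℂ) (c : ι → ι → C → ℂ) :
    Prop where
  holomorphic : ∀ α β, HolOn (c α β) ((z α).source ∩ (z β).source)
  cocycle : ∀ α β γ, ∀ x ∈ (z α).source ∩ (z β).source ∩ (z γ).source,
    c α γ x = canonicalCocycle z γ β x * c α β x + c β γ x

end Coordinates

/-! ## Holomorphic vector bundles, connections, Higgs fields

A holomorphic vector bundle is given by its transition functions `g α β` on `U_α ∩ U_β`; a section
`s` over `V` is a family `s α` of vector functions on `V ∩ U_α` with `s α = g α β s β`. -/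

section Bundles

variable {C : Type*} [TopologicalSpace C] [ChartedSpace ℂ C] {ι : Type*}
variable {m n : Type*} [Fintype m] [DecidableEq m] [Fintype n] [DecidableEq n]

/-- `g` is a system of transition functions of a holomorphic vector bundle. -/
structure IsBundle (z : ι → OpenPartialHomeomorph C ℂ) (g : ι → ι → C → Matrix n n ℂ) :
    Prop where
  holomorphic : ∀ α β, HolMatrixOn (g α β) ((z α).source ∩ (z β).source)
  one : ∀ α, ∀ x ∈ (z α).source, g α α x = 1
  cocycle : ∀ α β γ, ∀ x ∈ (z α).source ∩ (z β).source ∩ (z γ).source,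
    g α β x * g β γ x = g α γ x

/-- Holomorphic sections over `V` of the bundle with transition functions `g`. -/
def IsSection (z : ι → OpenPartialHomeomorph C ℂ) (g : ι → ι → C → Matrix n n ℂ) (V : Set C)
    (s : ι → C → n → ℂ) : Prop :=
  (∀ α, HolOn (s α) (V ∩ (z α).source)) ∧
  ∀ α β, ∀ x ∈ V ∩ ((z α).source ∩ (z β).source), s α x = g α β x *ᵥ s β x

/-- The transition functions of `E ⊗ K_C`, where `g` are those of `E`. -/
def tensorCanonical (z : ι → OpenPartialHomeomorph C ℂ) (g : ι → ι → C → Matrix n n ℂ) :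
    ι → ι → C → Matrix n n ℂ :=
  fun α β x => canonicalCocycle z α β x • g α β x

/-- The coefficient with respect to `dz_α` of `(lam • d + A_α dz_α) s` on `U_α`. -/
def localOp (z : ι → OpenPartialHomeomorph C ℂ) (lam : ℂ) (A : ι → C → Matrix n n ℂ) (α : ι)
    (s : C → n → ℂ) (x : C) : n → ℂ :=
  lam • coordDeriv (z α) s x + A α x *ᵥ s x

/-- The local operators `lam • d + A_α dz_α` glue to a global holomorphic operator
`D : E → E ⊗ K_C`, in the sense of sheaves of sections. Such a `D` obeys the rule
`D (f s) = f D s + lam • df ⊗ s`: it is a `lam`-connection of Deligne, a holomorphic connection if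
`lam = 1`, and an `𝒪_C`-linear Higgs field if `lam = 0`. -/
structure IsLambdaConnection (z : ι → OpenPartialHomeomorph C ℂ)
    (g : ι → ι → C → Matrix n n ℂ) (lam : ℂ) (A : ι → C → Matrix n n ℂ) : Prop where
  holomorphic : ∀ α, HolMatrixOn (A α) (z α).source
  glue : ∀ V : Set C, IsOpen V → ∀ s, IsSection z g V s →
    IsSection z (tensorCanonical z g) V (fun α => localOp z lam A α (s α))

/-- Holomorphic connections with local expressions `d + A_α dz_α`. -/
abbrev IsConnection (z : ι → OpenPartialHomeomorph C ℂ) (g : ι → ι → C → Matrix n n ℂ)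
    (A : ι → C → Matrix n n ℂ) : Prop :=
  IsLambdaConnection z g 1 A

/-- Holomorphic bundle homomorphisms. -/
structure IsBundleHom (z : ι → OpenPartialHomeomorph C ℂ) (g : ι → ι → C → Matrix m m ℂ)
    (g' : ι → ι → C → Matrix n n ℂ) (T : ι → C → Matrix n m ℂ) : Prop where
  holomorphic : ∀ α, HolMatrixOn (T α) (z α).source
  intertwines : ∀ α β, ∀ x ∈ (z α).source ∩ (z β).source,
    T α x * g α β x = g' α β x * T β x

/-- An isomorphism `(E, D) → (E', D')` of bundles with `lam`-connections (a gauge transformation):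
an invertible bundle homomorphism `T` with `T ∘ D = D' ∘ T`. -/
structure IsGaugeTransformation (z : ι → OpenPartialHomeomorph C ℂ) (lam : ℂ)
    (g : ι → ι → C → Matrix n n ℂ) (A : ι → C → Matrix n n ℂ)
    (g' : ι → ι → C → Matrix n n ℂ) (A' : ι → C → Matrix n n ℂ)
    (T : ι → C → Matrix n n ℂ) : Prop extends IsBundleHom z g g' T where
  invertible : ∀ α, ∀ x ∈ (z α).source, IsUnit (T α x)
  commutes : ∀ α, ∀ V ⊆ (z α).source, IsOpen V → ∀ s : C → n → ℂ, HolOn s V → ∀ x ∈ V,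
    T α x *ᵥ localOp z lam A α s x = localOp z lam A' α (fun y => T α y *ᵥ s y) x

/-- The extension `0 → L → E → L' → 0`, with maps `i` and `p`, is exact. -/
structure IsShortExact {l : Type*} [Fintype l] [DecidableEq l]
    (z : ι → OpenPartialHomeomorph C ℂ)
    (g : ι → ι → C → Matrix l l ℂ) (g' : ι → ι → C → Matrix m m ℂ)
    (g'' : ι → ι → C → Matrix n n ℂ)
    (i : ι → C → Matrix m l ℂ) (p : ι → C → Matrix n m ℂ) : Prop where
  hom_left : IsBundleHom z g g' i
  hom_right : IsBundleHom z g' g'' p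
  injective : ∀ α, ∀ x ∈ (z α).source, Function.Injective (i α x *ᵥ ·)
  exact : ∀ α, ∀ x ∈ (z α).source, Function.Exact (i α x *ᵥ ·) (p α x *ᵥ ·)
  surjective : ∀ α, ∀ x ∈ (z α).source, Function.Surjective (p α x *ᵥ ·)

/-- The extension with projection `p : E → L'` splits holomorphically. -/
def Splits (z : ι → OpenPartialHomeomorph C ℂ) (g : ι → ι → C → Matrix m m ℂ)
    (g' : ι → ι → C → Matrix n n ℂ) (p : ι → C → Matrix n m ℂ) : Prop :=
  ∃ r : ι → C → Matrix m n ℂ, IsBundleHom z g' g r ∧ ∀ α, ∀ x ∈ (z α).source, p α x * r α x = 1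

/-- Holomorphic line subbundles: `L α x` is the fibre at `x ∈ U_α`, in the trivialization over
`U_α`. -/
structure IsLineSubbundle (z : ι → OpenPartialHomeomorph C ℂ) (g : ι → ι → C → Matrix n n ℂ)
    (L : ι → C → Submodule ℂ (n → ℂ)) : Prop where
  transition : ∀ α β, ∀ x ∈ (z α).source ∩ (z β).source,
    L α x = (L β x).map (Matrix.toLin' (g α β x))
  frame : ∀ α, ∀ x ∈ (z α).source, ∃ V ⊆ (z α).source, IsOpen V ∧ x ∈ V ∧
    ∃ s : C → n → ℂ, HolOn s V ∧ ∀ y ∈ V, s y ≠ 0 ∧ L α y = Submodule.span ℂ {s y}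

/-- `N` is the degree of the line subbundle `L`: the degree of the divisor of a meromorphic section
`s` of `L` that does not vanish identically (`d x` is the order of `s` at `x`). On a compact
connected Riemann surface such a section exists, and the degree of its divisor does not depend on
the section. -/
def HasDegree (z : ι → OpenPartialHomeomorph C ℂ) (g : ι → ι → C → Matrix n n ℂ)
    (L : ι → C → Submodule ℂ (n → ℂ)) (N : ℤ) : Prop :=
  ∃ (s : ι → C → n → ℂ) (d : C → ℤ),
    (∀ α, ∀ x ∈ (z α).source, MeromorphicAt (s α ∘ (z α).symm) (z α x)) ∧
    (∀ α β, ∀ x ∈ (z α).source ∩ (z β).source, ∀ᶠ y in 𝓝[≠] x, s α y = g α β y *ᵥ s β y) ∧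
    (∀ α, ∀ x ∈ (z α).source, ∀ᶠ y in 𝓝[≠] x, s α y ∈ L α y) ∧
    (∀ α, ∀ x ∈ (z α).source, meromorphicOrderAt (s α ∘ (z α).symm) (z α x) = (d x : WithTop ℤ)) ∧
    N = ∑ᶠ x, d x

/-- `v t` is a parallel vector field along the path `γ` (`v t α` is the vector at `γ t`, seen in
the trivialization over `U_α`): locally it is the restriction of a flat holomorphic section. -/
def IsParallelAlong (z : ι → OpenPartialHomeomorph C ℂ) (g : ι → ι → C → Matrix n n ℂ)
    (A : ι → C → Matrix n n ℂ) {x y : C} (γ : Path x y) (v : unitInterval → ι → n → ℂ) : Prop :=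
  ∀ t₀, ∃ V : Set C, IsOpen V ∧ γ t₀ ∈ V ∧ ∃ s, IsSection z g V s ∧
    (∀ α, ∀ y ∈ V ∩ (z α).source, localOp z 1 A α (s α) y = 0) ∧
    ∀ᶠ t in 𝓝 t₀, ∀ α, γ t ∈ (z α).source → v t α = s α (γ t)

/-- The image of the holonomy representation of the connection `d + A_α dz_α` at the base point
`x`, in the trivialization of the bundle over `U_α`. -/
def holonomy (z : ι → OpenPartialHomeomorph C ℂ) (g : ι → ι → C → Matrix n n ℂ)
    (A : ι → C → Matrix n n ℂ) (α : ι) (x : C) : Set (Matrix n n ℂ) :=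
  {M | ∃ γ : Path x x, ∀ w : n → ℂ, ∃ v, IsParallelAlong z g A γ v ∧
    v 0 α = w ∧ v 1 α = M *ᵥ w}

/-- Zariski density of a set of matrices in `SL_n(ℂ)`. -/
def IsZariskiDenseInSL (S : Set (Matrix n n ℂ)) : Prop :=
  S ⊆ {M | M.det = 1} ∧
  ∀ P : MvPolynomial (n × n) ℂ,
    (∀ M ∈ S, MvPolynomial.eval (fun k => M k.1 k.2) P = 0) →
    ∀ M : Matrix n n ℂ, M.det = 1 → MvPolynomial.eval (fun k => M k.1 k.2) P = 0

/-- `SL_n(ℂ)`-bundles with a `lam`-connection: `det E` is trivial, and the `lam`-connection induced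
on it is the trivial one. -/
structure IsSLPair (z : ι → OpenPartialHomeomorph C ℂ) (g : ι → ι → C → Matrix n n ℂ) (lam : ℂ)
    (A : ι → C → Matrix n n ℂ) : Prop where
  bundle : IsBundle z g
  det_eq_one : ∀ α β, ∀ x ∈ (z α).source ∩ (z β).source, (g α β x).det = 1
  connection : IsLambdaConnection z g lam A
  trace_eq_zero : ∀ α, ∀ x ∈ (z α).source, (A α x).trace = 0

/-- A connection is irreducible if the image of its holonomy representation is Zariski dense. -/
def IsIrreducibleConnection (z : ι → OpenPartialHomeomorph C ℂ)
    (g : ι → ι → C → Matrix n n ℂ) (A : ι → C → Matrix n n ℂ) : Prop :=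
  ∀ α, ∀ x ∈ (z α).source, IsZariskiDenseInSL (holonomy z g A α x)

/-- The map `L → (E / L) ⊗ K_C` of sheaves of sections induced by the connection `d + A_α dz_α` is
an isomorphism: it is injective on the sections over each open set, and locally surjective. -/
structure InducesIsoOnQuotient (z : ι → OpenPartialHomeomorph C ℂ) (A : ι → C → Matrix n n ℂ)
    (L : ι → C → Submodule ℂ (n → ℂ)) : Prop where
  injective : ∀ α, ∀ V ⊆ (z α).source, IsOpen V → ∀ s : C → n → ℂ, HolOn s V →
    (∀ x ∈ V, s x ∈ L α x) → (∀ x ∈ V, localOp z 1 A α s x ∈ L α x) → ∀ x ∈ V, s x = 0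
  surjective : ∀ α, ∀ V ⊆ (z α).source, IsOpen V → ∀ t : C → n → ℂ, HolOn t V → ∀ x ∈ V,
    ∃ W ⊆ V, IsOpen W ∧ x ∈ W ∧ ∃ s : C → n → ℂ, HolOn s W ∧ (∀ y ∈ W, s y ∈ L α y) ∧
      ∀ y ∈ W, localOp z 1 A α s y - t y ∈ L α y

/-- `SL₂(ℂ)`-opers. -/
structure IsOper (z : ι → OpenPartialHomeomorph C ℂ)
    (g : ι → ι → C → Matrix (Fin 2) (Fin 2) ℂ) (A : ι → C → Matrix (Fin 2) (Fin 2) ℂ) :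
    Prop where
  slPair : IsSLPair z g 1 A
  irreducible : IsIrreducibleConnection z g A
  exists_line : ∃ L, IsLineSubbundle z g L ∧ InducesIsoOnQuotient z A L

/-- Stable `SL₂(ℂ)`-Higgs bundles: every invariant line subbundle has negative degree. -/
structure IsStableHiggs (z : ι → OpenPartialHomeomorph C ℂ)
    (g : ι → ι → C → Matrix (Fin 2) (Fin 2) ℂ) (Φ : ι → C → Matrix (Fin 2) (Fin 2) ℂ) :
    Prop where
  slPair : IsSLPair z g 0 Φ
  stable : ∀ L, IsLineSubbundle z g L →
    (∀ α, ∀ x ∈ (z α).source, ∀ v ∈ L α x, Φ α x *ᵥ v ∈ L α x) →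
    ∀ N, HasDegree z g L N → N < 0

end Bundles

/-! ## The objects of the theorem -/

section Objects

variable {C : Type*} [TopologicalSpace C] [ChartedSpace ℂ C] {ι : Type*}

/-- `X₋` -/
def Xminus : Matrix (Fin 2) (Fin 2) ℂ := !![0, 0; 1, 0]

/-- `X₊` -/
def Xplus : Matrix (Fin 2) (Fin 2) ℂ := !![0, 1; 0, 0]

/-- `∂_β log ξ_αβ = ξ_αβ⁻¹ dξ_αβ / dz_β` -/
def dlogTheta (z : ι → OpenPartialHomeomorph C ℂ) (ξ : ι → ι → C → ℂ) (α β : ι) (x : C) : ℂ :=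
  coordDeriv (z β) (ξ α β) x / ξ α β x

/-- The transition functions `g_αβ^ħ` of `E_ħ`. -/
def transE (z : ι → OpenPartialHomeomorph C ℂ) (ξ : ι → ι → C → ℂ) (ħ : ℂ) (α β : ι) (x : C) :
    Matrix (Fin 2) (Fin 2) ℂ :=
  !![ξ α β x, 0; 0, (ξ α β x)⁻¹] * !![1, -ħ * dlogTheta z ξ α β x; 0, 1]

/-- The transition functions of `K_C^{1/2}`. -/
def transHalf (ξ : ι → ι → C → ℂ) (α β : ι) (x : C) : Matrix (Fin 1) (Fin 1) ℂ := !![ξ α β x]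

/-- The transition functions of `K_C^{-1/2}`. -/
def transNegHalf (ξ : ι → ι → C → ℂ) (α β : ι) (x : C) : Matrix (Fin 1) (Fin 1) ℂ :=
  !![(ξ α β x)⁻¹]

/-- The inclusion `K_C^{1/2} → E_ħ` as the first coordinate. -/
def inclHalf (ι C : Type*) : ι → C → Matrix (Fin 2) (Fin 1) ℂ := fun _ _ => !![1; 0]

/-- The projection `E_ħ → K_C^{-1/2}` to the second coordinate. -/
def projNegHalf (ι C : Type*) : ι → C → Matrix (Fin 1) (Fin 2) ℂ := fun _ _ => !![0, 1]

/-- The Higgs field `φ(q) = X₋ + q X₊`; its local expression on `U_α` is `φ_α(q) dz_α`. -/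
def higgs (q : ι → C → ℂ) (α : ι) (x : C) : Matrix (Fin 2) (Fin 2) ℂ :=
  Xminus + q α x • Xplus

/-- The connection matrices of `∇^ħ(q) = d - (1/ħ) φ(q)`. -/
def operForm (ħ : ℂ) (q : ι → C → ℂ) (α : ι) (x : C) : Matrix (Fin 2) (Fin 2) ℂ :=
  -((1 / ħ) • higgs q α x)

end Objects

end

open Set Filter Topology
open scoped Manifold ContDiff Matrix
set_option linter.unusedSectionVars false

section CoordinateCalculus

variable {C : Type*} [TopologicalSpace C] [ChartedSpace ℂ C] [IsManifold 𝓘(ℂ, ℂ) ω C] {ι : Type*}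
variable {F : Type*} [NormedAddCommGroup F] [NormedSpace ℂ F]
variable {e e' : OpenPartialHomeomorph C ℂ} {f g : C → F} {x : C} {V : Set C}

theorem mdifferentiableAt_coord (he : e ∈ IsManifold.maximalAtlas 𝓘(ℂ, ℂ) ω C)
    (hx : x ∈ e.source) : MDifferentiableAt 𝓘(ℂ, ℂ) 𝓘(ℂ, ℂ) e x :=
  (contMDiffAt_of_mem_maximalAtlas he hx).mdifferentiableAt (by simp)

theorem mdifferentiableAt_iff_coord (he : e ∈ IsManifold.maximalAtlas 𝓘(ℂ, ℂ) ω C)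
    (hx : x ∈ e.source) :
    MDifferentiableAt 𝓘(ℂ, ℂ) 𝓘(ℂ, F) f x ↔ DifferentiableAt ℂ (f ∘ e.symm) (e x) := by
  constructor
  · intro h
    rw [← mdifferentiableAt_iff_differentiableAt]
    refine MDifferentiableAt.comp (e x) (by rwa [e.left_inv hx]) ?_
    exact (contMDiffAt_symm_of_mem_maximalAtlas he (e.map_source hx)).mdifferentiableAt (by simp)
  · intro h
    have h1 : MDifferentiableAt 𝓘(ℂ, ℂ) 𝓘(ℂ, F) ((f ∘ e.symm) ∘ e) x :=
      MDifferentiableAt.comp x h.mdifferentiableAt (mdifferentiableAt_coord he hx)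
    refine h1.congr_of_eventuallyEq ?_
    filter_upwards [e.open_source.mem_nhds hx] with y hy
    simp [e.left_inv hy]

theorem HolOn.mdifferentiableAt (h : HolOn f V) (hV : IsOpen V) (hx : x ∈ V) :
    MDifferentiableAt 𝓘(ℂ, ℂ) 𝓘(ℂ, F) f x :=
  (h x hx).mdifferentiableAt (hV.mem_nhds hx)

theorem HolOn.differentiableAt (h : HolOn f V) (hV : IsOpen V) (hx : x ∈ V)
    (he : e ∈ IsManifold.maximalAtlas 𝓘(ℂ, ℂ) ω C) (hxe : x ∈ e.source) :
    DifferentiableAt ℂ (f ∘ e.symm) (e x) :=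
  (mdifferentiableAt_iff_coord he hxe).1 (h.mdifferentiableAt hV hx)

theorem holOn_of_differentiableAt
    (h : ∀ x ∈ V, ∃ e ∈ IsManifold.maximalAtlas 𝓘(ℂ, ℂ) ω C, x ∈ e.source ∧
      DifferentiableAt ℂ (f ∘ e.symm) (e x)) : HolOn f V := by
  intro x hx
  obtain ⟨e, he, hxe, hd⟩ := h x hx
  exact ((mdifferentiableAt_iff_coord he hxe).2 hd).mdifferentiableWithinAt

/-- Holomorphic functions are analytic in each coordinate. -/
theorem HolOn.analyticAt [CompleteSpace F] (h : HolOn f V) (hV : IsOpen V) (hx : x ∈ V)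
    (he : e ∈ IsManifold.maximalAtlas 𝓘(ℂ, ℂ) ω C) (hxe : x ∈ e.source) :
    AnalyticAt ℂ (f ∘ e.symm) (e x) := by
  have hopen : IsOpen (e.target ∩ e.symm ⁻¹' V) := e.isOpen_inter_preimage_symm hV
  refine DifferentiableOn.analyticAt (s := e.target ∩ e.symm ⁻¹' V) ?_
    (hopen.mem_nhds ⟨e.map_source hxe, by simpa [e.left_inv hxe] using hx⟩)
  intro w hw
  have h1 := h.differentiableAt hV hw.2 he (e.map_target hw.1)
  rw [e.right_inv hw.1] at h1
  exact h1.differentiableWithinAt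

theorem HolOn.mono {W : Set C} (h : HolOn f V) (hW : W ⊆ V) : HolOn f W :=
  MDifferentiableOn.mono h hW

theorem HolOn.continuousOn (h : HolOn f V) : ContinuousOn f V :=
  MDifferentiableOn.continuousOn h

theorem holOn_const (c : F) : HolOn (fun _ : C => c) V := fun _ _ => mdifferentiableWithinAt_const

theorem holOn_coord (he : e ∈ IsManifold.maximalAtlas 𝓘(ℂ, ℂ) ω C) : HolOn e e.source :=
  fun _ hx => (mdifferentiableAt_coord he hx).mdifferentiableWithinAt

theorem HolOn.comp_differentiable {G : Type*} [NormedAddCommGroup G] [NormedSpace ℂ G] {φ : F → G}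
    (h : HolOn f V) (hφ : ∀ x ∈ V, DifferentiableAt ℂ φ (f x)) : HolOn (fun x => φ (f x)) V :=
  fun x hx => MDifferentiableAt.comp_mdifferentiableWithinAt x
    (hφ x hx).mdifferentiableAt (h x hx)

theorem HolOn.congr' (h : HolOn f V) (hfg : ∀ x ∈ V, g x = f x) : HolOn g V :=
  MDifferentiableOn.congr h hfg

theorem HolOn.add (hf : HolOn f V) (hg : HolOn g V) : HolOn (fun x => f x + g x) V :=
  fun x hx => (hf x hx).add (hg x hx)

theorem HolOn.neg (hf : HolOn f V) : HolOn (fun x => -f x) V :=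
  fun x hx => (hf x hx).neg

theorem HolOn.sub (hf : HolOn f V) (hg : HolOn g V) : HolOn (fun x => f x - g x) V :=
  fun x hx => (hf x hx).sub (hg x hx)

theorem HolOn.const_smul (c : ℂ) (hf : HolOn f V) : HolOn (fun x => c • f x) V :=
  hf.comp_differentiable (φ := fun v => c • v) fun _ _ => by fun_prop

theorem HolOn.mul {f g : C → ℂ} (hf : HolOn f V) (hg : HolOn g V) :
    HolOn (fun x => f x * g x) V :=
  fun x hx => (hf x hx).mul (hg x hx)

theorem holOn_sum {κ : Type*} (S : Finset κ) {f : κ → C → F} (h : ∀ i ∈ S, HolOn (f i) V) :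
    HolOn (fun x => ∑ i ∈ S, f i x) V := by
  classical
  induction S using Finset.induction_on with
  | empty => simpa using holOn_const (0 : F)
  | insert a S ha ih =>
    simp only [Finset.sum_insert ha]
    exact (h a (by simp)).add (ih fun i hi => h i (by simp [hi]))

theorem HolOn.inv {f : C → ℂ} (hf : HolOn f V) (h0 : ∀ x ∈ V, f x ≠ 0) :
    HolOn (fun x => (f x)⁻¹) V :=
  hf.comp_differentiable (φ := fun v => v⁻¹) fun x hx => differentiableAt_inv (h0 x hx)

theorem HolOn.div {f g : C → ℂ} (hf : HolOn f V) (hg : HolOn g V) (h0 : ∀ x ∈ V, g x ≠ 0) :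
    HolOn (fun x => f x / g x) V := by
  simpa only [div_eq_mul_inv] using hf.mul (hg.inv h0)

theorem holOn_pi {n : Type*} [Fintype n] {s : C → n → ℂ} :
    HolOn s V ↔ ∀ i, HolOn (fun x => s x i) V := by
  constructor
  · intro h i
    exact h.comp_differentiable (φ := fun v : n → ℂ => v i) fun _ _ => by fun_prop
  · intro h
    classical
    have h1 : HolOn (fun x => ∑ i, s x i • (Pi.single i 1 : n → ℂ)) V := by
      refine holOn_sum _ fun i _ => ?_
      exact (h i).comp_differentiable (φ := fun c : ℂ => c • (Pi.single i 1 : n → ℂ))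
        fun _ _ => by fun_prop
    exact h1.congr' fun x _ => by
      ext j
      simp [Finset.sum_apply, Pi.single_apply]

/-! ### Derivatives with respect to a coordinate -/

theorem coordDeriv_congr (hx : x ∈ e.source) (h : f =ᶠ[𝓝 x] g) :
    coordDeriv e f x = coordDeriv e g x := by
  refine Filter.EventuallyEq.deriv_eq ?_
  have hc := (e.continuousAt_symm (e.map_source hx)).tendsto
  rw [e.left_inv hx] at hc
  exact hc.eventually h

theorem coordDeriv_congr_of_eqOn (hx : x ∈ e.source) (hV : IsOpen V) (hxV : x ∈ V)
    (h : ∀ y ∈ V, f y = g y) : coordDeriv e f x = coordDeriv e g x :=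
  coordDeriv_congr hx (eventually_of_mem (hV.mem_nhds hxV) h)

theorem coordDeriv_const (c : F) : coordDeriv e (fun _ => c) x = 0 := by
  simp [coordDeriv, Function.comp_def]

theorem coordDeriv_self (hx : x ∈ e.source) : coordDeriv e e x = 1 := by
  have h : (e ∘ e.symm) =ᶠ[𝓝 (e x)] id := by
    filter_upwards [e.open_target.mem_nhds (e.map_source hx)] with w hw
    simp [e.right_inv hw]
  rw [coordDeriv, h.deriv_eq, deriv_id]

section Rules

variable (he : e ∈ IsManifold.maximalAtlas 𝓘(ℂ, ℂ) ω C) (hx : x ∈ e.source)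

include he hx

theorem coordDeriv_add (hf : MDifferentiableAt 𝓘(ℂ, ℂ) 𝓘(ℂ, F) f x)
    (hg : MDifferentiableAt 𝓘(ℂ, ℂ) 𝓘(ℂ, F) g x) :
    coordDeriv e (fun y => f y + g y) x = coordDeriv e f x + coordDeriv e g x :=
  deriv_fun_add ((mdifferentiableAt_iff_coord he hx).1 hf) ((mdifferentiableAt_iff_coord he hx).1 hg)

theorem coordDeriv_sub (hf : MDifferentiableAt 𝓘(ℂ, ℂ) 𝓘(ℂ, F) f x)
    (hg : MDifferentiableAt 𝓘(ℂ, ℂ) 𝓘(ℂ, F) g x) :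
    coordDeriv e (fun y => f y - g y) x = coordDeriv e f x - coordDeriv e g x :=
  deriv_fun_sub ((mdifferentiableAt_iff_coord he hx).1 hf) ((mdifferentiableAt_iff_coord he hx).1 hg)

theorem coordDeriv_mul {f g : C → ℂ} (hf : MDifferentiableAt 𝓘(ℂ, ℂ) 𝓘(ℂ, ℂ) f x)
    (hg : MDifferentiableAt 𝓘(ℂ, ℂ) 𝓘(ℂ, ℂ) g x) :
    coordDeriv e (fun y => f y * g y) x = coordDeriv e f x * g x + f x * coordDeriv e g x := by
  have h := deriv_fun_mul ((mdifferentiableAt_iff_coord he hx).1 hf)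
    ((mdifferentiableAt_iff_coord he hx).1 hg)
  simpa [coordDeriv, Function.comp_def, e.left_inv hx] using h

theorem coordDeriv_inv {f : C → ℂ} (hf : MDifferentiableAt 𝓘(ℂ, ℂ) 𝓘(ℂ, ℂ) f x) (h0 : f x ≠ 0) :
    coordDeriv e (fun y => (f y)⁻¹) x = -coordDeriv e f x / f x ^ 2 := by
  have h := deriv_fun_inv'' ((mdifferentiableAt_iff_coord he hx).1 hf)
    (by simpa [e.left_inv hx] using h0)
  simpa [coordDeriv, Function.comp_def, e.left_inv hx] using h

theorem coordDeriv_apply {n : Type*} [Fintype n] {s : C → n → ℂ}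
    (hs : MDifferentiableAt 𝓘(ℂ, ℂ) 𝓘(ℂ, n → ℂ) s x) (i : n) :
    coordDeriv e s x i = coordDeriv e (fun y => s y i) x := by
  have h := (mdifferentiableAt_iff_coord he hx).1 hs
  exact congrFun (deriv_pi fun i => (differentiableAt_pi.1 h) i) i

omit hx in
theorem coordDeriv_comp (he' : e' ∈ IsManifold.maximalAtlas 𝓘(ℂ, ℂ) ω C)
    (hx : x ∈ e.source) (hx' : x ∈ e'.source) (hf : MDifferentiableAt 𝓘(ℂ, ℂ) 𝓘(ℂ, F) f x) :
    coordDeriv e f x = coordDeriv e e' x • coordDeriv e' f x := by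
  have h1 := ((mdifferentiableAt_iff_coord he' hx').1 hf).hasDerivAt
  have h2 := ((mdifferentiableAt_iff_coord he hx).1 (mdifferentiableAt_coord he' hx')).hasDerivAt
  have h3 : HasDerivAt (f ∘ e'.symm) (deriv (f ∘ e'.symm) (e' x)) ((e' ∘ e.symm) (e x)) := by
    simpa [e.left_inv hx] using h1
  have h4 := h3.scomp (e x) h2
  have h5 : (f ∘ e'.symm) ∘ (e' ∘ e.symm) =ᶠ[𝓝 (e x)] f ∘ e.symm := by
    have hc := (e.continuousAt_symm (e.map_source hx)).tendsto
    rw [e.left_inv hx] at hc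
    filter_upwards [hc.eventually (e'.open_source.mem_nhds hx')] with w hw
    simp [e'.left_inv hw]
  rw [coordDeriv, ← h5.deriv_eq, h4.deriv]
  rfl

end Rules

theorem HolOn.coordDeriv [CompleteSpace F] (h : HolOn f V) (hV : IsOpen V)
    (he : e ∈ IsManifold.maximalAtlas 𝓘(ℂ, ℂ) ω C) : HolOn (coordDeriv e f) (V ∩ e.source) := by
  refine holOn_of_differentiableAt fun x hx => ⟨e, he, hx.2, ?_⟩
  have h1 := (h.analyticAt hV hx.1 he hx.2).deriv.differentiableAt
  refine h1.congr_of_eventuallyEq ?_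
  filter_upwards [e.open_target.mem_nhds (e.map_source hx.2)] with w hw
  simp [_root_.coordDeriv, e.right_inv hw]

end CoordinateCalculus

section Cocycles

variable {C : Type*} [TopologicalSpace C] [ChartedSpace ℂ C] [IsManifold 𝓘(ℂ, ℂ) ω C] {ι : Type*}
variable {z : ι → OpenPartialHomeomorph C ℂ} (hz : IsCoordinateSystem z) {ξ : ι → ι → C → ℂ}
variable {x : C}

include hz

theorem coordDeriv_change {F : Type*} [NormedAddCommGroup F] [NormedSpace ℂ F] {f : C → F}
    {α β : ι} (hα : x ∈ (z α).source) (hβ : x ∈ (z β).source)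
    (hf : MDifferentiableAt 𝓘(ℂ, ℂ) 𝓘(ℂ, F) f x) :
    coordDeriv (z α) f x = canonicalCocycle z α β x • coordDeriv (z β) f x :=
  coordDeriv_comp (hz.holomorphic α) (hz.holomorphic β) hα hβ hf

theorem canonicalCocycle_mul {α β γ : ι} (hα : x ∈ (z α).source) (hβ : x ∈ (z β).source)
    (hγ : x ∈ (z γ).source) :
    canonicalCocycle z α β x * canonicalCocycle z β γ x = canonicalCocycle z α γ x :=
  (coordDeriv_change hz hα hβ (mdifferentiableAt_coord (hz.holomorphic γ) hγ)).symm

omit hz in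
theorem canonicalCocycle_self {α : ι} (hα : x ∈ (z α).source) :
    canonicalCocycle z α α x = 1 :=
  coordDeriv_self hα

theorem canonicalCocycle_ne_zero {α β : ι} (hα : x ∈ (z α).source) (hβ : x ∈ (z β).source) :
    canonicalCocycle z α β x ≠ 0 := by
  intro h
  have h1 := canonicalCocycle_mul hz hα hβ hα
  rw [h, zero_mul, canonicalCocycle_self hα] at h1
  exact zero_ne_one h1

theorem holOn_canonicalCocycle (α β : ι) :
    HolOn (canonicalCocycle z α β) ((z α).source ∩ (z β).source) := by
  have h := (holOn_coord (hz.holomorphic β)).coordDeriv (z β).open_source (hz.holomorphic α)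
  rwa [inter_comm] at h

variable (hξ : IsThetaCharacteristic z ξ)

include hξ

theorem theta_ne_zero {α β : ι} (hx : x ∈ (z α).source ∩ (z β).source) : ξ α β x ≠ 0 := by
  intro h
  have h1 := hξ.sq α β x hx
  rw [h] at h1
  exact canonicalCocycle_ne_zero hz hx.1 hx.2 (by simpa using h1.symm)

theorem theta_self {α : ι} (hx : x ∈ (z α).source) : ξ α α x = 1 := by
  have h1 := hξ.cocycle α α α x ⟨⟨hx, hx⟩, hx⟩
  have h0 := theta_ne_zero hz hξ (α := α) (β := α) ⟨hx, hx⟩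
  exact mul_left_cancel₀ h0 (by rw [h1, mul_one])

theorem theta_inv {α β : ι} (hx : x ∈ (z α).source ∩ (z β).source) :
    ξ β α x = (ξ α β x)⁻¹ := by
  have h1 := hξ.cocycle α β α x ⟨hx, hx.1⟩
  rw [theta_self hz hξ hx.1] at h1
  exact (inv_eq_of_mul_eq_one_right h1).symm

omit hz in
theorem theta_mdifferentiableAt {α β : ι} (hx : x ∈ (z α).source ∩ (z β).source) :
    MDifferentiableAt 𝓘(ℂ, ℂ) 𝓘(ℂ, ℂ) (ξ α β) x :=
  (hξ.holomorphic α β).mdifferentiableAt ((z α).open_source.inter (z β).open_source) hx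

theorem holOn_dlogTheta (α β : ι) :
    HolOn (dlogTheta z ξ α β) ((z α).source ∩ (z β).source) := by
  have ho := (z α).open_source.inter (z β).open_source
  refine HolOn.div ?_ (hξ.holomorphic α β) fun x hx => theta_ne_zero hz hξ hx
  exact ((hξ.holomorphic α β).coordDeriv ho (hz.holomorphic β)).mono fun x hx => ⟨hx, hx.2⟩

theorem dlogTheta_cocycle {α β γ : ι}
    (hx : x ∈ (z α).source ∩ (z β).source ∩ (z γ).source) :
    dlogTheta z ξ α γ x = canonicalCocycle z γ β x * dlogTheta z ξ α β x + dlogTheta z ξ β γ x := by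
  obtain ⟨⟨hα, hβ⟩, hγ⟩ := hx
  have ho := (((z α).open_source.inter (z β).open_source).inter (z γ).open_source)
  have h1 : coordDeriv (z γ) (ξ α γ) x = coordDeriv (z γ) (fun y => ξ α β y * ξ β γ y) x :=
    coordDeriv_congr_of_eqOn hγ ho ⟨⟨hα, hβ⟩, hγ⟩ fun y hy => (hξ.cocycle α β γ y hy).symm
  have d1 := theta_mdifferentiableAt hξ (α := α) (β := β) ⟨hα, hβ⟩
  have d2 := theta_mdifferentiableAt hξ (α := β) (β := γ) ⟨hβ, hγ⟩
  rw [coordDeriv_mul (hz.holomorphic γ) hγ d1 d2, coordDeriv_change hz hγ hβ d1] at h1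
  have n1 := theta_ne_zero hz hξ (α := α) (β := β) ⟨hα, hβ⟩
  have n2 := theta_ne_zero hz hξ (α := β) (β := γ) ⟨hβ, hγ⟩
  rw [dlogTheta, h1, ← hξ.cocycle α β γ x ⟨⟨hα, hβ⟩, hγ⟩, dlogTheta, dlogTheta]
  simp only [smul_eq_mul]
  field_simp

end Cocycles

section Planar

open MeasureTheory Complex

/-- The operator `2 ∂/∂z̄` on functions on the plane. -/
noncomputable def dbar (f : ℂ → ℂ) (w : ℂ) : ℂ :=
  fderiv ℝ f w 1 + I * fderiv ℝ f w I

variable {f g h : ℂ → ℂ} {w p : ℂ}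

theorem dbar_congr (hfg : f =ᶠ[𝓝 w] g) : dbar f w = dbar g w := by
  rw [dbar, dbar, hfg.fderiv_eq]

theorem dbar_const (c : ℂ) : dbar (fun _ => c) w = 0 := by simp [dbar]

theorem dbar_sub (hf : DifferentiableAt ℝ f w) (hg : DifferentiableAt ℝ g w) :
    dbar (fun v => f v - g v) w = dbar f w - dbar g w := by
  simp only [dbar, fderiv_fun_sub hf hg, _root_.sub_apply]
  ring

theorem dbar_sum {κ : Type*} (S : Finset κ) {f : κ → ℂ → ℂ}
    (hf : ∀ i ∈ S, DifferentiableAt ℝ (f i) w) :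
    dbar (fun v => ∑ i ∈ S, f i v) w = ∑ i ∈ S, dbar (f i) w := by
  simp only [dbar, fderiv_fun_sum hf, _root_.sum_apply, Finset.mul_sum,
    Finset.sum_add_distrib]

theorem dbar_mul_const (c : ℂ) (hf : DifferentiableAt ℝ f w) :
    dbar (fun v => c * f v) w = c * dbar f w := by
  simp only [dbar, fderiv_const_mul hf, _root_.smul_apply, smul_eq_mul]
  ring

theorem dbar_mul_holomorphic (hf : DifferentiableAt ℝ f w) (hh : DifferentiableAt ℂ h w) :
    dbar (fun v => f v * h v) w = dbar f w * h w := by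
  have h1 : fderiv ℝ h w = (fderiv ℂ h w).restrictScalars ℝ := hh.fderiv_restrictScalars ℝ
  have h2 : fderiv ℂ h w I = I * fderiv ℂ h w 1 := by
    rw [← smul_eq_mul, ← map_smul]; simp
  simp only [dbar, fderiv_fun_mul hf (hh.restrictScalars ℝ), _root_.add_apply,
    _root_.smul_apply, smul_eq_mul, h1, ContinuousLinearMap.coe_restrictScalars', h2]
  linear_combination f w * fderiv ℂ h w 1 * I_mul_I

theorem dbar_comp_holomorphic {T : ℂ → ℂ} (hf : DifferentiableAt ℝ f (T w))
    (hT : DifferentiableAt ℂ T w) :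
    dbar (f ∘ T) w = dbar f (T w) * (starRingEnd ℂ) (deriv T w) := by
  have h1 : fderiv ℝ T w = (fderiv ℂ T w).restrictScalars ℝ := hT.fderiv_restrictScalars ℝ
  have key : ∀ c : ℂ, fderiv ℝ f (T w) c
      = c.re * fderiv ℝ f (T w) 1 + c.im * fderiv ℝ f (T w) I := by
    intro c
    have : c = c.re • (1 : ℂ) + c.im • I := by
      simp
    conv_lhs => rw [this]
    rw [map_add, map_smul, map_smul]
    simp
  have h2 : ∀ v, fderiv ℂ T w v = v * deriv T w := by
    intro v
    rw [fderiv_eq_smul_deriv, smul_eq_mul]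
  rw [dbar, fderiv_comp w hf (hT.restrictScalars ℝ), h1]
  simp only [ContinuousLinearMap.comp_apply, ContinuousLinearMap.coe_restrictScalars', h2]
  rw [key (1 * _), key (I * _), dbar]
  have h3 : (starRingEnd ℂ) (deriv T w) = (deriv T w).re - (deriv T w).im * I := by
    apply Complex.ext <;> simp
  rw [h3]
  simp only [one_mul, mul_re, I_re, zero_mul, I_im, zero_sub, mul_im, zero_add]
  push_cast
  linear_combination
    (fderiv ℝ f (T w) I * (deriv T w).im) * I_mul_I

theorem dbar_eq_zero_of_notMem_tsupport (hw : w ∉ tsupport f) : dbar f w = 0 := by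
  rw [dbar_congr (notMem_tsupport_iff_eventuallyEq.1 hw)]
  exact dbar_const 0

theorem tsupport_dbar_subset : tsupport (dbar f) ⊆ tsupport f := by
  refine closure_minimal (fun w hw => ?_) (isClosed_tsupport f)
  by_contra h
  exact hw (dbar_eq_zero_of_notMem_tsupport h)

theorem HasCompactSupport.dbar (hf : HasCompactSupport f) : HasCompactSupport (dbar f) :=
  hf.mono' (subset_closure.trans tsupport_dbar_subset)

theorem ContDiff.continuous_dbar (hf : ContDiff ℝ 1 f) : Continuous (dbar f) := by
  have := hf.continuous_fderiv one_ne_zero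
  unfold _root_.dbar
  fun_prop

theorem integral_dbar_eq_zero (hf : ContDiff ℝ 1 f) (hs : HasCompactSupport f) :
    ∫ w, dbar f w = 0 := by
  have hc := hf.continuous_fderiv one_ne_zero
  have hi : ∀ v, Integrable (fun w => fderiv ℝ f w v) := fun v =>
    (Continuous.integrable_of_hasCompactSupport (by fun_prop)
      ((hs.fderiv (𝕜 := ℝ)).comp_left (g := fun L : ℂ →L[ℝ] ℂ => L v) (by simp)))
  have hif : Integrable f := hf.continuous.integrable_of_hasCompactSupport hs
  have h0 : ∀ v, ∫ w, fderiv ℝ f w v = 0 := by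
    intro v
    have := integral_smul_fderiv_eq_neg_fderiv_smul_of_integrable (μ := volume) (𝕜 := ℝ)
      (f := fun _ : ℂ => (1 : ℝ)) (g := f) (v := v) (by simp) (by simpa using hi v)
      (by simpa using hif) (by fun_prop) (fun x _ => (hf.differentiable one_ne_zero) x)
    simpa using this
  simp only [dbar]
  rw [integral_add (hi 1) ((hi I).const_mul I), integral_const_mul, h0, h0]
  simp

theorem det_holomorphic (c : ℂ) :
    ((c • (1 : ℂ →L[ℂ] ℂ)).restrictScalars ℝ).det = ‖c‖ ^ 2 := by
  have h : (((c • (1 : ℂ →L[ℂ] ℂ)).restrictScalars ℝ : ℂ →L[ℝ] ℂ) : ℂ →ₗ[ℝ] ℂ)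
      = (c • (1 : ℂ →ₗ[ℂ] ℂ)).restrictScalars ℝ := rfl
  rw [ContinuousLinearMap.det, h, LinearMap.det_restrictScalars]
  simp [Algebra.norm_complex_eq, Complex.normSq_eq_norm_sq]

/-- Holomorphic change of variables. -/
theorem integral_image_holomorphic {T : ℂ → ℂ} {s : Set ℂ} (hs : IsOpen s)
    (hT : DifferentiableOn ℂ T s) (hinj : InjOn T s) (g : ℂ → ℂ) :
    ∫ w in T '' s, g w = ∫ w in s, (deriv T w * (starRingEnd ℂ) (deriv T w)) * g (T w) := by
  have hd : ∀ w ∈ s, HasFDerivWithinAt T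
      ((deriv T w • (1 : ℂ →L[ℂ] ℂ)).restrictScalars ℝ) s w := by
    intro w hw
    have h1 := (hT.differentiableAt (hs.mem_nhds hw)).hasDerivAt.hasFDerivAt
    have h2 : (deriv T w • (1 : ℂ →L[ℂ] ℂ)) = ContinuousLinearMap.toSpanSingleton ℂ (deriv T w) := by
      ext; simp
    rw [h2]
    exact (h1.restrictScalars ℝ).hasFDerivWithinAt
  rw [integral_image_eq_integral_abs_det_fderiv_smul volume hs.measurableSet hd hinj]
  refine setIntegral_congr_fun hs.measurableSet fun w _ => ?_
  simp only [det_holomorphic, mul_conj, normSq_eq_norm_sq, abs_pow, abs_norm, real_smul]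

/-- A radial bump function: `1` on the disc of radius `r`, supported in the disc of radius
`√2 r`. -/
noncomputable def radialBump (p : ℂ) (r : ℝ) (w : ℂ) : ℂ :=
  (Real.smoothTransition (2 - (‖w - p‖ / r) ^ 2) : ℝ)

theorem contDiff_radialBump (p : ℂ) (r : ℝ) : ContDiff ℝ 1 (radialBump p r) := by
  have h : ContDiff ℝ 1 fun w : ℂ => Real.smoothTransition (2 - (‖w - p‖ / r) ^ 2) := by
    refine Real.smoothTransition.contDiff.comp ?_
    simp only [div_pow]
    exact contDiff_const.sub (((contDiff_id.sub contDiff_const).norm_sq ℝ).div_const _)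
  exact ofRealCLM.contDiff.comp h

theorem radialBump_eq_one {r : ℝ} (hr : 0 < r) (hw : ‖w - p‖ ≤ r) : radialBump p r w = 1 := by
  have h1 : (‖w - p‖ / r) ^ 2 ≤ 1 := pow_le_one₀ (by positivity) ((div_le_one hr).2 hw)
  rw [radialBump, Real.smoothTransition.one_of_one_le (by linarith)]
  simp

theorem radialBump_eq_zero {r : ℝ} (hr : 0 < r) (hw : 2 * r ≤ ‖w - p‖) :
    radialBump p r w = 0 := by
  have h1 : 2 ≤ ‖w - p‖ / r := (le_div_iff₀ hr).2 hw
  rw [radialBump, Real.smoothTransition.zero_of_nonpos (by nlinarith)]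
  simp

theorem tsupport_radialBump_subset {r : ℝ} (hr : 0 < r) :
    tsupport (radialBump p r) ⊆ Metric.closedBall p (2 * r) := by
  refine closure_minimal (fun w hw => ?_) Metric.isClosed_closedBall
  rw [Metric.mem_closedBall, dist_eq_norm]
  by_contra h
  exact hw (radialBump_eq_zero hr (not_le.1 h).le)

theorem hasCompactSupport_radialBump {r : ℝ} (hr : 0 < r) : HasCompactSupport (radialBump p r) :=
  (isCompact_closedBall p (2 * r)).of_isClosed_subset (isClosed_tsupport _)
    (tsupport_radialBump_subset hr)

theorem integral_dbar_radialBump_div (p : ℂ) :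
    ∫ w, dbar (radialBump p 1) w / (w - p) = -(2 * Real.pi) := by
  set φ : ℝ → ℝ := fun s => deriv Real.smoothTransition (2 - s) with hφ
  have hst : Differentiable ℝ Real.smoothTransition :=
    (Real.smoothTransition.contDiff (n := 1)).differentiable one_ne_zero
  have h1 : ∀ w, dbar (radialBump p 1) w / (w - p)
      = (fun v : ℂ => ((-2 * φ (‖v‖ ^ 2) : ℝ) : ℂ)) (w - p) := by
    intro w
    have hd : HasFDerivAt (radialBump p 1)
        (ofRealCLM.comp ((deriv Real.smoothTransition (2 - ‖w - p‖ ^ 2)) •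
          (-(2 • (innerSL ℝ (w - p)))))) w := by
      have a1 : HasFDerivAt (fun v : ℂ => 2 - ‖v - p‖ ^ 2) (-(2 • (innerSL ℝ (w - p)))) w := by
        have := ((hasFDerivAt_id w).sub_const p).norm_sq
        simpa using this.const_sub 2
      have a2 := (hst (2 - ‖w - p‖ ^ 2)).hasDerivAt.comp_hasFDerivAt w a1
      have a3 := ofRealCLM.hasFDerivAt.comp w a2
      refine a3.congr_of_eventuallyEq (Eventually.of_forall fun v => ?_)
      simp [radialBump]
    by_cases hw : w - p = 0
    · have : φ 0 = 0 := by
        have hloc : Real.smoothTransition =ᶠ[𝓝 2] fun _ => 1 := by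
          filter_upwards [lt_mem_nhds (show (1 : ℝ) < 2 by norm_num)] with s hs
          exact Real.smoothTransition.one_of_one_le hs.le
        simp [hφ, hloc.deriv_eq]
      simp [hw, this]
    · rw [dbar, hd.fderiv, div_eq_iff hw]
      have hin1 : inner ℝ (w - p) (1 : ℂ) = (w - p).re := by
        simp [Complex.inner]
      have hin2 : inner ℝ (w - p) I = (w - p).im := by
        simp [Complex.inner]
        ring
      simp only [ContinuousLinearMap.comp_apply, _root_.smul_apply,
        _root_.neg_apply, innerSL_apply_apply, hin1, hin2, ofRealCLM_apply, hφ]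
      simp only [smul_eq_mul, nsmul_eq_mul]
      push_cast
      linear_combination
        (-2 * ((deriv Real.smoothTransition (2 - ‖w - p‖ ^ 2) : ℝ) : ℂ)) * re_add_im (w - p)
  simp_rw [h1]
  rw [integral_sub_right_eq_self (μ := volume) (fun v : ℂ => ((-2 * φ (‖v‖ ^ 2) : ℝ) : ℂ)) p,
    integral_complex_ofReal,
    integral_fun_norm_addHaar volume (fun y : ℝ => -2 * φ (y ^ 2))]
  have hF : ContDiff ℝ 1 (fun y : ℝ => Real.smoothTransition (2 - y ^ 2)) :=
    Real.smoothTransition.contDiff.comp (contDiff_const.sub (contDiff_id.pow 2))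
  have hFs : HasCompactSupport (fun y : ℝ => Real.smoothTransition (2 - y ^ 2)) := by
    refine HasCompactSupport.of_support_subset_isCompact (isCompact_closedBall (0 : ℝ) 2) ?_
    intro y hy
    by_contra hc
    refine hy (Real.smoothTransition.zero_of_nonpos ?_)
    rw [Metric.mem_closedBall, dist_zero_right, Real.norm_eq_abs] at hc
    nlinarith [sq_abs y]
  have hI := hFs.integral_Ioi_deriv_eq hF 0
  have hder : ∀ y : ℝ, deriv (fun y : ℝ => Real.smoothTransition (2 - y ^ 2)) y
      = y * (-2 * φ (y ^ 2)) := by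
    intro y
    have a1 : HasDerivAt (fun y : ℝ => 2 - y ^ 2) (-(2 * y)) y := by
      simpa using (hasDerivAt_pow 2 y).const_sub 2
    have := (hst (2 - y ^ 2)).hasDerivAt.comp y a1
    rw [show (fun y : ℝ => Real.smoothTransition (2 - y ^ 2))
      = Real.smoothTransition ∘ fun y : ℝ => 2 - y ^ 2 from rfl, this.deriv]
    simp only [hφ]
    ring
  simp_rw [hder] at hI
  have hv : (volume : Measure ℂ).real (Metric.ball 0 1) = Real.pi := by
    simp [Measure.real]
  simp only [finrank_real_complex, hv, Nat.add_one_sub_one, pow_one, smul_eq_mul, hI]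
  rw [Real.smoothTransition.one_of_one_le (by norm_num)]
  simp

theorem dbar_div_sub (hf : ContDiff ℝ 1 f) (hp : f =ᶠ[𝓝 p] 0) (w : ℂ) :
    dbar (fun v => f v / (v - p)) w = dbar f w / (w - p) := by
  by_cases hw : w = p
  · subst hw
    have h2 : (fun v => f v / (v - w)) =ᶠ[𝓝 w] fun _ => 0 := by
      filter_upwards [hp] with v hv
      simp [hv]
    rw [dbar_congr h2, dbar_const]
    simp
  · simp only [div_eq_mul_inv]
    rw [dbar_mul_holomorphic (h := fun v => (v - p)⁻¹) (hf.differentiable one_ne_zero w)]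
    exact (differentiableAt_id.sub_const p).inv (sub_ne_zero.2 hw)

theorem contDiff_div_sub (hf : ContDiff ℝ 1 f) (hp : f =ᶠ[𝓝 p] 0) :
    ContDiff ℝ 1 (fun v => f v / (v - p)) := by
  rw [contDiff_iff_contDiffAt]
  intro w
  by_cases hw : w = p
  · subst hw
    have h2 : (fun v => f v / (v - w)) =ᶠ[𝓝 w] fun _ => 0 := by
      filter_upwards [hp] with v hv
      simp [hv]
    exact contDiffAt_const.congr_of_eventuallyEq h2
  · simp only [div_eq_mul_inv]
    exact hf.contDiffAt.mul ((contDiffAt_id.sub contDiffAt_const).inv (sub_ne_zero.2 hw))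

theorem integrable_dbar_div_sub (hf : ContDiff ℝ 1 f) (hs : HasCompactSupport f) {c : ℂ}
    (hp : ∀ᶠ w in 𝓝 p, f w = c) : Integrable fun w => dbar f w / (w - p) := by
  refine Continuous.integrable_of_hasCompactSupport ?_ ?_
  · rw [continuous_iff_continuousAt]
    intro w
    by_cases hw : w = p
    · subst hw
      have : (fun v => dbar f v / (v - w)) =ᶠ[𝓝 w] fun _ => 0 := by
        filter_upwards [eventually_eventually_nhds.2 hp] with v hv
        rw [dbar_congr (g := fun _ => c) hv, dbar_const, zero_div]
      exact continuousAt_const.congr this.symm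
    · exact hf.continuous_dbar.continuousAt.div (continuousAt_id.sub continuousAt_const)
        (sub_ne_zero.2 hw)
  · simp only [div_eq_mul_inv]
    exact hs.dbar.mul_right

/-- The Cauchy–Pompeiu formula for functions that are constant near `p`. -/
theorem integral_dbar_div_sub (hf : ContDiff ℝ 1 f) (hs : HasCompactSupport f)
    (hp : ∀ᶠ w in 𝓝 p, f w = f p) : ∫ w, dbar f w / (w - p) = -(2 * Real.pi) * f p := by
  set b := radialBump p 1
  have hb := contDiff_radialBump p 1
  have hbs : HasCompactSupport b := hasCompactSupport_radialBump one_pos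
  have hbp : ∀ᶠ w in 𝓝 p, b w = 1 := by
    filter_upwards [Metric.closedBall_mem_nhds p one_pos] with w hw
    exact radialBump_eq_one one_pos (by rwa [← dist_eq_norm])
  set g : ℂ → ℂ := fun w => f w - f p * b w with hg
  have hgc : ContDiff ℝ 1 g := hf.sub (contDiff_const.mul hb)
  have hgs : HasCompactSupport g := hs.sub (hbs.mul_left)
  have hgp : g =ᶠ[𝓝 p] 0 := by
    filter_upwards [hp, hbp] with w h1 h2
    simp [hg, h1, h2]
  have h1 : ∫ w, dbar g w / (w - p) = 0 := by
    simp_rw [← dbar_div_sub hgc hgp]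
    refine integral_dbar_eq_zero (contDiff_div_sub hgc hgp) ?_
    simp only [div_eq_mul_inv]
    exact hgs.mul_right
  have h2 : ∀ w, dbar g w / (w - p) = dbar f w / (w - p) - f p * (dbar b w / (w - p)) := by
    intro w
    rw [hg, dbar_sub (hf.differentiable one_ne_zero w)
      ((contDiff_const.mul hb).differentiable one_ne_zero w),
      dbar_mul_const _ (hb.differentiable one_ne_zero w)]
    ring
  simp_rw [h2] at h1
  rw [integral_sub (integrable_dbar_div_sub hf hs hp)
    ((integrable_dbar_div_sub hb hbs hbp).const_mul _), integral_const_mul,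
    integral_dbar_radialBump_div] at h1
  linear_combination h1

theorem contDiff_mul_of_tsupport_subset {U : Set ℂ} (hU : IsOpen U) (hf : ContDiff ℝ 1 f)
    (hfU : tsupport f ⊆ U) (hh : ContDiffOn ℝ 1 h U) : ContDiff ℝ 1 fun w => f w * h w := by
  rw [contDiff_iff_contDiffAt]
  intro w
  by_cases hw : w ∈ tsupport f
  · exact hf.contDiffAt.mul (hh.contDiffAt (hU.mem_nhds (hfU hw)))
  · have : (fun v => f v * h v) =ᶠ[𝓝 w] fun _ => 0 := by
      filter_upwards [notMem_tsupport_iff_eventuallyEq.1 hw] with v hv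
      simp [hv]
    exact contDiffAt_const.congr_of_eventuallyEq this

/-- The residue formula in the plane: `θ` is a form with a simple pole at `p`, of residue `r`, and
`f` is a test function that is constant near `p`. -/
theorem integral_dbar_mul_simplePole {U : Set ℂ} (hU : IsOpen U) (hf : ContDiff ℝ 1 f)
    (hs : HasCompactSupport f) (hfU : tsupport f ⊆ U) (hp : ∀ᶠ w in 𝓝 p, f w = f p)
    {θ : ℂ → ℂ} {r : ℂ} (hh : DifferentiableOn ℂ h U)
    (hθ : ∀ w ∈ U, w ≠ p → θ w = r / (w - p) + h w) :
    ∫ w, dbar f w * θ w = -(2 * Real.pi) * (r * f p) := by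
  have hp0 : dbar f p = 0 := by rw [dbar_congr (g := fun _ => f p) hp, dbar_const]
  have hhR : ContDiffOn ℝ 1 h U :=
    ((hh.contDiffOn (n := 1) hU).restrict_scalars ℝ)
  have hc := contDiff_mul_of_tsupport_subset hU hf hfU hhR
  have h1 : ∀ w, dbar f w * θ w
      = dbar (fun v => f v * h v) w + r * (dbar f w / (w - p)) := by
    intro w
    by_cases hw : w ∈ tsupport f
    · rw [dbar_mul_holomorphic (hf.differentiable one_ne_zero w)
        (hh.differentiableAt (hU.mem_nhds (hfU hw)))]
      by_cases hwp : w = p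
      · simp [hwp, hp0]
      · rw [hθ w (hfU hw) hwp]
        ring
    · have hw' : w ∉ tsupport fun v => f v * h v := fun h' => hw (tsupport_mul_subset_left h')
      rw [dbar_eq_zero_of_notMem_tsupport hw, dbar_eq_zero_of_notMem_tsupport hw']
      simp
  have hi1 : Integrable (dbar fun v => f v * h v) :=
    hc.continuous_dbar.integrable_of_hasCompactSupport hs.mul_right.dbar
  simp_rw [h1]
  rw [integral_add hi1 ((integrable_dbar_div_sub hf hs hp).const_mul r), integral_dbar_eq_zero hc hs.mul_right,
    integral_const_mul, integral_dbar_div_sub hf hs hp]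
  ring

end Planar

section Residues

open MeasureTheory

variable {C : Type*} [TopologicalSpace C] [ChartedSpace ℂ C] [IsManifold 𝓘(ℂ, ℂ) ω C] {ι : Type*}
variable {z : ι → OpenPartialHomeomorph C ℂ}

theorem differentiableAt_transition {e e' : OpenPartialHomeomorph C ℂ}
    (he : e ∈ IsManifold.maximalAtlas 𝓘(ℂ, ℂ) ω C)
    (he' : e' ∈ IsManifold.maximalAtlas 𝓘(ℂ, ℂ) ω C) {x : C} (hx : x ∈ e.source)
    (hx' : x ∈ e'.source) : AnalyticAt ℂ (e' ∘ e.symm) (e x) :=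
  (holOn_coord he').analyticAt e'.open_source hx' he hx

/-- Test functions on `C`: continuously differentiable functions which are constant near each point
of `S`. -/
structure IsTestFunction (z : ι → OpenPartialHomeomorph C ℂ) (S : Finset C) (f : C → ℂ) :
    Prop where
  contDiffAt : ∀ α, ∀ w ∈ (z α).target, ContDiffAt ℝ 1 (f ∘ (z α).symm) w
  eventually_eq : ∀ s ∈ S, ∀ᶠ x in 𝓝 s, f x = f s

namespace IsTestFunction

variable {S : Finset C} {f g : C → ℂ}

theorem const (c : ℂ) : IsTestFunction z S fun _ => c :=
  ⟨fun _ _ _ => contDiffAt_const, fun _ _ => by simp⟩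

theorem mul (hf : IsTestFunction z S f) (hg : IsTestFunction z S g) :
    IsTestFunction z S fun x => f x * g x :=
  ⟨fun α w hw => (hf.contDiffAt α w hw).mul (hg.contDiffAt α w hw), fun s hs => by
    filter_upwards [hf.eventually_eq s hs, hg.eventually_eq s hs] with x h1 h2
    rw [h1, h2]⟩

theorem sub (hf : IsTestFunction z S f) (hg : IsTestFunction z S g) :
    IsTestFunction z S fun x => f x - g x :=
  ⟨fun α w hw => (hf.contDiffAt α w hw).sub (hg.contDiffAt α w hw), fun s hs => by
    filter_upwards [hf.eventually_eq s hs, hg.eventually_eq s hs] with x h1 h2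
    rw [h1, h2]⟩

theorem prod {κ : Type*} (t : Finset κ) {f : κ → C → ℂ}
    (hf : ∀ i ∈ t, IsTestFunction z S (f i)) : IsTestFunction z S fun x => ∏ i ∈ t, f i x := by
  classical
  induction t using Finset.induction_on with
  | empty => simpa using const 1
  | insert a t ha ih =>
    simp only [Finset.prod_insert ha]
    exact (hf a (by simp)).mul (ih fun i hi => hf i (by simp [hi]))

theorem dbar_eq_zero (hf : IsTestFunction z S f) {α : ι} {w : ℂ} (hw : w ∈ (z α).target)
    (hs : (z α).symm w ∈ S) : ∀ᶠ v in 𝓝 w, dbar (f ∘ (z α).symm) v = 0 := by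
  have h2 : ∀ᶠ v in 𝓝 w, ∀ᶠ u in 𝓝 v, f ((z α).symm u) = f ((z α).symm w) :=
    eventually_eventually_nhds.2
      (((z α).continuousAt_symm hw).tendsto.eventually (hf.eventually_eq _ hs))
  exact h2.mono fun v hv =>
    (dbar_congr (g := fun _ => f ((z α).symm w)) hv).trans (dbar_const _)

theorem continuousOn_dbar (hf : IsTestFunction z S f) (α : ι) :
    ContinuousOn (dbar (f ∘ (z α).symm)) (z α).target := by
  have h1 : ContDiffOn ℝ 1 (f ∘ (z α).symm) (z α).target := fun w hw =>
    (hf.contDiffAt α w hw).contDiffWithinAt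
  have h2 := h1.continuousOn_fderiv_of_isOpen (z α).open_target le_rfl
  unfold dbar
  fun_prop

/-- `∂̄ f ∧ θ` is continuous, even if `θ` has poles in `S`. -/
theorem continuousOn_dbar_mul [T2Space C] (hf : IsTestFunction z S f) {α : ι} {θ : C → ℂ}
    (hθ : ContinuousOn θ ((z α).source \ S)) :
    ContinuousOn (fun w => dbar (f ∘ (z α).symm) w * θ ((z α).symm w)) (z α).target := by
  intro w hw
  by_cases hs : (z α).symm w ∈ S
  · have : (fun w => dbar (f ∘ (z α).symm) w * θ ((z α).symm w)) =ᶠ[𝓝 w] fun _ => 0 := by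
      filter_upwards [hf.dbar_eq_zero hw hs] with v hv
      simp [hv]
    exact (continuousAt_const.congr this.symm).continuousWithinAt
  · refine ContinuousWithinAt.mul (hf.continuousOn_dbar α w hw) ?_
    refine ContinuousAt.continuousWithinAt ?_
    have ho : IsOpen ((z α).source \ S) := (z α).open_source.sdiff S.finite_toSet.isClosed
    exact (hθ.continuousAt (ho.mem_nhds ⟨(z α).map_target hw, hs⟩)).comp
      ((z α).continuousAt_symm hw)

end IsTestFunction

theorem integrableOn_of_eq_zero_off_compact {u : ℂ → ℂ} {U K : Set ℂ} (hU : IsOpen U)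
    (hK : IsCompact K) (hKU : K ⊆ U) (hu : ContinuousOn u U) (h0 : ∀ w ∈ U, w ∉ K → u w = 0) :
    IntegrableOn u U :=
  ((hu.mono hKU).integrableOn_compact hK).of_forall_sdiff_eq_zero hU.measurableSet
    fun w hw => h0 w hw.1 hw.2

section Stokes

variable {S : Finset C} {θ : ι → C → ℂ} {f g : C → ℂ} {α β : ι} {K L : Set C}

theorem dbar_eq_zero_of_notMem_compact [T2Space C] (hK : IsCompact K)
    (hf : ∀ x ∉ K, f x = 0) {w : ℂ} (hw : w ∈ (z α).target) (hwK : (z α).symm w ∉ K) :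
    dbar (f ∘ (z α).symm) w = 0 := by
  have h1 : ∀ᶠ v in 𝓝 w, (z α).symm v ∉ K :=
    ((z α).continuousAt_symm hw).tendsto.eventually (hK.isClosed.isOpen_compl.mem_nhds hwK)
  rw [dbar_congr (g := fun _ => 0) (by filter_upwards [h1] with v hv; exact hf _ hv), dbar_const]

/-- The integral of `g ∂̄f ∧ θ` may be computed in every chart that contains the support of `f` or
of `g`. -/
theorem integral_dbar_mul_change_chart [T2Space C] (hz : IsCoordinateSystem z)
    (htrans : ∀ α β, ∀ x ∈ (z α).source ∩ (z β).source, x ∉ S →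
      θ α x = canonicalCocycle z α β x * θ β x)
    (hf : IsTestFunction z S f) (hK : IsCompact K) (hKα : K ⊆ (z α).source)
    (hfK : ∀ x ∉ K, f x = 0) (hLβ : L ⊆ (z β).source) (hgL : ∀ x ∉ L, g x = 0) :
    ∫ w in (z α).target, g ((z α).symm w) * (dbar (f ∘ (z α).symm) w * θ α ((z α).symm w)) =
      ∫ w in (z β).target, g ((z β).symm w) * (dbar (f ∘ (z β).symm) w * θ β ((z β).symm w)) := by
  set s : Set ℂ := (z β).target ∩ (z β).symm ⁻¹' (z α).source with hs
  set T : ℂ → ℂ := z α ∘ (z β).symm with hT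
  have hso : IsOpen s := (z β).isOpen_inter_preimage_symm (z α).open_source
  have himg : T '' s = (z α).target ∩ (z α).symm ⁻¹' (z β).source := by
    ext v
    constructor
    · rintro ⟨w, ⟨hw1, hw2⟩, rfl⟩
      refine ⟨(z α).map_source hw2, ?_⟩
      simp only [hT, mem_preimage, Function.comp_apply, (z α).left_inv hw2]
      exact (z β).map_target hw1
    · rintro ⟨hv1, hv2⟩
      refine ⟨z β ((z α).symm v), ⟨(z β).map_source hv2, ?_⟩, ?_⟩
      · simp only [mem_preimage, (z β).left_inv hv2]
        exact (z α).map_target hv1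
      · simp [hT, (z β).left_inv hv2, (z α).right_inv hv1]
  have hinj : InjOn T s := by
    rintro w ⟨hw1, hw2⟩ v ⟨hv1, hv2⟩ hwv
    exact (z β).symm.injOn hw1 hv1 ((z α).injOn hw2 hv2 hwv)
  have hTan : ∀ w ∈ s, AnalyticAt ℂ T w := by
    intro w hw
    have := differentiableAt_transition (hz.holomorphic β) (hz.holomorphic α)
      ((z β).map_target hw.1) hw.2
    rwa [(z β).right_inv hw.1] at this
  have hTd : DifferentiableOn ℂ T s := fun w hw =>
    (hTan w hw).differentiableAt.differentiableWithinAt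
  have h1 : ∫ w in (z α).target,
      g ((z α).symm w) * (dbar (f ∘ (z α).symm) w * θ α ((z α).symm w)) = ∫ w in T '' s,
      g ((z α).symm w) * (dbar (f ∘ (z α).symm) w * θ α ((z α).symm w)) := by
    rw [himg]
    refine setIntegral_eq_of_subset_of_forall_sdiff_eq_zero (z α).open_target.measurableSet
      inter_subset_left fun w hw => ?_
    rw [hgL _ fun h => hw.2 ⟨hw.1, hLβ h⟩, zero_mul]
  have h2 : ∫ w in (z β).target,
      g ((z β).symm w) * (dbar (f ∘ (z β).symm) w * θ β ((z β).symm w)) = ∫ w in s,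
      g ((z β).symm w) * (dbar (f ∘ (z β).symm) w * θ β ((z β).symm w)) := by
    refine setIntegral_eq_of_subset_of_forall_sdiff_eq_zero (z β).open_target.measurableSet
      inter_subset_left fun w hw => ?_
    rw [dbar_eq_zero_of_notMem_compact hK hfK hw.1 fun h => hw.2 ⟨hw.1, hKα h⟩]
    simp
  rw [h1, h2, integral_image_holomorphic hso hTd hinj]
  refine setIntegral_congr_fun hso.measurableSet fun w hw => ?_
  have hsymm : (z α).symm (T w) = (z β).symm w := (z α).left_inv hw.2
  have hTw : T w ∈ (z α).target := (z α).map_source hw.2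
  have hloc : (f ∘ (z α).symm) ∘ T =ᶠ[𝓝 w] f ∘ (z β).symm := by
    filter_upwards [hso.mem_nhds hw] with v hv
    simp [hT, (z α).left_inv hv.2]
  have hchain : dbar (f ∘ (z β).symm) w
      = dbar (f ∘ (z α).symm) (T w) * (starRingEnd ℂ) (deriv T w) := by
    rw [← dbar_congr hloc]
    exact dbar_comp_holomorphic ((hf.contDiffAt α _ hTw).differentiableAt one_ne_zero)
      (hTan w hw).differentiableAt
  simp only [hsymm]
  by_cases hwS : (z β).symm w ∈ S
  · have h3 := (hf.dbar_eq_zero hw.1 hwS).self_of_nhds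
    have h4 := (hf.dbar_eq_zero hTw (by rwa [hsymm])).self_of_nhds
    simp [h3, h4]
  · have h5 := htrans β α _ ⟨(z β).map_target hw.1, hw.2⟩ hwS
    have h6 : canonicalCocycle z β α ((z β).symm w) = deriv T w := by
      rw [canonicalCocycle, coordDeriv, (z β).right_inv hw.1]
    rw [hchain, h5, h6]
    ring

/-- Stokes' theorem, for `∂̄(∑ ρ_i) ∧ θ` with a partition of unity `ρ`. -/
theorem sum_integral_dbar_eq_zero [T2Space C] (hz : IsCoordinateSystem z)
    (hθ : ∀ α, ContinuousOn (θ α) ((z α).source \ S))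
    (htrans : ∀ α β, ∀ x ∈ (z α).source ∩ (z β).source, x ∉ S →
      θ α x = canonicalCocycle z α β x * θ β x)
    {κ : Type*} (t : Finset κ) (a : κ → ι) (ρ : κ → C → ℂ) (K : κ → Set C)
    (hρ : ∀ i ∈ t, IsTestFunction z S (ρ i)) (hK : ∀ i, IsCompact (K i))
    (hKa : ∀ i, K i ⊆ (z (a i)).source) (hρK : ∀ i ∈ t, ∀ x ∉ K i, ρ i x = 0)
    (hsum : ∀ x, ∑ i ∈ t, ρ i x = 1) :
    ∑ i ∈ t, ∫ w in (z (a i)).target,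
      dbar (ρ i ∘ (z (a i)).symm) w * θ (a i) ((z (a i)).symm w) = 0 := by
  have hcomp : ∀ i, IsCompact (z (a i) '' K i) := fun i =>
    (hK i).image_of_continuousOn ((z (a i)).continuousOn.mono (hKa i))
  have hcsub : ∀ i, z (a i) '' K i ⊆ (z (a i)).target := by
    rintro i _ ⟨x, hx, rfl⟩
    exact (z (a i)).map_source (hKa i hx)
  have hnot : ∀ i, ∀ w ∈ (z (a i)).target, w ∉ z (a i) '' K i → (z (a i)).symm w ∉ K i :=
    fun i w hw h h' => h ⟨_, h', (z (a i)).right_inv hw⟩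
  have hcont : ∀ i, ∀ j ∈ t, ∀ k ∈ t, ContinuousOn (fun w => ρ j ((z (a i)).symm w) *
      (dbar (ρ k ∘ (z (a i)).symm) w * θ (a i) ((z (a i)).symm w))) (z (a i)).target := by
    intro i j hj k hk
    refine ContinuousOn.mul (fun w hw => ?_) ((hρ k hk).continuousOn_dbar_mul (hθ _))
    exact ((hρ j hj).contDiffAt (a i) w hw).continuousAt.continuousWithinAt
  have h1 : ∀ i ∈ t, ∫ w in (z (a i)).target,
      dbar (ρ i ∘ (z (a i)).symm) w * θ (a i) ((z (a i)).symm w) =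
      ∑ j ∈ t, ∫ w in (z (a j)).target, ρ j ((z (a j)).symm w) *
        (dbar (ρ i ∘ (z (a j)).symm) w * θ (a j) ((z (a j)).symm w)) := by
    intro i hi
    rw [← Finset.sum_congr rfl fun j hj => integral_dbar_mul_change_chart (θ := θ) (S := S) hz
      htrans (hρ i hi) (hK i) (hKa i) (hρK i hi) (hKa j) (hρK j hj), ← integral_finsetSum]
    · refine setIntegral_congr_fun (z (a i)).open_target.measurableSet fun w _ => ?_
      simp only [← Finset.sum_mul, hsum, one_mul]
    · intro j hj
      refine integrableOn_of_eq_zero_off_compact (z (a i)).open_target (hcomp i) (hcsub i)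
        (hcont i j hj i hi) fun w hw hwK => ?_
      rw [dbar_eq_zero_of_notMem_compact (hK i) (hρK i hi) hw (hnot i w hw hwK)]
      simp
  rw [Finset.sum_congr rfl h1, Finset.sum_comm]
  refine Finset.sum_eq_zero fun j hj => ?_
  rw [← integral_finsetSum]
  · refine (setIntegral_congr_fun (z (a j)).open_target.measurableSet fun w hw => ?_).trans
      (integral_zero _ _)
    have h2 : ∑ i ∈ t, dbar (ρ i ∘ (z (a j)).symm) w = 0 := by
      rw [← dbar_sum t fun i hi => ((hρ i hi).contDiffAt (a j) w hw).differentiableAt one_ne_zero]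
      simp only [Function.comp_apply, hsum, dbar_const]
    simp only [← Finset.mul_sum, ← Finset.sum_mul, h2]
    simp
  · intro i hi
    refine integrableOn_of_eq_zero_off_compact (z (a j)).open_target (hcomp j) (hcsub j)
      (hcont j j hj i hi) fun w hw hwK => ?_
    rw [hρK j hj _ (hnot j w hw hwK), zero_mul]

end Stokes

end Residues

section ResidueTheorem

open MeasureTheory

variable {C : Type*} [TopologicalSpace C] [ChartedSpace ℂ C] [IsManifold 𝓘(ℂ, ℂ) ω C] {ι : Type*}
variable {z : ι → OpenPartialHomeomorph C ℂ}

/-- `e.symm '' closedBall (e p) r`, written as a subset of the source of `e`. -/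
def coordDisc (e : OpenPartialHomeomorph C ℂ) (p : C) (r : ℝ) : Set C :=
  e.symm '' Metric.closedBall (e p) r

variable {e : OpenPartialHomeomorph C ℂ} {p : C} {r : ℝ}

theorem isCompact_coordDisc (h : Metric.closedBall (e p) r ⊆ e.target) :
    IsCompact (coordDisc e p r) :=
  (isCompact_closedBall _ _).image_of_continuousOn (e.continuousOn_symm.mono h)

theorem coordDisc_subset_source (h : Metric.closedBall (e p) r ⊆ e.target) :
    coordDisc e p r ⊆ e.source := by
  rintro _ ⟨w, hw, rfl⟩
  exact e.map_target (h hw)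

open Classical in
/-- A bump function on `C`, radial in the coordinate `e` centred at `p`. -/
noncomputable def coordBump (e : OpenPartialHomeomorph C ℂ) (p : C) (r : ℝ) (x : C) : ℂ :=
  if x ∈ e.source then radialBump (e p) r (e x) else 0

theorem coordBump_eq_zero (hr : 0 < r) {x : C} (hx : x ∉ coordDisc e p (2 * r)) :
    coordBump e p r x = 0 := by
  by_cases hxs : x ∈ e.source
  · rw [coordBump, if_pos hxs]
    refine radialBump_eq_zero hr (not_lt.1 fun h => hx ⟨e x, ?_, e.left_inv hxs⟩)
    rw [Metric.mem_closedBall, dist_eq_norm]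
    exact h.le
  · rw [coordBump, if_neg hxs]

theorem coordBump_eq_one (hr : 0 < r) {x : C} (hxs : x ∈ e.source) (hx : ‖e x - e p‖ ≤ r) :
    coordBump e p r x = 1 := by
  rw [coordBump, if_pos hxs, radialBump_eq_one hr hx]

theorem isTestFunction_coordBump [T2Space C] (hz : IsCoordinateSystem z) {S : Finset C} {α : ι}
    (hr : 0 < r) (hp : p ∈ (z α).source)
    (h : Metric.closedBall (z α p) (2 * r) ⊆ (z α).target)
    (hS : ∀ w ∈ Metric.closedBall (z α p) (2 * r), w ≠ z α p → (z α).symm w ∉ S) :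
    IsTestFunction z S (coordBump (z α) p r) := by
  have hclosed : IsClosed (coordDisc (z α) p (2 * r)) := (isCompact_coordDisc h).isClosed
  constructor
  · intro β w hw
    by_cases hwα : (z β).symm w ∈ (z α).source
    · have h1 : AnalyticAt ℂ (z α ∘ (z β).symm) w := by
        have := differentiableAt_transition (hz.holomorphic β) (hz.holomorphic α)
          ((z β).map_target hw) hwα
        rwa [(z β).right_inv hw] at this
      have h2 : ContDiffAt ℝ 1 (radialBump (z α p) r ∘ (z α ∘ (z β).symm)) w :=
        (contDiff_radialBump _ _).contDiffAt.comp w ((h1.contDiffAt (n := 1)).restrict_scalars ℝ)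
      refine h2.congr_of_eventuallyEq ?_
      filter_upwards [((z β).continuousAt_symm hw).tendsto.eventually
        ((z α).open_source.mem_nhds hwα)] with v hv
      exact if_pos hv
    · have hwK : (z β).symm w ∉ coordDisc (z α) p (2 * r) := fun h' =>
        hwα (coordDisc_subset_source h h')
      have h1 : (coordBump (z α) p r ∘ (z β).symm) =ᶠ[𝓝 w] fun _ => 0 := by
        filter_upwards [((z β).continuousAt_symm hw).tendsto.eventually
          (hclosed.isOpen_compl.mem_nhds hwK)] with v hv
        exact coordBump_eq_zero hr hv
      exact contDiffAt_const.congr_of_eventuallyEq h1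
  · intro s hs
    by_cases hsp : s = p
    · subst hsp
      have h1 : ∀ᶠ x in 𝓝 s, x ∈ (z α).source ∧ z α x ∈ Metric.closedBall (z α s) r :=
        (show ∀ᶠ x in 𝓝 s, x ∈ (z α).source from (z α).open_source.mem_nhds hp).and
          (((z α).continuousAt hp).tendsto.eventually (Metric.closedBall_mem_nhds _ hr))
      have h2 : ∀ᶠ x in 𝓝 s, coordBump (z α) s r x = 1 := by
        filter_upwards [h1] with x hx
        exact coordBump_eq_one hr hx.1 (by rw [← dist_eq_norm]; exact hx.2)
      filter_upwards [h2] with x hx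
      rw [hx, h2.self_of_nhds]
    · have hsK : s ∉ coordDisc (z α) p (2 * r) := by
        rintro ⟨w, hw, rfl⟩
        refine hS w hw (fun h' => hsp ?_) hs
        rw [h', (z α).left_inv hp]
      filter_upwards [hclosed.isOpen_compl.mem_nhds hsK] with x hx
      rw [coordBump_eq_zero hr hx, coordBump_eq_zero hr hsK]

/-- Partitions of unity by test functions, from bump functions that equal `1` on the members of a
cover. -/
theorem exists_partition {S : Finset C} {κ : Type*} (t : Finset κ) (b : κ → C → ℂ)
    (hb : ∀ i ∈ t, IsTestFunction z S (b i)) :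
    ∃ ρ : κ → C → ℂ, (∀ i ∈ t, IsTestFunction z S (ρ i) ∧ ∀ x, b i x = 0 → ρ i x = 0) ∧
      ∀ x, ∑ i ∈ t, ρ i x = 1 - ∏ i ∈ t, (1 - b i x) := by
  classical
  induction t using Finset.induction_on with
  | empty => exact ⟨fun _ _ => 0, by simp, by simp⟩
  | insert a t ha ih =>
    obtain ⟨ρ, h1, h2⟩ := ih fun i hi => hb i (by simp [hi])
    have hne : ∀ i ∈ t, i ≠ a := fun i hi h => ha (h ▸ hi)
    refine ⟨Function.update ρ a fun x => b a x * ∏ i ∈ t, (1 - b i x), ?_, ?_⟩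
    · intro i hi
      rcases Finset.mem_insert.1 hi with rfl | hi
      · rw [Function.update_self]
        refine ⟨(hb i (by simp)).mul (IsTestFunction.prod t fun j hj =>
          (IsTestFunction.const 1).sub (hb j (by simp [hj]))), fun x hx => by simp [hx]⟩
      · rw [Function.update_of_ne (hne i hi)]
        exact h1 i hi
    · intro x
      have h3 : ∑ i ∈ t, Function.update ρ a (fun x => b a x * ∏ i ∈ t, (1 - b i x)) i x
          = ∑ i ∈ t, ρ i x :=
        Finset.sum_congr rfl fun i hi => by rw [Function.update_of_ne (hne i hi)]
      rw [Finset.sum_insert ha, Finset.prod_insert ha, h3, h2, Function.update_self]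
      ring

/-- `∂̄ f ∧ θ` integrates to the residue, for `f` supported in a disc about `p` in which `θ` has no
pole except `p`. -/
theorem setIntegral_dbar_mul_simplePole [T2Space C] {S : Finset C} {α : ι} (hr : 0 < r)
    (hp : p ∈ (z α).source) (h : Metric.ball (z α p) (3 * r) ⊆ (z α).target) {f : C → ℂ}
    (hf : IsTestFunction z S f) (hfK : ∀ x ∉ coordDisc (z α) p (2 * r), f x = 0)
    {θ : C → ℂ} {h' : ℂ → ℂ} {c : ℂ} (hh : DifferentiableOn ℂ h' (Metric.ball (z α p) (3 * r)))
    (hθ : ∀ w ∈ Metric.ball (z α p) (3 * r), w ≠ z α p →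
      θ ((z α).symm w) = c / (w - z α p) + h' w)
    (hc : p ∉ S → c = 0) :
    ∫ w in (z α).target, dbar (f ∘ (z α).symm) w * θ ((z α).symm w) =
      -(2 * Real.pi) * (c * f p) := by
  classical
  have h2 : Metric.closedBall (z α p) (2 * r) ⊆ Metric.ball (z α p) (3 * r) :=
    Metric.closedBall_subset_ball (by linarith)
  set F : ℂ → ℂ := fun w => if w ∈ (z α).target then f ((z α).symm w) else 0 with hF
  have hF0 : ∀ w ∉ Metric.closedBall (z α p) (2 * r), F w = 0 := by
    intro w hw
    by_cases hwt : w ∈ (z α).target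
    · simp only [hF, if_pos hwt]
      refine hfK _ ?_
      rintro ⟨v, hv, hvw⟩
      exact hw ((z α).symm.injOn (h (h2 hv)) hwt hvw ▸ hv)
    · simp only [hF, if_neg hwt]
  have hFeq : ∀ w ∈ (z α).target, F =ᶠ[𝓝 w] f ∘ (z α).symm := by
    intro w hw
    filter_upwards [(z α).open_target.mem_nhds hw] with v hv
    simp [hF, if_pos hv]
  have hts : tsupport F ⊆ Metric.closedBall (z α p) (2 * r) :=
    closure_minimal (fun w hw => by_contra fun h' => hw (hF0 w h')) Metric.isClosed_closedBall
  have hFs : HasCompactSupport F :=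
    (isCompact_closedBall _ _).of_isClosed_subset (isClosed_tsupport _) hts
  have hFc : ContDiff ℝ 1 F := by
    rw [contDiff_iff_contDiffAt]
    intro w
    by_cases hw : w ∈ Metric.closedBall (z α p) (2 * r)
    · exact (hf.contDiffAt α w (h (h2 hw))).congr_of_eventuallyEq (hFeq w (h (h2 hw)))
    · refine (contDiffAt_const (c := (0 : ℂ))).congr_of_eventuallyEq ?_
      filter_upwards [Metric.isClosed_closedBall.isOpen_compl.mem_nhds hw] with v hv
      exact hF0 v hv
  have hFp : F (z α p) = f p := by
    simp [hF, if_pos ((z α).map_source hp), (z α).left_inv hp]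
  have h3 : ∫ w in (z α).target, dbar (f ∘ (z α).symm) w * θ ((z α).symm w) =
      ∫ w, dbar F w * θ ((z α).symm w) := by
    rw [← setIntegral_eq_integral_of_forall_compl_eq_zero (s := (z α).target)
      (f := fun w => dbar F w * θ ((z α).symm w))]
    · refine setIntegral_congr_fun (z α).open_target.measurableSet fun w hw => ?_
      simp only [dbar_congr (hFeq w hw)]
    · intro w hw
      rw [dbar_eq_zero_of_notMem_tsupport fun h' => hw (h (h2 (hts h'))), zero_mul]
  rw [h3]
  by_cases hpS : p ∈ S
  · rw [← hFp]
    refine integral_dbar_mul_simplePole (h := h') (θ := fun w => θ ((z α).symm w))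
      Metric.isOpen_ball hFc hFs (hts.trans h2) ?_ hh hθ
    have h4 := ((z α).continuousAt_symm ((z α).map_source hp)).tendsto
    rw [(z α).left_inv hp] at h4
    filter_upwards [hFeq _ ((z α).map_source hp), h4.eventually (hf.eventually_eq p hpS)]
      with w h5 h6
    rw [h5, hFp, ← h6]
    rfl
  · have hc0 := hc hpS
    subst hc0
    have hFh := contDiff_mul_of_tsupport_subset Metric.isOpen_ball hFc (hts.trans h2)
      ((hh.contDiffOn (n := 1) Metric.isOpen_ball).restrict_scalars ℝ)
    have h5 := integral_dbar_eq_zero hFh hFs.mul_right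
    have h6 : (fun w => dbar F w * θ ((z α).symm w)) =ᵐ[volume]
        dbar fun w => F w * h' w := by
      have : ∀ᵐ w ∂(volume : Measure ℂ), w ≠ z α p := by
        rw [ae_iff]
        simp
      filter_upwards [this] with w hw
      by_cases hw2 : w ∈ tsupport F
      · rw [dbar_mul_holomorphic (hFc.differentiable one_ne_zero w)
          (hh.differentiableAt (Metric.isOpen_ball.mem_nhds (h2 (hts hw2)))), hθ w (h2 (hts hw2)) hw]
        simp
      · rw [dbar_eq_zero_of_notMem_tsupport hw2, dbar_eq_zero_of_notMem_tsupport fun h' =>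
          hw2 (tsupport_mul_subset_left h'), zero_mul]
    rw [integral_congr_ae h6, h5]
    simp

/-- The residue theorem, for meromorphic `1`-forms with simple poles on a compact Riemann
surface. -/
theorem sum_residues_eq_zero [T2Space C] [CompactSpace C] (hz : IsCoordinateSystem z)
    (S : Finset C) (θ : ι → C → ℂ) (hol : ∀ α, HolOn (θ α) ((z α).source \ S))
    (htrans : ∀ α β, ∀ x ∈ (z α).source ∩ (z β).source, x ∉ S →
      θ α x = canonicalCocycle z α β x * θ β x)
    (res : C → ℂ) (hpole : ∀ p ∈ S, ∃ α, p ∈ (z α).source ∧ ∃ h : ℂ → ℂ, AnalyticAt ℂ h (z α p) ∧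
      ∀ᶠ w in 𝓝[≠] (z α p), θ α ((z α).symm w) = res p / (w - z α p) + h w) :
    ∑ p ∈ S, res p = 0 := by
  classical
  set res' : C → ℂ := fun p => if p ∈ S then res p else 0 with hres'
  have hSo : ∀ α, IsOpen ((z α).source \ (S : Set C)) := fun α =>
    (z α).open_source.sdiff S.finite_toSet.isClosed
  have key : ∀ p : C, ∃ (α : ι) (r : ℝ) (h : ℂ → ℂ), 0 < r ∧ p ∈ (z α).source ∧
      Metric.ball (z α p) (3 * r) ⊆ (z α).target ∧
      DifferentiableOn ℂ h (Metric.ball (z α p) (3 * r)) ∧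
      ∀ w ∈ Metric.ball (z α p) (3 * r), w ≠ z α p → (z α).symm w ∉ S ∧
        θ α ((z α).symm w) = res' p / (w - z α p) + h w := by
    intro p
    have hloc : ∃ α, p ∈ (z α).source ∧ ∃ h : ℂ → ℂ, AnalyticAt ℂ h (z α p) ∧
        ∀ᶠ w in 𝓝[≠] (z α p), θ α ((z α).symm w) = res' p / (w - z α p) + h w := by
      by_cases hp : p ∈ S
      · simpa only [hres', if_pos hp] using hpole p hp
      · obtain ⟨α, hα⟩ := hz.covers p
        refine ⟨α, hα, θ α ∘ (z α).symm,
          (hol α).analyticAt (hSo α) ⟨hα, hp⟩ (hz.holomorphic α) hα, ?_⟩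
        simp [hres', if_neg hp]
    obtain ⟨α, hα, h, hh, hev⟩ := hloc
    have h4 := ((z α).continuousAt_symm ((z α).map_source hα)).tendsto
    rw [(z α).left_inv hα] at h4
    have h5 : ∀ᶠ w in 𝓝 (z α p), w ≠ z α p → (z α).symm w ∉ S := by
      have hfin : IsClosed ((S : Set C) \ {p}) := (S.finite_toSet.sdiff).isClosed
      filter_upwards [h4.eventually (hfin.isOpen_compl.mem_nhds (by simp)),
        (z α).open_target.mem_nhds ((z α).map_source hα)] with w hw hwt hwp hwS
      refine hw ⟨hwS, fun h' => hwp ?_⟩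
      rw [← (z α).right_inv hwt, mem_singleton_iff.1 h']
    have h6 := (h5.and (eventually_nhdsWithin_iff.1 hev)).and
      (hh.eventually_analyticAt.and ((z α).open_target.mem_nhds ((z α).map_source hα)))
    obtain ⟨R, hR, hball⟩ := Metric.eventually_nhds_iff_ball.1 h6
    refine ⟨α, R / 3, h, by positivity, hα, ?_⟩
    rw [mul_div_cancel₀ R three_ne_zero]
    exact ⟨fun w hw => (hball w hw).2.2,
      fun w hw => (hball w hw).2.1.differentiableAt.differentiableWithinAt,
      fun w hw hwp => ⟨(hball w hw).1.1 hwp, (hball w hw).1.2 hwp⟩⟩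
  choose a r h hr ha hball hh hθ using key
  have h23 : ∀ p, Metric.closedBall (z (a p) p) (2 * r p) ⊆ Metric.ball (z (a p) p) (3 * r p) :=
    fun p => Metric.closedBall_subset_ball (by linarith [hr p])
  set b : C → C → ℂ := fun p => coordBump (z (a p)) p (r p) with hb
  have hbtest : ∀ p, IsTestFunction z S (b p) := fun p =>
    isTestFunction_coordBump hz (hr p) (ha p) ((h23 p).trans (hball p))
      fun w hw hwp => (hθ p w (h23 p hw) hwp).1
  have hcover : ∀ p : C, ∀ᶠ x in 𝓝 p, b p x = 1 := by
    intro p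
    filter_upwards [(z (a p)).open_source.mem_nhds (ha p), ((z (a p)).continuousAt (ha p)).tendsto
      (Metric.closedBall_mem_nhds _ (hr p))] with x h1 h2
    exact coordBump_eq_one (hr p) h1 (by rw [← dist_eq_norm]; exact h2)
  obtain ⟨t, -, ht⟩ := isCompact_univ.elim_nhds_subcover (fun p => {x | b p x = 1})
    fun p _ => hcover p
  obtain ⟨ρ, hρ, hsum⟩ := exists_partition (z := z) (S := S) t b fun i _ => hbtest i
  have hsum1 : ∀ x, ∑ i ∈ t, ρ i x = 1 := by
    intro x
    obtain ⟨i, hi, hx⟩ := mem_iUnion₂.1 (ht (mem_univ x))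
    rw [hsum, Finset.prod_eq_zero hi (by rw [show b i x = 1 from hx, sub_self]), sub_zero]
  have hρK : ∀ i ∈ t, ∀ x ∉ coordDisc (z (a i)) i (2 * r i), ρ i x = 0 := fun i hi x hx =>
    (hρ i hi).2 x (coordBump_eq_zero (hr i) hx)
  have hstokes := sum_integral_dbar_eq_zero (θ := θ) (S := S) hz
    (fun α => (hol α).continuousOn) htrans t a ρ
    (fun i => coordDisc (z (a i)) i (2 * r i)) (fun i hi => (hρ i hi).1)
    (fun i => isCompact_coordDisc ((h23 i).trans (hball i)))
    (fun i => coordDisc_subset_source ((h23 i).trans (hball i))) hρK hsum1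
  have hloc : ∀ i ∈ t, ∫ w in (z (a i)).target,
      dbar (ρ i ∘ (z (a i)).symm) w * θ (a i) ((z (a i)).symm w) =
      -(2 * Real.pi) * (res' i * ρ i i) := fun i hi =>
    setIntegral_dbar_mul_simplePole (hr i) (ha i) (hball i) (hρ i hi).1 (hρK i hi) (hh i)
      (fun w hw hwp => (hθ i w hw hwp).2) fun hi' => by simp [hres', if_neg hi']
  rw [Finset.sum_congr rfl hloc, ← Finset.mul_sum] at hstokes
  have hpi : (-(2 * Real.pi) : ℂ) ≠ 0 := by
    simp [Real.pi_ne_zero]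
  have h7 : ∑ i ∈ t, res' i * ρ i i = 0 := (mul_eq_zero.1 hstokes).resolve_left hpi
  have h8 : ∀ s ∈ S, ∀ i ∈ t, i ≠ s → ρ i s = 0 := by
    intro s hs i hi his
    refine hρK i hi s ?_
    rintro ⟨w, hw, rfl⟩
    refine (hθ i w (h23 i hw) fun h' => his ?_).1 hs
    rw [h', (z (a i)).left_inv (ha i)]
  have h9 : ∀ s ∈ S, s ∈ t ∧ ρ s s = 1 := by
    intro s hs
    have h10 := hsum1 s
    by_cases hst : s ∈ t
    · rw [Finset.sum_eq_single_of_mem s hst fun i hi his => h8 s hs i hi his] at h10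
      exact ⟨hst, h10⟩
    · rw [Finset.sum_eq_zero fun i hi => h8 s hs i hi fun h' => hst (h' ▸ hi)] at h10
      exact absurd h10 zero_ne_one
  rw [← h7, ← Finset.sum_subset (fun s hs => (h9 s hs).1)
    (fun i _ hi => by simp [hres', if_neg hi])]
  exact Finset.sum_congr rfl fun s hs => by simp [hres', if_pos hs, (h9 s hs).2]

end ResidueTheorem

section OneForms

variable {C : Type*} [TopologicalSpace C] [ChartedSpace ℂ C] [IsManifold 𝓘(ℂ, ℂ) ω C] {ι : Type*}
variable {z : ι → OpenPartialHomeomorph C ℂ}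

/-- A holomorphic `1`-form, given by its coefficients with respect to `dz_α`. -/
structure IsOneForm (z : ι → OpenPartialHomeomorph C ℂ) (η : ι → C → ℂ) : Prop where
  holomorphic : ∀ α, HolOn (η α) (z α).source
  transition : ∀ α β, ∀ x ∈ (z α).source ∩ (z β).source,
    η α x = canonicalCocycle z α β x * η β x

/-- The coordinate vector field `d/de`. -/
noncomputable def coordVector (e : OpenPartialHomeomorph C ℂ) (x : C) : TangentSpace 𝓘(ℂ, ℂ) x :=
  show ℂ from mfderiv 𝓘(ℂ, ℂ) 𝓘(ℂ, ℂ) e.symm (e x) (1 : ℂ)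

variable {e e' : OpenPartialHomeomorph C ℂ} {x : C}

theorem contMDiffAt_coordVector (he : e ∈ IsManifold.maximalAtlas 𝓘(ℂ, ℂ) ω C)
    (hx : x ∈ e.source) :
    ContMDiffAt 𝓘(ℂ, ℂ) (𝓘(ℂ, ℂ).prod 𝓘(ℂ, ℂ)) 1
      (fun y => (Bundle.TotalSpace.mk' ℂ y (coordVector e y) : TangentBundle 𝓘(ℂ, ℂ) C)) x := by
  have h1 : ContMDiffOn 𝓘(ℂ, ℂ) 𝓘(ℂ, ℂ) 2 e.symm e.target :=
    (contMDiffOn_symm_of_mem_maximalAtlas he).of_le le_top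
  have h2 := h1.contMDiffOn_tangentMapWithin (m := 1) (by norm_num) e.open_target.uniqueMDiffOn
  have h3 : ContMDiff 𝓘(ℂ, ℂ) (𝓘(ℂ, ℂ).prod 𝓘(ℂ, ℂ)) 1
      (fun w : ℂ => (Bundle.TotalSpace.mk' ℂ w (1 : ℂ) : TangentBundle 𝓘(ℂ, ℂ) ℂ)) :=
    contMDiff_vectorSpace_iff_contDiff.2 contDiff_const
  have h4 : ContMDiffOn 𝓘(ℂ, ℂ) 𝓘(ℂ, ℂ) 1 e e.source :=
    (contMDiffOn_of_mem_maximalAtlas he).of_le le_top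
  have h5 := (h2.comp (h3.comp_contMDiffOn h4)
    (fun y hy => by simpa using! e.map_source hy)).contMDiffAt (e.open_source.mem_nhds hx)
  refine h5.congr_of_eventuallyEq ?_
  filter_upwards [e.open_source.mem_nhds hx] with y hy
  refine Bundle.TotalSpace.ext (e.left_inv hy).symm (heq_of_eq ?_)
  have h6 : mfderivWithin 𝓘(ℂ, ℂ) 𝓘(ℂ, ℂ) e.symm e.target (e y)
      = mfderiv 𝓘(ℂ, ℂ) 𝓘(ℂ, ℂ) e.symm (e y) :=
    mfderivWithin_of_isOpen e.open_target (e.map_source hy)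
  exact (congrArg (fun L : ℂ →L[ℂ] ℂ => L 1) h6).symm

theorem clm_apply_eq_smul (L : ℂ →L[ℂ] ℂ) (c : ℂ) : L c = c • L 1 := by
  rw [← map_smul, smul_eq_mul, mul_one]

theorem coordVector_change (he : e ∈ IsManifold.maximalAtlas 𝓘(ℂ, ℂ) ω C)
    (he' : e' ∈ IsManifold.maximalAtlas 𝓘(ℂ, ℂ) ω C) (hx : x ∈ e.source) (hx' : x ∈ e'.source) :
    coordVector e x = coordDeriv e e' x • coordVector e' x := by
  have h1 : e.symm =ᶠ[𝓝 (e x)] e'.symm ∘ (e' ∘ e.symm) := by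
    have hc := (e.continuousAt_symm (e.map_source hx)).tendsto
    rw [e.left_inv hx] at hc
    filter_upwards [hc.eventually (e'.open_source.mem_nhds hx')] with w hw
    simp [e'.left_inv hw]
  have h2 : (e' ∘ e.symm) (e x) = e' x := by simp [e.left_inv hx]
  have h3 : DifferentiableAt ℂ (e' ∘ e.symm) (e x) :=
    (differentiableAt_transition he he' hx hx').differentiableAt
  have h4 : MDifferentiableAt 𝓘(ℂ, ℂ) 𝓘(ℂ, ℂ) e'.symm ((e' ∘ e.symm) (e x)) := by
    rw [h2]
    exact (contMDiffAt_symm_of_mem_maximalAtlas he' (e'.map_source hx')).mdifferentiableAt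
      (by simp)
  have h5 : HasMFDerivAt 𝓘(ℂ, ℂ) 𝓘(ℂ, ℂ) e.symm (e x) _ :=
    (HasMFDerivAt.comp (e x) h4.hasMFDerivAt
      h3.hasFDerivAt.hasMFDerivAt).congr_of_eventuallyEq h1
  have h6 : (mfderiv 𝓘(ℂ, ℂ) 𝓘(ℂ, ℂ) e.symm (e x) : ℂ →L[ℂ] ℂ) (1 : ℂ)
      = (mfderiv 𝓘(ℂ, ℂ) 𝓘(ℂ, ℂ) e'.symm ((e' ∘ e.symm) (e x)) : ℂ →L[ℂ] ℂ)
        (fderiv ℂ (e' ∘ e.symm) (e x) 1) := by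
    rw [h5.mfderiv]
    rfl
  change (mfderiv 𝓘(ℂ, ℂ) 𝓘(ℂ, ℂ) e.symm (e x) : ℂ →L[ℂ] ℂ) (1 : ℂ)
    = coordDeriv e e' x • (mfderiv 𝓘(ℂ, ℂ) 𝓘(ℂ, ℂ) e'.symm (e' x) : ℂ →L[ℂ] ℂ) (1 : ℂ)
  rw [h6, h2, fderiv_apply_one_eq_deriv]
  exact clm_apply_eq_smul _ _

theorem coordVector_ne_zero (he : e ∈ IsManifold.maximalAtlas 𝓘(ℂ, ℂ) ω C) (hx : x ∈ e.source) :
    (coordVector e x : ℂ) ≠ 0 := by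
  have hm : e.MDifferentiable 𝓘(ℂ, ℂ) 𝓘(ℂ, ℂ) :=
    ⟨(contMDiffOn_of_mem_maximalAtlas he).mdifferentiableOn (by simp),
      (contMDiffOn_symm_of_mem_maximalAtlas he).mdifferentiableOn (by simp)⟩
  intro h
  have h1 := hm.symm.mfderiv_injective (x := e x) (e.map_source hx)
  have h2 : (1 : ℂ) = 0 := h1 (h.trans (map_zero _).symm)
  exact one_ne_zero h2

/-- The coefficients of a holomorphic section of the cotangent bundle. -/
noncomputable def formCoeff (z : ι → OpenPartialHomeomorph C ℂ)
    (σ : ContMDiffSection 𝓘(ℂ, ℂ) (ℂ →L[ℂ] ℂ) ω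
      (fun x : C => TangentSpace 𝓘(ℂ, ℂ) x →L[ℂ] Bundle.Trivial C ℂ x)) (α : ι) (x : C) : ℂ :=
  σ x (coordVector (z α) x)

theorem isOneForm_formCoeff (hz : IsCoordinateSystem z)
    (σ : ContMDiffSection 𝓘(ℂ, ℂ) (ℂ →L[ℂ] ℂ) ω
      (fun x : C => TangentSpace 𝓘(ℂ, ℂ) x →L[ℂ] Bundle.Trivial C ℂ x)) :
    IsOneForm z (formCoeff z σ) := by
  constructor
  · intro α x hx
    have h1 := contMDiffAt_coordVector (hz.holomorphic α) hx
    have h2 := (σ.contMDiff.contMDiffAt (x := x)).of_le (m := 1) le_top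
    have h3 := ContMDiffAt.clm_bundle_apply (b := id) h2 h1
    have h4 := (Bundle.contMDiffAt_totalSpace.1 h3).2
    have h5 : ContMDiffAt 𝓘(ℂ, ℂ) 𝓘(ℂ, ℂ) 1 (formCoeff z σ α) x := by
      simpa using! h4
    exact (h5.mdifferentiableAt one_ne_zero).mdifferentiableWithinAt
  · intro α β x hx
    change σ x _ = _ * σ x _
    rw [coordVector_change (hz.holomorphic α) (hz.holomorphic β) hx.1 hx.2, map_smul]
    rfl

theorem eq_zero_of_formCoeff_eq_zero (hz : IsCoordinateSystem z)
    (σ : ContMDiffSection 𝓘(ℂ, ℂ) (ℂ →L[ℂ] ℂ) ω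
      (fun x : C => TangentSpace 𝓘(ℂ, ℂ) x →L[ℂ] Bundle.Trivial C ℂ x))
    (h : ∀ α, ∀ x ∈ (z α).source, formCoeff z σ α x = 0) : σ = 0 := by
  ext x
  obtain ⟨α, hα⟩ := hz.covers x
  have h1 := h α x hα
  have h2 := coordVector_ne_zero (hz.holomorphic α) hα
  set L : ℂ →L[ℂ] ℂ := σ x
  have h4 := (clm_apply_eq_smul L _).symm.trans h1
  have h5 : L 1 = 0 := (smul_eq_zero.1 h4).resolve_left h2
  exact h5

theorem IsOneForm.eq_zero_iff (hz : IsCoordinateSystem z) {η : ι → C → ℂ} (hη : IsOneForm z η)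
    {α β : ι} (hx : x ∈ (z α).source ∩ (z β).source) : η α x = 0 ↔ η β x = 0 := by
  rw [hη.transition α β x hx, mul_eq_zero, or_iff_right (canonicalCocycle_ne_zero hz hx.1 hx.2)]

/-- On a connected surface, a `1`-form that does not vanish identically has isolated zeros. -/
theorem IsOneForm.eventually_ne_zero [ConnectedSpace C] (hz : IsCoordinateSystem z)
    {η : ι → C → ℂ} (hη : IsOneForm z η) {α₀ : ι} {x₀ : C} (hx₀ : x₀ ∈ (z α₀).source)
    (h0 : η α₀ x₀ ≠ 0) {α : ι} {x : C} (hx : x ∈ (z α).source) :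
    ∀ᶠ w in 𝓝[≠] (z α x), η α ((z α).symm w) ≠ 0 := by
  have han : ∀ β y, y ∈ (z β).source → AnalyticAt ℂ (η β ∘ (z β).symm) (z β y) := fun β y hy =>
    (hη.holomorphic β).analyticAt (z β).open_source hy (hz.holomorphic β) hy
  set Z : Set C := {y | ∀ᶠ u in 𝓝 y, ∀ β, u ∈ (z β).source → η β u = 0} with hZ
  have hZo : IsOpen Z := by
    rw [isOpen_iff_mem_nhds]
    intro y hy
    exact eventually_eventually_nhds.2 hy
  have hZmem : ∀ y β, y ∈ (z β).source → (y ∈ Z ↔ ∀ᶠ w in 𝓝 (z β y), η β ((z β).symm w) = 0) := by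
    intro y β hy
    constructor
    · intro h
      have hc := ((z β).continuousAt_symm ((z β).map_source hy)).tendsto
      rw [(z β).left_inv hy] at hc
      filter_upwards [hc.eventually h, (z β).open_target.mem_nhds ((z β).map_source hy)]
        with w hw hwt
      exact hw β ((z β).map_target hwt)
    · intro h
      filter_upwards [((z β).continuousAt hy).tendsto.eventually h, (z β).open_source.mem_nhds hy]
        with u hu hus γ hγ
      rw [(z β).left_inv hus] at hu
      exact (hη.eq_zero_iff hz ⟨hus, hγ⟩).1 hu
  have hZc : IsClosed Z := by
    rw [← isOpen_compl_iff, isOpen_iff_mem_nhds]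
    intro y hy
    obtain ⟨β, hβ⟩ := hz.covers y
    have h1 : ∀ᶠ w in 𝓝[≠] (z β y), η β ((z β).symm w) ≠ 0 :=
      (han β y hβ).eventually_eq_zero_or_eventually_ne_zero.resolve_left
        fun h => hy ((hZmem y β hβ).2 h)
    have h2 := ((z β).continuousAt hβ).tendsto.eventually (eventually_nhdsWithin_iff.1 h1)
    filter_upwards [h2, (z β).open_source.mem_nhds hβ] with u hu hus huZ
    by_cases huy : u = y
    · exact hy (huy ▸ huZ)
    · refine hu (fun h => huy ((z β).injOn hus hβ h)) ?_
      rw [(z β).left_inv hus]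
      exact huZ.self_of_nhds β hus
  have hZe : Z = ∅ := by
    refine (isClopen_iff.1 ⟨hZc, hZo⟩).resolve_right fun h => ?_
    have : x₀ ∈ Z := h ▸ mem_univ x₀
    exact h0 (this.self_of_nhds α₀ hx₀)
  exact (han α x hx).eventually_eq_zero_or_eventually_ne_zero.resolve_left fun h => by
    have := (hZmem x α hx).2 h
    rw [hZe] at this
    exact this

/-- On a connected surface of genus at least `2` there is a non-zero holomorphic `1`-form with a
zero. -/
theorem exists_oneForm_with_zero [ConnectedSpace C] (hC : 2 ≤ genus C)
    (hz : IsCoordinateSystem z) :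
    ∃ η : ι → C → ℂ, IsOneForm z η ∧
      (∀ α, ∀ x ∈ (z α).source, ∀ᶠ w in 𝓝[≠] (z α x), η α ((z α).symm w) ≠ 0) ∧
      ∃ α, ∃ x ∈ (z α).source, η α x = 0 := by
  obtain ⟨x₀⟩ := (inferInstance : Nonempty C)
  obtain ⟨α₀, hα₀⟩ := hz.covers x₀
  obtain ⟨σ, hσ⟩ : ∃ σ : ContMDiffSection 𝓘(ℂ, ℂ) (ℂ →L[ℂ] ℂ) ω
      (fun x : C => TangentSpace 𝓘(ℂ, ℂ) x →L[ℂ] Bundle.Trivial C ℂ x), σ ≠ 0 := by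
    by_contra! h
    have : Subsingleton (ContMDiffSection 𝓘(ℂ, ℂ) (ℂ →L[ℂ] ℂ) ω
      (fun x : C => TangentSpace 𝓘(ℂ, ℂ) x →L[ℂ] Bundle.Trivial C ℂ x)) :=
      ⟨fun a b => (h a).trans (h b).symm⟩
    have h0 : genus C = 0 := Module.finrank_zero_of_subsingleton
    omega
  obtain ⟨τ, hτ⟩ := exists_linearIndependent_pair_of_one_lt_finrank (R := ℂ)
    (show 1 < Module.finrank ℂ _ from hC) hσ
  rw [LinearIndependent.pair_iff] at hτ
  set a := formCoeff z σ α₀ x₀ with ha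
  set b := formCoeff z τ α₀ x₀ with hb
  obtain ⟨ρ, hρ0, hρ⟩ : ∃ ρ : ContMDiffSection 𝓘(ℂ, ℂ) (ℂ →L[ℂ] ℂ) ω
      (fun x : C => TangentSpace 𝓘(ℂ, ℂ) x →L[ℂ] Bundle.Trivial C ℂ x),
      ρ ≠ 0 ∧ formCoeff z ρ α₀ x₀ = 0 := by
    by_cases ha0 : a = 0
    · exact ⟨σ, hσ, ha0⟩
    · refine ⟨b • σ + (-a) • τ, fun h => ha0 (by simpa using (hτ _ _ h).2), ?_⟩
      change b • formCoeff z σ α₀ x₀ + (-a) • formCoeff z τ α₀ x₀ = 0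
      rw [← ha, ← hb]
      simp only [smul_eq_mul]
      ring
  have hη := isOneForm_formCoeff hz ρ
  obtain ⟨α₁, x₁, hx₁, h1⟩ : ∃ α, ∃ x ∈ (z α).source, formCoeff z ρ α x ≠ 0 := by
    by_contra! h
    exact hρ0 (eq_zero_of_formCoeff_eq_zero hz ρ h)
  exact ⟨formCoeff z ρ, hη, fun α x hx => hη.eventually_ne_zero hz hx₁ h1 hx, α₀, x₀, hα₀, hρ⟩

end OneForms

section LogarithmicForms

variable {C : Type*} [TopologicalSpace C] [ChartedSpace ℂ C] [IsManifold 𝓘(ℂ, ℂ) ω C] {ι : Type*}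
variable {z : ι → OpenPartialHomeomorph C ℂ} {ξ : ι → ι → C → ℂ}

theorem eventually_nhds_coord {e : OpenPartialHomeomorph C ℂ} {x : C} (hx : x ∈ e.source)
    {P : C → Prop} : (∀ᶠ y in 𝓝 x, P y) ↔ ∀ᶠ w in 𝓝 (e x), P (e.symm w) := by
  constructor
  · intro h
    have hc := (e.continuousAt_symm (e.map_source hx)).tendsto
    rw [e.left_inv hx] at hc
    exact hc.eventually h
  · intro h
    filter_upwards [(e.continuousAt hx).tendsto.eventually h, e.open_source.mem_nhds hx] with y hy hys
    rwa [e.left_inv hys] at hy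

theorem eventually_nhdsNE_coord {e : OpenPartialHomeomorph C ℂ} {x : C} (hx : x ∈ e.source)
    {P : C → Prop} : (∀ᶠ y in 𝓝[≠] x, P y) ↔ ∀ᶠ w in 𝓝[≠] (e x), P (e.symm w) := by
  rw [eventually_nhdsWithin_iff, eventually_nhdsWithin_iff, eventually_nhds_coord hx]
  refine eventually_congr ?_
  filter_upwards [e.open_target.mem_nhds (e.map_source hx)] with w hw
  refine imp_congr_left (not_congr ?_)
  constructor
  · rintro h
    rw [mem_singleton_iff, ← mem_singleton_iff.1 h, e.right_inv hw]
  · intro h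
    rw [mem_singleton_iff, mem_singleton_iff.1 h, e.left_inv hx]

theorem eventually_nhdsNE_eventually_nhds {X : Type*} [TopologicalSpace X] [T1Space X] {p : X}
    {P : X → Prop} (h : ∀ᶠ w in 𝓝[≠] p, P w) : ∀ᶠ w in 𝓝[≠] p, ∀ᶠ v in 𝓝 w, P v := by
  have h1 := eventually_eventually_nhds.2 (eventually_nhdsWithin_iff.1 h)
  filter_upwards [h1.filter_mono nhdsWithin_le_nhds, self_mem_nhdsWithin] with w hw hwp
  filter_upwards [hw, isOpen_ne.mem_nhds hwp] with v h2 h3 using h2 h3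

theorem limUnder_eq_of_analyticAt {f φ : ℂ → ℂ} {p : ℂ} (hφ : AnalyticAt ℂ φ p)
    (h : ∀ᶠ w in 𝓝[≠] p, f w = φ w) : ∀ᶠ u in 𝓝 p, limUnder (𝓝[≠] u) f = φ u := by
  have h1 : ∀ᶠ u in 𝓝 p, ∀ᶠ w in 𝓝[≠] u, f w = φ w := by
    have h2 := eventually_nhdsWithin_iff.1 (eventually_nhdsNE_eventually_nhds h)
    filter_upwards [h2] with u hu
    by_cases hup : u = p
    · rwa [hup]
    · exact (hu hup).filter_mono nhdsWithin_le_nhds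
  filter_upwards [h1, hφ.eventually_analyticAt] with u hu hφu
  refine Tendsto.limUnder_eq ?_
  exact ((hφu.continuousAt.tendsto).mono_left nhdsWithin_le_nhds).congr'
    (hu.mono fun w hw => hw.symm)

/-- The residue theorem for meromorphic forms with simple poles; the coefficients `θ α` are only
required to be compatible away from isolated points. -/
theorem finsum_residues_eq_zero [T2Space C] [CompactSpace C] (hz : IsCoordinateSystem z)
    (θ : ι → C → ℂ) (htrans : ∀ α β, ∀ x ∈ (z α).source ∩ (z β).source,
      ∀ᶠ y in 𝓝[≠] x, θ α y = canonicalCocycle z α β y * θ β y)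
    (res : C → ℂ) (hpole : ∀ x, ∃ α, x ∈ (z α).source ∧ ∃ h : ℂ → ℂ, AnalyticAt ℂ h (z α x) ∧
      ∀ᶠ w in 𝓝[≠] (z α x), θ α ((z α).symm w) = res x / (w - z α x) + h w) :
    (Function.support res).Finite ∧ ∑ᶠ x, res x = 0 := by
  classical
  set θ' : ι → C → ℂ := fun α y => limUnder (𝓝[≠] (z α y)) (θ α ∘ (z α).symm) with hθ'
  set Reg : ι → C → Prop := fun α x => x ∈ (z α).source ∧ ∃ φ : ℂ → ℂ, AnalyticAt ℂ φ (z α x) ∧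
    ∀ᶠ w in 𝓝[≠] (z α x), θ α ((z α).symm w) = φ w with hReg
  have hlim : ∀ α x, x ∈ (z α).source → ∀ φ : ℂ → ℂ, AnalyticAt ℂ φ (z α x) →
      (∀ᶠ w in 𝓝[≠] (z α x), θ α ((z α).symm w) = φ w) →
      ∀ᶠ w in 𝓝 (z α x), θ' α ((z α).symm w) = φ w := by
    intro α x hx φ hφ h
    filter_upwards [limUnder_eq_of_analyticAt hφ h,
      (z α).open_target.mem_nhds ((z α).map_source hx)] with w hw hwt
    simp only [hθ', (z α).right_inv hwt]
    exact hw
  -- regularity does not depend on the chart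
  have hRegch : ∀ α β x, Reg α x → x ∈ (z β).source → Reg β x ∧
      θ' β x = canonicalCocycle z β α x * θ' α x := by
    rintro α β x ⟨hα, φ, hφ, hev⟩ hβ
    set ψ : ℂ → ℂ := fun w => canonicalCocycle z β α ((z β).symm w) * φ (z α ((z β).symm w))
    have hβx : (z β).symm (z β x) = x := (z β).left_inv hβ
    have hψ : AnalyticAt ℂ ψ (z β x) := by
      refine AnalyticAt.mul ((holOn_canonicalCocycle hz β α).analyticAt
        ((z β).open_source.inter (z α).open_source) ⟨hβ, hα⟩ (hz.holomorphic β) hβ) ?_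
      refine AnalyticAt.fun_comp ?_ (differentiableAt_transition (hz.holomorphic β)
        (hz.holomorphic α) hβ hα)
      simpa [hβx] using hφ
    have hev2 : ∀ᶠ w in 𝓝[≠] (z β x), θ β ((z β).symm w) = ψ w := by
      rw [← eventually_nhdsNE_coord (P := fun y => θ β y
        = canonicalCocycle z β α y * φ (z α y)) hβ]
      have h1 : ∀ᶠ y in 𝓝[≠] x, θ α y = φ (z α y) := by
        rw [eventually_nhdsNE_coord hα]
        filter_upwards [hev, mem_nhdsWithin_of_mem_nhds
          ((z α).open_target.mem_nhds ((z α).map_source hα))] with w hw hwt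
        rw [hw, (z α).right_inv hwt]
      filter_upwards [htrans β α x ⟨hβ, hα⟩, h1] with y h2 h3
      rw [h2, h3]
    refine ⟨⟨hβ, ψ, hψ, hev2⟩, ?_⟩
    have h4 := (hlim β x hβ ψ hψ hev2).self_of_nhds
    have h5 := (hlim α x hα φ hφ hev).self_of_nhds
    rw [(z β).left_inv hβ] at h4
    rw [(z α).left_inv hα] at h5
    rw [h4, h5]
    simp only [ψ, hβx]
  set G : Set C := {x | ∃ α, Reg α x} with hG
  -- near a point, all other points are regular
  have hiso : ∀ x, ∀ᶠ y in 𝓝[≠] x, y ∈ G := by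
    intro x
    obtain ⟨α, hα, h, hh, hev⟩ := hpole x
    have h2 := eventually_nhdsNE_eventually_nhds hev
    rw [eventually_nhdsNE_coord hα]
    filter_upwards [h2, mem_nhdsWithin_of_mem_nhds
      ((z α).open_target.mem_nhds ((z α).map_source hα)), self_mem_nhdsWithin,
      hh.eventually_analyticAt.filter_mono nhdsWithin_le_nhds] with w hw hwt hwne hwh
    refine ⟨α, (z α).map_target hwt, fun v => res x / (v - z α x) + h v, ?_, ?_⟩
    · rw [(z α).right_inv hwt]
      exact (analyticAt_const.div (analyticAt_id.sub analyticAt_const) (sub_ne_zero.2 hwne)).add hwh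
    · rw [(z α).right_inv hwt]
      exact hw.filter_mono nhdsWithin_le_nhds
  have hGo : IsOpen G := by
    rw [isOpen_iff_mem_nhds]
    rintro x ⟨α, hα, φ, hφ, hev⟩
    have h1 := eventually_nhdsWithin_iff.1 (hiso x)
    filter_upwards [h1] with y hy
    by_cases hyx : y = x
    · rw [hyx]
      exact ⟨α, hα, φ, hφ, hev⟩
    · exact hy hyx
  have hGfin : Gᶜ.Finite := by
    obtain ⟨t, -, ht⟩ := isCompact_univ.elim_nhds_subcover
      (fun x => {y | y ∈ ({x}ᶜ : Set C) → y ∈ G})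
      fun x _ => eventually_nhdsWithin_iff.1 (hiso x)
    refine t.finite_toSet.subset fun y hy => ?_
    obtain ⟨x, hx, hyx⟩ := mem_iUnion₂.1 (ht (mem_univ y))
    by_contra hyt
    exact hy (hyx fun h => hyt (mem_singleton_iff.1 h ▸ hx))
  have hres : ∀ x ∈ G, res x = 0 := by
    rintro x ⟨β, hβ⟩
    obtain ⟨α, hα, h, hh, hev⟩ := hpole x
    obtain ⟨⟨-, φ, hφ, hev2⟩, -⟩ := hRegch β α x hβ hα
    have h1 : ∀ᶠ w in 𝓝[≠] (z α x), (w - z α x) * (φ w - h w) = res x := by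
      filter_upwards [hev, hev2, self_mem_nhdsWithin] with w h2 h3 h4
      have h5 : w - z α x ≠ 0 := sub_ne_zero.2 h4
      rw [← h3, h2]
      field_simp
      ring
    have h2 : Tendsto (fun w => (w - z α x) * (φ w - h w)) (𝓝[≠] (z α x))
        (𝓝 ((z α x - z α x) * (φ (z α x) - h (z α x)))) := by
      refine Tendsto.mono_left (ContinuousAt.tendsto ?_) nhdsWithin_le_nhds
      exact (continuousAt_id.sub continuousAt_const).mul (hφ.continuousAt.sub hh.continuousAt)
    rw [sub_self, zero_mul] at h2
    exact tendsto_nhds_unique (tendsto_const_nhds.congr' (h1.mono fun w hw => hw.symm)) h2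
  have hsupp : Function.support res ⊆ Gᶜ := fun x hx hxG => hx (hres x hxG)
  refine ⟨hGfin.subset hsupp, ?_⟩
  rw [finsum_eq_sum_of_support_subset (s := hGfin.toFinset) res (by simpa using hsupp)]
  refine sum_residues_eq_zero hz hGfin.toFinset θ' ?_ ?_ res ?_
  · intro α
    refine holOn_of_differentiableAt fun x hx => ⟨z α, hz.holomorphic α, hx.1, ?_⟩
    have hxG : x ∈ G := by simpa using hx.2
    obtain ⟨β, hβ⟩ := hxG
    obtain ⟨⟨-, φ, hφ, hev⟩, -⟩ := hRegch β α x hβ hx.1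
    exact hφ.differentiableAt.congr_of_eventuallyEq (hlim α x hx.1 φ hφ hev)
  · intro α β x hx hxS
    have hxG : x ∈ G := by simpa using hxS
    obtain ⟨γ, hγ⟩ := hxG
    exact (hRegch β α x (hRegch γ β x hγ hx.2).1 hx.1).2
  · intro p _
    obtain ⟨α, hα, h, hh, hev⟩ := hpole p
    refine ⟨α, hα, h, hh, ?_⟩
    have h2 := eventually_nhdsNE_eventually_nhds hev
    filter_upwards [h2, mem_nhdsWithin_of_mem_nhds
      ((z α).open_target.mem_nhds ((z α).map_source hα)), self_mem_nhdsWithin,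
      hh.eventually_analyticAt.filter_mono nhdsWithin_le_nhds] with w hw hwt hwne hwh
    have h3 := hlim α ((z α).symm w) ((z α).map_target hwt)
      (fun v => res p / (v - z α p) + h v)
    rw [(z α).right_inv hwt] at h3
    exact (h3 ((analyticAt_const.div (analyticAt_id.sub analyticAt_const)
      (sub_ne_zero.2 hwne)).add hwh) (hw.filter_mono nhdsWithin_le_nhds)).self_of_nhds

/-- The logarithmic derivative of a meromorphic function. -/
theorem logDeriv_simplePole {f : ℂ → ℂ} {p : ℂ} {n : ℤ} (hf : MeromorphicAt f p)
    (hn : meromorphicOrderAt f p = n) : ∃ h : ℂ → ℂ, AnalyticAt ℂ h p ∧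
      ∀ᶠ w in 𝓝[≠] p, deriv f w / f w = n / (w - p) + h w := by
  obtain ⟨g, hg, hg0, hev⟩ := (meromorphicOrderAt_eq_int_iff hf).1 hn
  refine ⟨fun w => deriv g w / g w, hg.deriv.div hg hg0, ?_⟩
  filter_upwards [eventually_nhdsNE_eventually_nhds hev, self_mem_nhdsWithin,
    hg.eventually_analyticAt.filter_mono nhdsWithin_le_nhds,
    (hg.continuousAt.eventually_ne hg0).filter_mono nhdsWithin_le_nhds] with w hw hwp hgw hgw0
  have h1 : w - p ≠ 0 := sub_ne_zero.2 hwp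
  have h2 : HasDerivAt (fun v => (v - p) ^ n • g v)
      ((n * (w - p) ^ (n - 1)) * g w + (w - p) ^ n * deriv g w) w := by
    have h3 : HasDerivAt (fun v : ℂ => (v - p) ^ n) (n * (w - p) ^ (n - 1)) w := by
      have := (hasDerivAt_zpow n (w - p) (Or.inl h1)).comp w ((hasDerivAt_id w).sub_const p)
      rwa [mul_one] at this
    exact h3.mul hgw.differentiableAt.hasDerivAt
  have h4 : f =ᶠ[𝓝 w] fun v => (v - p) ^ n • g v := hw
  rw [h4.deriv_eq, h2.deriv, hw.self_of_nhds, smul_eq_mul, zpow_sub_one₀ h1]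
  have h5 : (w - p) ^ n ≠ 0 := zpow_ne_zero n h1
  field_simp

/-- The coefficient of the logarithmic derivative of `f`. -/
noncomputable def dlog (e : OpenPartialHomeomorph C ℂ) (f : C → ℂ) (x : C) : ℂ :=
  coordDeriv e f x / f x

theorem dlog_symm {e : OpenPartialHomeomorph C ℂ} (f : C → ℂ) {w : ℂ} (hw : w ∈ e.target) :
    dlog e f (e.symm w) = deriv (f ∘ e.symm) w / (f ∘ e.symm) w := by
  rw [dlog, coordDeriv, e.right_inv hw]
  rfl

theorem dlog_simplePole {e : OpenPartialHomeomorph C ℂ} {f : C → ℂ} {x : C} (hx : x ∈ e.source)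
    {n : ℤ} (hf : MeromorphicAt (f ∘ e.symm) (e x))
    (hn : meromorphicOrderAt (f ∘ e.symm) (e x) = n) : ∃ h : ℂ → ℂ, AnalyticAt ℂ h (e x) ∧
      ∀ᶠ w in 𝓝[≠] (e x), dlog e f (e.symm w) = n / (w - e x) + h w := by
  obtain ⟨h, hh, hev⟩ := logDeriv_simplePole hf hn
  refine ⟨h, hh, ?_⟩
  filter_upwards [hev, mem_nhdsWithin_of_mem_nhds (e.open_target.mem_nhds (e.map_source hx))]
    with w hw hwt
  rw [dlog_symm f hwt, hw]

/-- Logarithmic derivatives of sections of powers of `K^{1/2}`. -/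
theorem dlog_transition (hz : IsCoordinateSystem z) (hξ : IsThetaCharacteristic z ξ) {α β : ι}
    {x : C} (hx : x ∈ (z α).source ∩ (z β).source) {f g : C → ℂ} {k : ℤ}
    (hfg : ∀ᶠ y in 𝓝 x, f y = ξ α β y ^ k * g y)
    (hg : MDifferentiableAt 𝓘(ℂ, ℂ) 𝓘(ℂ, ℂ) g x) (hg0 : g x ≠ 0) :
    dlog (z α) f x = canonicalCocycle z α β x * (dlog (z β) g x + k * dlogTheta z ξ α β x) := by
  have h0 := theta_ne_zero hz hξ hx
  have hd := theta_mdifferentiableAt hξ hx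
  have hp : HasDerivAt (fun v : ℂ => v ^ k) (k * ξ α β x ^ (k - 1)) (ξ α β x) :=
    hasDerivAt_zpow k _ (Or.inl h0)
  have hdk : MDifferentiableAt 𝓘(ℂ, ℂ) 𝓘(ℂ, ℂ) (fun y => ξ α β y ^ k) x :=
    MDifferentiableAt.comp x hp.differentiableAt.mdifferentiableAt hd
  have h1 : coordDeriv (z β) (fun y => ξ α β y ^ k) x
      = k * ξ α β x ^ (k - 1) * coordDeriv (z β) (ξ α β) x := by
    have hl : (z β).symm (z β x) = x := (z β).left_inv hx.2
    have h2 := ((mdifferentiableAt_iff_coord (hz.holomorphic β) hx.2).1 hd).hasDerivAt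
    have h3 : HasDerivAt (fun v : ℂ => v ^ k) (k * ξ α β x ^ (k - 1))
        ((ξ α β ∘ (z β).symm) (z β x)) := by simpa [hl] using hp
    exact (h3.comp (z β x) h2).deriv
  have h4 : coordDeriv (z α) f x = canonicalCocycle z α β x *
      (k * ξ α β x ^ (k - 1) * coordDeriv (z β) (ξ α β) x * g x
        + ξ α β x ^ k * coordDeriv (z β) g x) := by
    rw [coordDeriv_congr hx.1 hfg, coordDeriv_change hz hx.1 hx.2
      (f := fun y => ξ α β y ^ k * g y) (hdk.mul hg),
      coordDeriv_mul (hz.holomorphic β) hx.2 hdk hg, h1, smul_eq_mul]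
  rw [dlog, h4, hfg.self_of_nhds, dlog, dlogTheta, zpow_sub_one₀ h0]
  have h5 : ξ α β x ^ k ≠ 0 := zpow_ne_zero k h0
  field_simp
  ring

/-- A holomorphic `1`-form and its divisor, of positive degree. -/
theorem exists_oneForm_with_divisor [ConnectedSpace C] (hC : 2 ≤ genus C)
    (hz : IsCoordinateSystem z) {a : C → ι} (ha : ∀ x, x ∈ (z (a x)).source) :
    ∃ (η : ι → C → ℂ) (m : C → ℕ), IsOneForm z η ∧
      (∀ α, ∀ x ∈ (z α).source, ∀ᶠ y in 𝓝[≠] x, η α y ≠ 0) ∧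
      (∀ x, ∃ h : ℂ → ℂ, AnalyticAt ℂ h (z (a x) x) ∧ ∀ᶠ w in 𝓝[≠] (z (a x) x),
        dlog (z (a x)) (η (a x)) ((z (a x)).symm w) = m x / (w - z (a x) x) + h w) ∧
      ∃ x, m x ≠ 0 := by
  obtain ⟨η, hη, hne, α₁, x₁, hx₁, h0⟩ := exists_oneForm_with_zero hC hz
  have han : ∀ x, AnalyticAt ℂ (η (a x) ∘ (z (a x)).symm) (z (a x) x) := fun x =>
    (hη.holomorphic (a x)).analyticAt (z (a x)).open_source (ha x) (hz.holomorphic (a x)) (ha x)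
  have htop : ∀ x, analyticOrderAt (η (a x) ∘ (z (a x)).symm) (z (a x) x) ≠ ⊤ := by
    intro x h
    have h1 := (analyticOrderAt_eq_top.1 h).filter_mono (nhdsWithin_le_nhds (s := {z (a x) x}ᶜ))
    exact ((hne _ x (ha x)).and h1).exists.elim fun w hw => hw.1 hw.2
  refine ⟨η, fun x => analyticOrderNatAt (η (a x) ∘ (z (a x)).symm) (z (a x) x), hη,
    fun α x hx => (eventually_nhdsNE_coord hx).2 (hne α x hx), ?_, x₁, ?_⟩
  · intro x
    have h1 : meromorphicOrderAt (η (a x) ∘ (z (a x)).symm) (z (a x) x)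
        = ((analyticOrderNatAt (η (a x) ∘ (z (a x)).symm) (z (a x) x) : ℕ) : ℤ) := by
      rw [(han x).meromorphicOrderAt_eq, ← Nat.cast_analyticOrderNatAt (htop x)]
      rfl
    simpa using dlog_simplePole (ha x) (han x).meromorphicAt h1
  · intro h
    have h1 := (han x₁).analyticOrderAt_eq_zero.1
      (by rw [← Nat.cast_analyticOrderNatAt (htop x₁)]; simpa using h)
    refine h1 ?_
    simp only [Function.comp_apply, (z (a x₁)).left_inv (ha x₁)]
    exact (hη.eq_zero_iff hz ⟨hx₁, ha x₁⟩).1 h0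

end LogarithmicForms

section ExtensionBundle

variable {C : Type*} [TopologicalSpace C] [ChartedSpace ℂ C] [IsManifold 𝓘(ℂ, ℂ) ω C] {ι : Type*}
variable {z : ι → OpenPartialHomeomorph C ℂ} {ξ : ι → ι → C → ℂ}
variable (hz : IsCoordinateSystem z) (hξ : IsThetaCharacteristic z ξ)

/-- `∂_β ξ_αβ` -/
noncomputable def dTheta (z : ι → OpenPartialHomeomorph C ℂ) (ξ : ι → ι → C → ℂ) (α β : ι) (x : C) :
    ℂ := coordDeriv (z β) (ξ α β) x

include hz hξ

theorem holOn_dTheta (α β : ι) : HolOn (dTheta z ξ α β) ((z α).source ∩ (z β).source) :=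
  ((hξ.holomorphic α β).coordDeriv ((z α).open_source.inter (z β).open_source)
    (hz.holomorphic β)).mono fun _ hx => ⟨hx, hx.2⟩

theorem isCanonicalOneCocycle_dlogTheta (ħ : ℂ) :
    IsCanonicalOneCocycle z fun α β x => ħ * dlogTheta z ξ α β x where
  holomorphic α β := (holOn_const ħ).mul (holOn_dlogTheta hz hξ α β)
  cocycle α β γ x hx := by
    rw [dlogTheta_cocycle hz hξ hx]
    ring

theorem transE_apply (ħ : ℂ) {α β : ι} {x : C} (hx : x ∈ (z α).source ∩ (z β).source) :
    transE z ξ ħ α β x = !![ξ α β x, -ħ * dTheta z ξ α β x; 0, (ξ α β x)⁻¹] := by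
  have h0 := theta_ne_zero hz hξ hx
  ext i j
  fin_cases i <;> fin_cases j <;>
    simp [transE, Matrix.mul_apply, Fin.sum_univ_two, dlogTheta, dTheta]
  field_simp

theorem holMatrixOn_transE (ħ : ℂ) (α β : ι) :
    HolMatrixOn (transE z ξ ħ α β) ((z α).source ∩ (z β).source) := by
  have h1 := hξ.holomorphic α β
  have h2 := h1.inv fun x hx => theta_ne_zero hz hξ hx
  have h3 := (holOn_const (-ħ)).mul (holOn_dTheta hz hξ α β)
  intro i j
  refine HolOn.congr' (f := fun x => !![ξ α β x, -ħ * dTheta z ξ α β x; 0, (ξ α β x)⁻¹] i j) ?_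
    fun x hx => by rw [transE_apply hz hξ ħ hx]
  fin_cases i <;> fin_cases j
  exacts [h1, h3, holOn_const 0, h2]

theorem dlogTheta_self {α : ι} {x : C} (hx : x ∈ (z α).source) : dlogTheta z ξ α α x = 0 := by
  have := dlogTheta_cocycle hz hξ (α := α) (β := α) (γ := α) ⟨⟨hx, hx⟩, hx⟩
  rw [canonicalCocycle_self hx] at this
  linear_combination -this

theorem isBundle_transE (ħ : ℂ) : IsBundle z (transE z ξ ħ) where
  holomorphic := holMatrixOn_transE hz hξ ħ
  one α x hx := by
    rw [transE, dlogTheta_self hz hξ hx, theta_self hz hξ hx]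
    ext i j
    fin_cases i <;> fin_cases j <;> simp
  cocycle α β γ x hx := by
    obtain ⟨⟨hα, hβ⟩, hγ⟩ := hx
    have h1 := theta_ne_zero hz hξ (α := α) (β := β) ⟨hα, hβ⟩
    have h2 := theta_ne_zero hz hξ (α := β) (β := γ) ⟨hβ, hγ⟩
    have h3 := hξ.sq γ β x ⟨hγ, hβ⟩
    rw [theta_inv hz hξ (α := β) (β := γ) ⟨hβ, hγ⟩] at h3
    simp only [transE, dlogTheta_cocycle hz hξ (α := α) (β := β) (γ := γ) ⟨⟨hα, hβ⟩, hγ⟩,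
      ← hξ.cocycle α β γ x ⟨⟨hα, hβ⟩, hγ⟩, ← h3]
    ext i j
    fin_cases i <;> fin_cases j <;> simp [Matrix.mul_apply, Fin.sum_univ_two]
    · field_simp
      ring
    · field_simp

theorem det_transE (ħ : ℂ) {α β : ι} {x : C} (hx : x ∈ (z α).source ∩ (z β).source) :
    (transE z ξ ħ α β x).det = 1 := by
  rw [transE_apply hz hξ ħ hx, Matrix.det_fin_two_of, mul_inv_cancel₀ (theta_ne_zero hz hξ hx)]
  ring

theorem isShortExact_transE (ħ : ℂ) :
    IsShortExact z (transHalf ξ) (transE z ξ ħ) (transNegHalf ξ) (inclHalf ι C)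
      (projNegHalf ι C) where
  hom_left :=
    { holomorphic := fun _ _ _ => holOn_const _
      intertwines := fun α β x hx => by
        rw [transE_apply hz hξ ħ hx]
        ext i j
        fin_cases i <;> fin_cases j <;>
          simp [inclHalf, transHalf, Matrix.mul_apply, Fin.sum_univ_two] }
  hom_right :=
    { holomorphic := fun _ _ _ => holOn_const _
      intertwines := fun α β x hx => by
        rw [transE_apply hz hξ ħ hx]
        ext i j
        fin_cases i
        fin_cases j <;>
          simp [projNegHalf, transNegHalf, Matrix.mul_apply, Fin.sum_univ_two] }
  injective α x _ v w hvw := by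
    have := congrFun hvw 0
    ext i
    fin_cases i
    simpa [inclHalf, Matrix.mulVec, dotProduct] using this
  exact α x _ v := by
    constructor
    · intro h
      have h1 : v 1 = 0 := by
        simpa [projNegHalf, Matrix.mulVec, dotProduct, Fin.sum_univ_two] using congrFun h 0
      refine ⟨fun _ => v 0, ?_⟩
      ext i
      fin_cases i <;> simp [inclHalf, Matrix.mulVec, dotProduct, h1]
    · rintro ⟨w, rfl⟩
      ext i
      fin_cases i
      simp [projNegHalf, inclHalf, Matrix.mulVec, dotProduct, Fin.sum_univ_two]
  surjective α x _ v := by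
    refine ⟨![0, v 0], ?_⟩
    ext i
    fin_cases i
    simp [projNegHalf, Matrix.mulVec, dotProduct, Fin.sum_univ_two]

omit hz hξ in
theorem HolOn.comp_fst {f : C → ℂ} {V : Set C} (hf : HolOn f V) :
    MDifferentiableOn (𝓘(ℂ, ℂ).prod 𝓘(ℂ, ℂ)) 𝓘(ℂ, ℂ) (fun p : C × ℂ => f p.1) (V ×ˢ univ) :=
  MDifferentiableOn.comp (u := V) hf mdifferentiableOn_fst fun _ hp => hp.1

theorem mdifferentiableOn_transE (α β : ι) (i j : Fin 2) :
    MDifferentiableOn (𝓘(ℂ, ℂ).prod 𝓘(ℂ, ℂ)) 𝓘(ℂ, ℂ)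
      (fun p : C × ℂ => transE z ξ p.2 α β p.1 i j)
      (((z α).source ∩ (z β).source) ×ˢ univ) := by
  have h1 := (hξ.holomorphic α β).comp_fst
  have h2 := ((hξ.holomorphic α β).inv fun x hx => theta_ne_zero hz hξ hx).comp_fst
  have h3 := (holOn_dTheta hz hξ α β).comp_fst
  have h4 : MDifferentiableOn (𝓘(ℂ, ℂ).prod 𝓘(ℂ, ℂ)) 𝓘(ℂ, ℂ) (fun p : C × ℂ => -p.2)
      (((z α).source ∩ (z β).source) ×ˢ univ) := fun p hp =>
    (mdifferentiableWithinAt_snd).neg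
  have h5 : MDifferentiableOn (𝓘(ℂ, ℂ).prod 𝓘(ℂ, ℂ)) 𝓘(ℂ, ℂ)
      (fun p : C × ℂ => -p.2 * dTheta z ξ α β p.1)
      (((z α).source ∩ (z β).source) ×ˢ univ) := fun p hp => (h4 p hp).mul (h3 p hp)
  refine MDifferentiableOn.congr (f := fun p : C × ℂ =>
    !![ξ α β p.1, -p.2 * dTheta z ξ α β p.1; 0, (ξ α β p.1)⁻¹] i j) ?_
    fun p hp => by rw [transE_apply hz hξ p.2 hp.1]
  fin_cases i <;> fin_cases j
  exacts [h1, h5, mdifferentiableOn_const, h2]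

/-- The extension `E_ħ` does not split: otherwise `K` would have a holomorphic connection. -/
theorem not_splits_transE [T2Space C] [CompactSpace C] [ConnectedSpace C] (hC : 2 ≤ genus C)
    {ħ : ℂ} (hħ : ħ ≠ 0) : ¬ Splits z (transE z ξ ħ) (transNegHalf ξ) (projNegHalf ι C) := by
  rintro ⟨r, hr, hpr⟩
  choose a ha using hz.covers
  obtain ⟨η, m, hη, hne, hpole, x₁, hx₁⟩ := exists_oneForm_with_divisor hC hz ha
  have h1 : ∀ α, ∀ x ∈ (z α).source, r α x 1 0 = 1 := by
    intro α x hx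
    have := congrFun (congrFun (hpr α x hx) 0) 0
    simpa [projNegHalf, Matrix.mul_apply, Fin.sum_univ_two] using this
  have h2 : ∀ α β, ∀ x ∈ (z α).source ∩ (z β).source, r α x 0 0
      = canonicalCocycle z α β x * (r β x 0 0 - ħ * dlogTheta z ξ α β x) := by
    intro α β x hx
    have h0 := theta_ne_zero hz hξ hx
    have h3 := congrFun (congrFun (hr.intertwines α β x hx) 0) 0
    rw [transE_apply hz hξ ħ hx] at h3
    simp [transNegHalf, Matrix.mul_apply, Fin.sum_univ_two, h1 β x hx.2] at h3
    rw [← hξ.sq α β x hx, dlogTheta]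
    rw [dTheta] at h3
    field_simp at h3 ⊢
    linear_combination h3
  have h4 := finsum_residues_eq_zero hz
    (fun α x => ħ * dlog (z α) (η α) x + 2 * r α x 0 0) ?_ (fun x => ħ * m x) ?_
  · obtain ⟨hfin, hsum⟩ := h4
    have h5 : ∑ᶠ x, (ħ * m x : ℂ) = ħ * ((∑ x ∈ hfin.toFinset, m x : ℕ) : ℂ) := by
      rw [finsum_eq_sum_of_support_subset (s := hfin.toFinset) _ (by simp), Nat.cast_sum,
        Finset.mul_sum]
    rw [h5] at hsum
    have h6 : ∑ x ∈ hfin.toFinset, m x = 0 := by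
      exact_mod_cast (mul_eq_zero.1 hsum).resolve_left hħ
    refine hx₁ (Finset.sum_eq_zero_iff.1 h6 x₁ ?_)
    simp [hħ, hx₁]
  · intro α β x hx
    have h6 : ∀ᶠ y in 𝓝 x, y ∈ (z α).source ∩ (z β).source :=
      ((z α).open_source.inter (z β).open_source).mem_nhds hx
    filter_upwards [h6.filter_mono nhdsWithin_le_nhds, hne β x hx.2] with y hy hy0
    have h7 := dlog_transition hz hξ hy (f := η α) (g := η β) (k := 2)
      (by
        filter_upwards [((z α).open_source.inter (z β).open_source).mem_nhds hy] with u hu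
        rw [hη.transition α β u hu, ← hξ.sq α β u hu]
        norm_cast)
      ((hη.holomorphic β).mdifferentiableAt (z β).open_source hy.2) hy0
    rw [h7, h2 α β y hy]
    push_cast
    ring
  · intro x
    obtain ⟨h, hh, hev⟩ := hpole x
    have hra : AnalyticAt ℂ ((fun y => r (a x) y 0 0) ∘ (z (a x)).symm) (z (a x) x) :=
      (hr.holomorphic (a x) 0 0).analyticAt (z (a x)).open_source (ha x) (hz.holomorphic _) (ha x)
    refine ⟨a x, ha x, fun w => ħ * h w + 2 * r (a x) ((z (a x)).symm w) 0 0,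
      (analyticAt_const.mul hh).add (analyticAt_const.mul hra), ?_⟩
    filter_upwards [hev] with w hw
    rw [hw]
    ring

end ExtensionBundle

section Gluing

variable {C : Type*} [TopologicalSpace C] [ChartedSpace ℂ C] [IsManifold 𝓘(ℂ, ℂ) ω C] {ι : Type*}
variable {m n : Type*} [Fintype m] [DecidableEq m] [Fintype n] [DecidableEq n]
variable {z : ι → OpenPartialHomeomorph C ℂ}

/-- The entrywise derivative of a matrix-valued function. -/
noncomputable def matDeriv (e : OpenPartialHomeomorph C ℂ) (M : C → Matrix m n ℂ) (x : C) :
    Matrix m n ℂ :=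
  Matrix.of fun i j => coordDeriv e (fun y => M y i j) x

theorem HolMatrixOn.mulVec {M : C → Matrix m n ℂ} {s : C → n → ℂ} {V : Set C}
    (hM : HolMatrixOn M V) (hs : HolOn s V) : HolOn (fun x => M x *ᵥ s x) V := by
  rw [holOn_pi]
  intro i
  simp only [Matrix.mulVec, dotProduct]
  exact holOn_sum _ fun j _ => (hM i j).mul (holOn_pi.1 hs j)

theorem coordDeriv_sum {e : OpenPartialHomeomorph C ℂ} {x : C}
    (he : e ∈ IsManifold.maximalAtlas 𝓘(ℂ, ℂ) ω C) (hx : x ∈ e.source) {κ : Type*} (S : Finset κ)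
    {f : κ → C → ℂ} (hf : ∀ i ∈ S, MDifferentiableAt 𝓘(ℂ, ℂ) 𝓘(ℂ, ℂ) (f i) x) :
    coordDeriv e (fun y => ∑ i ∈ S, f i y) x = ∑ i ∈ S, coordDeriv e (f i) x :=
  deriv_fun_sum fun i hi => (mdifferentiableAt_iff_coord he hx).1 (hf i hi)

theorem coordDeriv_mulVec {e : OpenPartialHomeomorph C ℂ} {x : C} {M : C → Matrix m n ℂ}
    {s : C → n → ℂ} {V : Set C} (he : e ∈ IsManifold.maximalAtlas 𝓘(ℂ, ℂ) ω C)
    (hxe : x ∈ e.source) (hV : IsOpen V) (hx : x ∈ V) (hM : HolMatrixOn M V) (hs : HolOn s V) :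
    coordDeriv e (fun y => M y *ᵥ s y) x = matDeriv e M x *ᵥ s x + M x *ᵥ coordDeriv e s x := by
  ext i
  rw [coordDeriv_apply he hxe ((hM.mulVec hs).mdifferentiableAt hV hx)]
  simp only [Matrix.mulVec, dotProduct, Pi.add_apply, ← Finset.sum_add_distrib, matDeriv,
    Matrix.of_apply]
  have h1 : ∀ j, MDifferentiableAt 𝓘(ℂ, ℂ) 𝓘(ℂ, ℂ) (fun y => M y i j) x := fun j =>
    (hM i j).mdifferentiableAt hV hx
  have h2 : ∀ j, MDifferentiableAt 𝓘(ℂ, ℂ) 𝓘(ℂ, ℂ) (fun y => s y j) x := fun j =>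
    (holOn_pi.1 hs j).mdifferentiableAt hV hx
  rw [coordDeriv_sum he hxe (f := fun j y => M y i j * s y j) _ fun j _ => (h1 j).mul (h2 j)]
  refine Finset.sum_congr rfl fun j _ => ?_
  rw [coordDeriv_mul he hxe (h1 j) (h2 j), coordDeriv_apply he hxe (hs.mdifferentiableAt hV hx)]

theorem holOn_localOp (hz : IsCoordinateSystem z) {lam : ℂ} {A : ι → C → Matrix n n ℂ} {α : ι}
    (hA : HolMatrixOn (A α) (z α).source) {s : C → n → ℂ} {V : Set C} (hV : IsOpen V)
    (hVα : V ⊆ (z α).source) (hs : HolOn s V) : HolOn (localOp z lam A α s) V := by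
  refine HolOn.add ((hs.coordDeriv hV (hz.holomorphic α)).mono
    (fun x hx => ⟨hx, hVα hx⟩) |>.const_smul lam) ?_
  exact HolMatrixOn.mulVec (fun i j => (hA i j).mono hVα) hs

/-- Local operators glue if and only if their matrices transform like those of a
`lam`-connection. -/
theorem isLambdaConnection_iff (hz : IsCoordinateSystem z) {g : ι → ι → C → Matrix n n ℂ}
    (hg : IsBundle z g) {lam : ℂ} {A : ι → C → Matrix n n ℂ}
    (hA : ∀ α, HolMatrixOn (A α) (z α).source) :
    IsLambdaConnection z g lam A ↔ ∀ α β, ∀ x ∈ (z α).source ∩ (z β).source,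
      lam • matDeriv (z α) (g α β) x + A α x * g α β x
        = canonicalCocycle z α β x • (g α β x * A β x) := by
  have ho : ∀ α β, IsOpen ((z α).source ∩ (z β).source) := fun α β =>
    (z α).open_source.inter (z β).open_source
  constructor
  · intro h α β x hx
    refine Matrix.ext_of_mulVec_single fun j => ?_
    set v : n → ℂ := Pi.single j 1
    have hs : IsSection z g ((z α).source ∩ (z β).source) fun γ y => g γ β y *ᵥ v := by
      refine ⟨fun γ => ?_, fun γ δ y hy => ?_⟩
      · exact HolMatrixOn.mulVec (fun i j => (hg.holomorphic γ β i j).mono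
          fun y hy => ⟨hy.2, hy.1.2⟩) (holOn_const v)
      · rw [Matrix.mulVec_mulVec, hg.cocycle γ δ β y ⟨hy.2, hy.1.2⟩]
    have h1 := (h.glue _ (ho α β) _ hs).2 α β x ⟨hx, hx⟩
    have h2 : coordDeriv (z β) (fun y => g β β y *ᵥ v) x = 0 := by
      rw [coordDeriv_congr_of_eqOn (g := fun _ => v) hx.2 (z β).open_source hx.2
        fun y hy => by rw [hg.one β y hy, Matrix.one_mulVec], coordDeriv_const]
    have h3 : coordDeriv (z α) (fun y => g α β y *ᵥ v) x = matDeriv (z α) (g α β) x *ᵥ v := by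
      rw [coordDeriv_mulVec (hz.holomorphic α) hx.1 (ho α β) hx (hg.holomorphic α β)
        (holOn_const v), coordDeriv_const, Matrix.mulVec_zero, add_zero]
    simp only [localOp, h2, h3, hg.one β x hx.2, Matrix.one_mulVec, smul_zero, zero_add,
      tensorCanonical] at h1
    rw [Matrix.add_mulVec, Matrix.smul_mulVec, ← Matrix.mulVec_mulVec, h1, Matrix.smul_mulVec,
      Matrix.smul_mulVec, ← Matrix.mulVec_mulVec]
  · intro h
    refine ⟨hA, fun V hV s hs => ⟨fun α => ?_, fun α β x hx => ?_⟩⟩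
    · exact holOn_localOp hz (hA α) (hV.inter (z α).open_source) inter_subset_right (hs.1 α)
    · obtain ⟨hxV, hx⟩ := hx
      have hW : IsOpen (V ∩ ((z α).source ∩ (z β).source)) := hV.inter (ho α β)
      have hsβ : HolOn (s β) (V ∩ ((z α).source ∩ (z β).source)) :=
        (hs.1 β).mono fun y hy => ⟨hy.1, hy.2.2⟩
      have h1 : coordDeriv (z α) (s α) x = matDeriv (z α) (g α β) x *ᵥ s β x
          + g α β x *ᵥ (canonicalCocycle z α β x • coordDeriv (z β) (s β) x) := by
        rw [coordDeriv_congr_of_eqOn hx.1 hW ⟨hxV, hx⟩ (hs.2 α β),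
          coordDeriv_mulVec (hz.holomorphic α) hx.1 hW ⟨hxV, hx⟩
            (fun i j => (hg.holomorphic α β i j).mono fun y hy => hy.2) hsβ,
          coordDeriv_change hz hx.1 hx.2 (hsβ.mdifferentiableAt hW ⟨hxV, hx⟩)]
      have h2 := congrArg (· *ᵥ s β x) (h α β x hx)
      simp only [Matrix.add_mulVec, Matrix.smul_mulVec] at h2
      simp only [localOp, h1, tensorCanonical, hs.2 α β x ⟨hxV, hx⟩, Matrix.mulVec_add,
        Matrix.smul_mulVec, Matrix.mulVec_smul, smul_add, Matrix.mulVec_mulVec, Matrix.smul_mul]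
      rw [← h2]
      module

end Gluing

section HitchinSection

variable {C : Type*} [TopologicalSpace C] [ChartedSpace ℂ C] [IsManifold 𝓘(ℂ, ℂ) ω C] {ι : Type*}
variable {z : ι → OpenPartialHomeomorph C ℂ} {ξ : ι → ι → C → ℂ}
variable (hz : IsCoordinateSystem z) (hξ : IsThetaCharacteristic z ξ)

omit [TopologicalSpace C] [ChartedSpace ℂ C] [IsManifold 𝓘(ℂ, ℂ) ω C] in
theorem higgs_eq (q : ι → C → ℂ) (α : ι) (x : C) : higgs q α x = !![0, q α x; 1, 0] := by
  ext i j
  fin_cases i <;> fin_cases j <;> simp [higgs, Xminus, Xplus]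

theorem holMatrixOn_smul_higgs {q : ι → C → ℂ} (hq : ∀ α, HolOn (q α) (z α).source) (c : ℂ)
    (α : ι) : HolMatrixOn (fun x => -(c • higgs q α x)) (z α).source := by
  intro i j
  simp only [higgs_eq]
  fin_cases i <;> fin_cases j <;> simp
  exacts [holOn_const _, ((holOn_const c).mul (hq α)).neg, holOn_const _, holOn_const _]

include hz hξ

/-- The local operators `lam • d - c φ(q)`, with `lam = ħ c`, glue on `E_ħ` precisely if
`ħ lam ∂_β² ξ_αβ = 0`. -/
theorem isLambdaConnection_higgs_iff {q : ι → C → ℂ} (hq : IsQuadraticDifferential z q)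
    (ħ c : ℂ) :
    IsLambdaConnection z (transE z ξ ħ) (c * ħ) (fun α x => -(c • higgs q α x)) ↔
      ∀ α β, ∀ x ∈ (z α).source ∩ (z β).source,
        c * ħ * ħ * coordDeriv (z β) (dTheta z ξ α β) x = 0 := by
  rw [isLambdaConnection_iff hz (isBundle_transE hz hξ ħ) (holMatrixOn_smul_higgs hq.holomorphic c)]
  refine forall₂_congr fun α β => forall₂_congr fun x hx => ?_
  have ho : IsOpen ((z α).source ∩ (z β).source) := (z α).open_source.inter (z β).open_source
  have h0 := theta_ne_zero hz hξ hx
  have hd := theta_mdifferentiableAt hξ hx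
  have hd2 := (holOn_dTheta hz hξ α β).mdifferentiableAt ho hx
  have hK := hξ.sq α β x hx
  have d00 : coordDeriv (z α) (fun y => transE z ξ ħ α β y 0 0) x
      = ξ α β x ^ 2 * dTheta z ξ α β x := by
    rw [coordDeriv_congr_of_eqOn (g := ξ α β) hx.1 ho hx fun y hy => by
      rw [transE_apply hz hξ ħ hy]; rfl, coordDeriv_change hz hx.1 hx.2 hd, hK, smul_eq_mul, dTheta]
  have d01 : coordDeriv (z α) (fun y => transE z ξ ħ α β y 0 1) x
      = ξ α β x ^ 2 * (-ħ * coordDeriv (z β) (dTheta z ξ α β) x) := by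
    rw [coordDeriv_congr_of_eqOn (g := fun y => -ħ * dTheta z ξ α β y) hx.1 ho hx fun y hy => by
      rw [transE_apply hz hξ ħ hy]; rfl,
      coordDeriv_mul (hz.holomorphic α) hx.1 mdifferentiableAt_const hd2, coordDeriv_const,
      coordDeriv_change hz hx.1 hx.2 hd2, hK, smul_eq_mul]
    ring
  have d10 : coordDeriv (z α) (fun y => transE z ξ ħ α β y 1 0) x = 0 := by
    rw [coordDeriv_congr_of_eqOn (g := fun _ => (0 : ℂ)) hx.1 ho hx fun y hy => by
      rw [transE_apply hz hξ ħ hy]; rfl, coordDeriv_const]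
  have d11 : coordDeriv (z α) (fun y => transE z ξ ħ α β y 1 1) x = -dTheta z ξ α β x := by
    rw [coordDeriv_congr_of_eqOn (g := fun y => (ξ α β y)⁻¹) hx.1 ho hx fun y hy => by
      rw [transE_apply hz hξ ħ hy]; rfl, coordDeriv_inv (hz.holomorphic α) hx.1 hd h0,
      coordDeriv_change hz hx.1 hx.2 hd, ← hK, smul_eq_mul, dTheta]
    field_simp
  rw [← Matrix.ext_iff, Fin.forall_fin_two, Fin.forall_fin_two, Fin.forall_fin_two]
  have hqt := hq.transition α β x hx
  rw [← hK] at hqt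
  simp only [Matrix.add_apply, Matrix.smul_apply, matDeriv, Matrix.of_apply, d00, d01, d10, d11,
    Matrix.mul_apply, Fin.sum_univ_two, transE_apply hz hξ ħ hx, higgs_eq, ← hK, hqt,
    Matrix.neg_apply, Matrix.of_apply, Matrix.cons_val', Matrix.cons_val_zero, Matrix.cons_val_one,
    Matrix.cons_val_fin_one, smul_eq_mul]
  set t := ξ α β x
  set u := dTheta z ξ α β x
  set v := coordDeriv (z β) (dTheta z ξ α β) x
  have ht : t * t⁻¹ = 1 := mul_inv_cancel₀ h0
  constructor
  · rintro ⟨⟨-, h⟩, -⟩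
    have h2 : t ^ 2 * (c * ħ * ħ * v) = 0 := by
      linear_combination -h - c * t ^ 3 * q β x * ht
    exact (mul_eq_zero.1 h2).resolve_left (pow_ne_zero 2 h0)
  · intro h
    refine ⟨⟨by ring, ?_⟩, ?_, by ring⟩
    · linear_combination -t ^ 2 * h - c * t ^ 3 * q β x * ht
    · linear_combination c * t * ht

end HitchinSection

section Projective

variable {C : Type*} [TopologicalSpace C] [ChartedSpace ℂ C] [IsManifold 𝓘(ℂ, ℂ) ω C] {ι : Type*}
variable {z : ι → OpenPartialHomeomorph C ℂ} {ξ : ι → ι → C → ℂ}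

theorem eventually_eq_of_coordDeriv_eq_zero {e : OpenPartialHomeomorph C ℂ}
    (he : e ∈ IsManifold.maximalAtlas 𝓘(ℂ, ℂ) ω C) {W : Set C} (hW : IsOpen W) (hWe : W ⊆ e.source)
    {f : C → ℂ} (hf : HolOn f W) (h0 : ∀ x ∈ W, coordDeriv e f x = 0) {x : C} (hx : x ∈ W) :
    ∀ᶠ y in 𝓝 x, f y = f x := by
  rw [eventually_nhds_coord (hWe hx)]
  have hopen : IsOpen (e.target ∩ e.symm ⁻¹' W) := e.isOpen_inter_preimage_symm hW
  obtain ⟨r, hr, hball⟩ := Metric.isOpen_iff.1 hopen (e x)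
    ⟨e.map_source (hWe hx), by simpa [e.left_inv (hWe hx)] using hx⟩
  have hd : DifferentiableOn ℂ (f ∘ e.symm) (Metric.ball (e x) r) := fun w hw => by
    have h1 := hf.differentiableAt hW (hball hw).2 he (hWe (hball hw).2)
    rw [e.right_inv (hball hw).1] at h1
    exact h1.differentiableWithinAt
  have hd0 : EqOn (deriv (f ∘ e.symm)) 0 (Metric.ball (e x) r) := fun w hw => by
    have h1 := h0 _ (hball hw).2
    rwa [coordDeriv, e.right_inv (hball hw).1] at h1
  filter_upwards [Metric.ball_mem_nhds (e x) hr] with w hw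
  have h2 := Metric.isOpen_ball.is_const_of_deriv_eq_zero (convex_ball (e x) r).isPreconnected hd hd0
    hw (Metric.mem_ball_self hr)
  simpa [e.left_inv (hWe hx)] using h2

theorem eq_of_coordDeriv_eq_zero {e : OpenPartialHomeomorph C ℂ}
    (he : e ∈ IsManifold.maximalAtlas 𝓘(ℂ, ℂ) ω C) {W : Set C} (hW : IsOpen W) (hWe : W ⊆ e.source)
    {f : C → ℂ} (hf : HolOn f W) (h0 : ∀ x ∈ W, coordDeriv e f x = 0) (hc : IsPreconnected W)
    {x y : C} (hx : x ∈ W) (hy : y ∈ W) : f x = f y := by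
  refine hc.induction₂ (fun a b => f a = f b) (fun a ha => ?_) (fun _ _ _ _ _ _ => Eq.trans)
    (fun _ _ _ _ => Eq.symm) hx hy
  exact eventually_nhdsWithin_of_eventually_nhds
    ((eventually_eq_of_coordDeriv_eq_zero he hW hWe hf h0 ha).mono fun _ h => h.symm)

variable (hz : IsCoordinateSystem z) (hξ : IsThetaCharacteristic z ξ)
include hz hξ

theorem coordDeriv_dTheta_eq_zero (h : IsProjective z) {α β : ι} {x : C}
    (hx : x ∈ (z α).source ∩ (z β).source) : coordDeriv (z β) (dTheta z ξ α β) x = 0 := by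
  set e := z β with he
  have hopen : IsOpen (e.target ∩ e.symm ⁻¹' ((z α).source ∩ e.source)) :=
    e.isOpen_inter_preimage_symm ((z α).open_source.inter (z β).open_source)
  obtain ⟨r, hr, hball⟩ := Metric.isOpen_iff.1 hopen (e x)
    ⟨e.map_source hx.2, by simpa [e.left_inv hx.2] using hx⟩
  set B := Metric.ball (e x) r
  have hBo : IsOpen B := Metric.isOpen_ball
  obtain ⟨⟨M, hdet⟩, hM⟩ := h α β (e.symm '' B) (by rintro _ ⟨w, hw, rfl⟩; exact (hball hw).2)
    ((convex_ball (e x) r).isPreconnected.image _ (e.continuousOn_symm.mono fun w hw =>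
      (hball hw).1))
  rw [Matrix.det_fin_two] at hdet
  simp only [forall_mem_image] at hM
  set c := M 1 0
  set d := M 1 1
  have hne : ∀ w ∈ B, c * w + d ≠ 0 := fun w hw => by
    have := (hM hw).1
    rwa [← he, e.right_inv (hball hw).1] at this
  set F := ξ α β ∘ e.symm
  have hFd : DifferentiableOn ℂ F B := fun w hw => by
    have h1 := (hξ.holomorphic α β).differentiableAt ((z α).open_source.inter (z β).open_source)
      (hball hw).2 (hz.holomorphic β) (hball hw).2.2
    rw [← he, e.right_inv (hball hw).1] at h1
    exact h1.differentiableWithinAt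
  have hF2 : ∀ w ∈ B, F w ^ 2 = (c * w + d) ^ 2 := fun w hw => by
    have hy := (hball hw).2
    have h1 := hξ.sq α β (e.symm w) hy
    have h2 := canonicalCocycle_mul hz hy.1 hy.2 hy.1
    rw [canonicalCocycle_self hy.1] at h2
    have h3 : canonicalCocycle z β α (e.symm w) = 1 / (c * w + d) ^ 2 := by
      rw [canonicalCocycle, coordDeriv, ← he, e.right_inv (hball hw).1]
      have h4 : (z α ∘ e.symm) =ᶠ[𝓝 w] fun w => (M 0 0 * w + M 0 1) / (c * w + d) := by
        filter_upwards [hBo.mem_nhds hw] with v hv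
        have := (hM hv).2
        rwa [← he, e.right_inv (hball hv).1] at this
      rw [h4.deriv_eq]
      have h5 : HasDerivAt (fun w => M 0 0 * w + M 0 1) (M 0 0) w := by
        simpa using ((hasDerivAt_id w).const_mul (M 0 0)).add_const (M 0 1)
      have h6 : HasDerivAt (fun w => c * w + d) c w := by
        simpa using ((hasDerivAt_id w).const_mul c).add_const d
      rw [(h5.fun_div h6 (hne w hw)).deriv]
      congr 1
      linear_combination hdet
    rw [h3, mul_one_div, div_eq_one_iff_eq (pow_ne_zero 2 (hne w hw))] at h2
    rw [← h2, ← h1]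
    rfl
  have hdF2 : ∀ w ∈ B, deriv F w * F w = c * (c * w + d) := fun w hw => by
    have h1 : (fun w => F w ^ 2) =ᶠ[𝓝 w] fun w => (c * w + d) ^ 2 := by
      filter_upwards [hBo.mem_nhds hw] with v hv using hF2 v hv
    have h2 := h1.deriv_eq
    have h6 : HasDerivAt (fun w => c * w + d) c w := by
      simpa using ((hasDerivAt_id w).const_mul c).add_const d
    rw [((hFd.differentiableAt (hBo.mem_nhds hw)).hasDerivAt.fun_pow 2).deriv,
      (h6.fun_pow 2).deriv] at h2
    norm_num at h2
    linear_combination h2 / 2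
  have hsq : ∀ w ∈ B, deriv F w ^ 2 = c ^ 2 := fun w hw => by
    have h1 : (c * w + d) ^ 2 * (deriv F w ^ 2 - c ^ 2) = 0 := by
      linear_combination (deriv F w * F w + c * (c * w + d)) * hdF2 w hw -
        deriv F w ^ 2 * hF2 w hw
    linear_combination (mul_eq_zero.1 h1).resolve_left (pow_ne_zero 2 (hne w hw))
  have hxB : e x ∈ B := Metric.mem_ball_self hr
  have hdd : DifferentiableAt ℂ (deriv F) (e x) :=
    ((hFd.analyticAt (hBo.mem_nhds hxB)).deriv).differentiableAt
  have h1 : (fun w => deriv F w ^ 2) =ᶠ[𝓝 (e x)] fun _ => c ^ 2 := by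
    filter_upwards [hBo.mem_nhds hxB] with v hv using hsq v hv
  have h2 := h1.deriv_eq
  rw [(hdd.hasDerivAt.fun_pow 2).deriv, deriv_const] at h2
  have h3 : coordDeriv e (dTheta z ξ α β) x = deriv (deriv F) (e x) := by
    refine Filter.EventuallyEq.deriv_eq ?_
    filter_upwards [hBo.mem_nhds hxB] with v hv
    simp only [Function.comp_apply, dTheta, coordDeriv, ← he, e.right_inv (hball hv).1]
    rfl
  rw [h3]
  norm_num at h2
  rcases h2 with h2 | h2
  · have h4 := hsq _ hxB
    rw [h2] at h4
    have hc : c = 0 := by simpa using h4.symm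
    have h5 : deriv F =ᶠ[𝓝 (e x)] fun _ => 0 := by
      filter_upwards [hBo.mem_nhds hxB] with v hv
      have := hsq v hv
      rw [hc] at this
      simpa using this
    rw [h5.deriv_eq, deriv_const]
  · exact h2

theorem isProjective_of_coordDeriv_dTheta
    (h : ∀ α β, ∀ x ∈ (z α).source ∩ (z β).source, coordDeriv (z β) (dTheta z ξ α β) x = 0) :
    IsProjective z := by
  have : LocallyConnectedSpace C := ChartedSpace.locallyConnectedSpace ℂ C
  intro α β V hV hVc
  rcases V.eq_empty_or_nonempty with rfl | ⟨p, hp⟩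
  · exact ⟨1, fun x hx => hx.elim⟩
  set e := z β
  have heA := hz.holomorphic β
  have ho : IsOpen ((z α).source ∩ e.source) := (z α).open_source.inter e.open_source
  set W := connectedComponentIn ((z α).source ∩ e.source) p
  have hWo : IsOpen W := ho.connectedComponentIn
  have hWc : IsPreconnected W := isPreconnected_connectedComponentIn
  have hWs : W ⊆ (z α).source ∩ e.source := connectedComponentIn_subset _ _
  have hWe : W ⊆ e.source := fun x hx => (hWs hx).2
  have hVW : V ⊆ W := hVc.subset_connectedComponentIn hp hV
  have hpW : p ∈ W := hVW hp
  have hze : HolOn e W := (holOn_coord heA).mono hWe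
  have hzα : HolOn (z α) W := (holOn_coord (hz.holomorphic α)).mono fun x hx => (hWs hx).1
  have hξW : HolOn (ξ α β) W := (hξ.holomorphic α β).mono hWs
  have hξ0 : ∀ x ∈ W, ξ α β x ≠ 0 := fun x hx => theta_ne_zero hz hξ (hWs hx)
  set c := dTheta z ξ α β p
  have hc : ∀ x ∈ W, coordDeriv e (ξ α β) x = c := fun x hx =>
    eq_of_coordDeriv_eq_zero heA hWo hWe ((holOn_dTheta hz hξ α β).mono hWs)
      (fun y hy => h α β y (hWs hy)) hWc hx hpW
  set d := ξ α β p - c * e p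
  have hcz : ∀ x ∈ W, coordDeriv e (fun y => c * e y) x = c := fun x hx => by
    rw [coordDeriv_mul heA (hWe hx) mdifferentiableAt_const (hze.mdifferentiableAt hWo hx),
      coordDeriv_const, coordDeriv_self (hWe hx)]
    ring
  have hd : ∀ x ∈ W, ξ α β x = c * e x + d := fun x hx => by
    have := eq_of_coordDeriv_eq_zero heA hWo hWe (hξW.sub ((holOn_const c).mul hze))
      (fun y hy => by
        rw [coordDeriv_sub heA (hWe hy) (hξW.mdifferentiableAt hWo hy)
          (((holOn_const c).mul hze).mdifferentiableAt hWo hy), hc y hy, hcz y hy, sub_self])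
      hWc hx hpW
    linear_combination this
  have hK : ∀ x ∈ W, coordDeriv e (z α) x = 1 / ξ α β x ^ 2 := fun x hx => by
    rw [hξ.sq α β x (hWs hx), eq_div_iff (canonicalCocycle_ne_zero hz (hWs hx).1 (hWs hx).2)]
    have := canonicalCocycle_mul hz (hWs hx).2 (hWs hx).1 (hWs hx).2
    rwa [canonicalCocycle_self (hWs hx).2] at this
  by_cases hc0 : c = 0
  · have hd' : ∀ x ∈ W, ξ α β x = d := fun x hx => by rw [hd x hx, hc0]; ring
    have hd0 : d ≠ 0 := hd' p hpW ▸ hξ0 p hpW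
    have hdz : HolOn (fun y => 1 / d ^ 2 * e y) W := (holOn_const _).mul hze
    set k := z α p - 1 / d ^ 2 * e p
    have hk : ∀ x ∈ W, z α x - 1 / d ^ 2 * e x = k := fun x hx =>
      eq_of_coordDeriv_eq_zero heA hWo hWe (hzα.sub hdz) (fun y hy => by
        rw [coordDeriv_sub heA (hWe hy) (hzα.mdifferentiableAt hWo hy)
          (hdz.mdifferentiableAt hWo hy), hK y hy, hd' y hy,
          coordDeriv_mul heA (hWe hy) mdifferentiableAt_const (hze.mdifferentiableAt hWo hy),
          coordDeriv_const, coordDeriv_self (hWe hy)]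
        ring) hWc hx hpW
    refine ⟨⟨!![1 / d, k * d; 0, d], ?_⟩, fun x hx => ?_⟩
    · rw [Matrix.det_fin_two_of]; field_simp; simp
    · have h1 := hk x (hVW hx)
      refine ⟨by simpa using hd0, ?_⟩
      have : z α x = 1 / d ^ 2 * e x + k := by linear_combination h1
      rw [this]
      simp
      field_simp
      try ring
  · have hinv : HolOn (fun y => 1 / c * (ξ α β y)⁻¹) W := (holOn_const _).mul (hξW.inv hξ0)
    set k := z α p + 1 / c * (ξ α β p)⁻¹
    have hk : ∀ x ∈ W, z α x + 1 / c * (ξ α β x)⁻¹ = k := fun x hx =>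
      eq_of_coordDeriv_eq_zero heA hWo hWe (hzα.add hinv) (fun y hy => by
        rw [coordDeriv_add heA (hWe hy) (hzα.mdifferentiableAt hWo hy)
          (hinv.mdifferentiableAt hWo hy), hK y hy,
          coordDeriv_mul heA (hWe hy) mdifferentiableAt_const
            ((hξW.inv hξ0).mdifferentiableAt hWo hy),
          coordDeriv_const, coordDeriv_inv heA (hWe hy) (hξW.mdifferentiableAt hWo hy) (hξ0 y hy),
          hc y hy]
        field_simp
        ring) hWc hx hpW
    refine ⟨⟨!![k * c, k * d - 1 / c; c, d], ?_⟩, fun x hx => ?_⟩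
    · rw [Matrix.det_fin_two_of]; field_simp; ring
    · have h1 := hk x (hVW hx)
      have h2 := hξ0 x (hVW hx)
      rw [hd x (hVW hx)] at h1 h2
      refine ⟨by simpa using h2, ?_⟩
      have : z α x = k - 1 / c * (c * e x + d)⁻¹ := by linear_combination h1
      rw [this]
      simp
      change _ = _ / (c * e x + d)
      field_simp
      ring

end Projective

section OperStructure

variable {C : Type*} [TopologicalSpace C] [ChartedSpace ℂ C] [IsManifold 𝓘(ℂ, ℂ) ω C] {ι : Type*}
variable {z : ι → OpenPartialHomeomorph C ℂ} {ξ : ι → ι → C → ℂ} {q : ι → C → ℂ}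

theorem isQuadraticDifferential_zero : IsQuadraticDifferential z fun _ _ => 0 :=
  ⟨fun _ => holOn_const 0, fun _ _ _ _ => by simp⟩

omit [TopologicalSpace C] [ChartedSpace ℂ C] [IsManifold 𝓘(ℂ, ℂ) ω C] in
theorem operForm_one (q : ι → C → ℂ) : operForm 1 q = fun α x => -higgs q α x := by
  ext
  simp [operForm]

omit [IsManifold 𝓘(ℂ, ℂ) ω C] in
theorem localOp_higgs {ħ : ℂ} (hħ : ħ ≠ 0) (q : ι → C → ℂ) (α : ι) (s : C → Fin 2 → ℂ) (x : C) :
    localOp z ħ (fun α x => -higgs q α x) α s x = ħ • localOp z 1 (operForm ħ q) α s x := by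
  simp only [localOp, operForm, smul_add, one_smul, ← Matrix.smul_mulVec, smul_neg, smul_smul,
    mul_one_div_cancel hħ]

theorem mem_span_e1 {v : Fin 2 → ℂ} : v ∈ Submodule.span ℂ {![(1 : ℂ), 0]} ↔ v 1 = 0 := by
  rw [Submodule.mem_span_singleton]
  constructor
  · rintro ⟨a, rfl⟩
    simp
  · intro h
    refine ⟨v 0, ?_⟩
    ext i
    fin_cases i <;> simp [h]

theorem higgs_mulVec (q : ι → C → ℂ) (α : ι) (x : C) (v : Fin 2 → ℂ) :
    higgs q α x *ᵥ v = ![q α x * v 1, v 0] := by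
  ext i
  rw [higgs_eq]
  fin_cases i <;> simp [Matrix.mulVec, dotProduct, Fin.sum_univ_two]

theorem inducesIsoOnQuotient_operForm (hz : IsCoordinateSystem z) {ħ : ℂ} (hħ : ħ ≠ 0) :
    InducesIsoOnQuotient z (operForm ħ q) fun _ _ => Submodule.span ℂ {![(1 : ℂ), 0]} := by
  have key : ∀ α, ∀ V ⊆ (z α).source, IsOpen V → ∀ s : C → Fin 2 → ℂ, HolOn s V →
      (∀ x ∈ V, s x 1 = 0) → ∀ x ∈ V, localOp z 1 (operForm ħ q) α s x 1 = -(1 / ħ) * s x 0 := by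
    intro α V hVα hV s hs h x hx
    have h1 : coordDeriv (z α) (fun y => s y 1) x = 0 := by
      rw [coordDeriv_congr_of_eqOn (g := fun _ => (0 : ℂ)) (hVα hx) hV hx h, coordDeriv_const]
    simp only [localOp, operForm, Pi.add_apply, one_smul, Matrix.neg_mulVec, Matrix.smul_mulVec,
      higgs_mulVec, coordDeriv_apply (hz.holomorphic α) (hVα hx) (hs.mdifferentiableAt hV hx), h1]
    simp
  constructor
  · intro α V hVα hV s hs hsL hL x hx
    simp only [mem_span_e1] at hsL hL
    have h1 := key α V hVα hV s hs hsL x hx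
    rw [hL x hx] at h1
    have h2 : s x 0 = 0 := by
      have : ħ⁻¹ ≠ 0 := inv_ne_zero hħ
      simpa [hħ] using h1.symm
    ext i
    fin_cases i
    exacts [h2, hsL x hx]
  · intro α V hVα hV t ht x hx
    have hs : HolOn (fun y => ![-ħ * t y 1, 0]) V := by
      rw [holOn_pi, Fin.forall_fin_two]
      exact ⟨(holOn_const (-ħ)).mul (holOn_pi.1 ht 1), holOn_const 0⟩
    refine ⟨V, Subset.rfl, hV, hx, _, hs, fun y _ => mem_span_e1.2 (by simp), fun y hy => ?_⟩
    rw [mem_span_e1, Pi.sub_apply, key α V hVα hV _ hs (fun _ _ => by simp) y hy]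
    simp
    field_simp
    ring

variable (hz : IsCoordinateSystem z) (hξ : IsThetaCharacteristic z ξ)
include hz hξ

theorem isLineSubbundle_e1 (ħ : ℂ) :
    IsLineSubbundle z (transE z ξ ħ) fun _ _ => Submodule.span ℂ {![(1 : ℂ), 0]} := by
  constructor
  · intro α β x hx
    have h0 := theta_ne_zero hz hξ hx
    have h1 : Matrix.toLin' (transE z ξ ħ α β x) ![1, 0] = ξ α β x • ![1, 0] := by
      ext i
      rw [transE_apply hz hξ ħ hx]
      fin_cases i <;> simp [Matrix.mulVec, dotProduct, Fin.sum_univ_two]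
    rw [Submodule.map_span, image_singleton, h1,
      Submodule.span_singleton_smul_eq (IsUnit.mk0 _ h0)]
  · intro α x hx
    exact ⟨(z α).source, Subset.rfl, (z α).open_source, hx, fun _ => ![1, 0], holOn_const _,
      fun y _ => ⟨fun h => by simpa using congrFun h 0, rfl⟩⟩

theorem isConnection_Xminus_iff {ħ : ℂ} (hħ : ħ ≠ 0) :
    IsConnection z (transE z ξ ħ) (fun _ _ => -((1 / ħ) • Xminus)) ↔ IsProjective z := by
  have h := isLambdaConnection_higgs_iff hz hξ isQuadraticDifferential_zero ħ (1 / ħ)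
  simp only [higgs, zero_smul, add_zero, one_div_mul_cancel hħ, one_mul, mul_eq_zero, hħ,
    false_or] at h
  rw [IsConnection, h]
  exact ⟨isProjective_of_coordDeriv_dTheta hz hξ,
    fun hp _ _ _ hx => coordDeriv_dTheta_eq_zero hz hξ hp hx⟩

theorem isLambdaConnection_higgs (hp : IsProjective z) (hq : IsQuadraticDifferential z q)
    (ħ c : ℂ) :
    IsLambdaConnection z (transE z ξ ħ) (c * ħ) (fun α x => -(c • higgs q α x)) :=
  (isLambdaConnection_higgs_iff hz hξ hq ħ c).2 fun _ _ _ hx => by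
    rw [coordDeriv_dTheta_eq_zero hz hξ hp hx, mul_zero]

theorem isSLPair_higgs (hp : IsProjective z) (hq : IsQuadraticDifferential z q) (ħ c : ℂ) :
    IsSLPair z (transE z ξ ħ) (c * ħ) (fun α x => -(c • higgs q α x)) where
  bundle := isBundle_transE hz hξ ħ
  det_eq_one _ _ _ hx := det_transE hz hξ ħ hx
  connection := isLambdaConnection_higgs hz hξ hp hq ħ c
  trace_eq_zero α x _ := by simp [higgs_eq, Matrix.trace_fin_two]

theorem isSLPair_operForm (hp : IsProjective z) (hq : IsQuadraticDifferential z q) {ħ : ℂ}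
    (hħ : ħ ≠ 0) : IsSLPair z (transE z ξ ħ) 1 (operForm ħ q) := by
  have h := isSLPair_higgs hz hξ hp hq ħ (1 / ħ)
  rwa [one_div_mul_cancel hħ] at h

theorem transE_zero {α β : ι} {x : C} (hx : x ∈ (z α).source ∩ (z β).source) :
    transE z ξ 0 α β x = !![ξ α β x, 0; 0, (ξ α β x)⁻¹] := by
  simp [transE_apply hz hξ 0 hx]

end OperStructure

section Gauge

variable {C : Type*} [TopologicalSpace C] [ChartedSpace ℂ C] [IsManifold 𝓘(ℂ, ℂ) ω C] {ι : Type*}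
variable {m n : Type*} [Fintype m] [DecidableEq m] [Fintype n] [DecidableEq n]
variable {z : ι → OpenPartialHomeomorph C ℂ} {ξ : ι → ι → C → ℂ} {q : ι → C → ℂ}

/-- A constant invertible matrix intertwining the transition functions and the local forms is a
gauge transformation. -/
theorem isGaugeTransformation_const (hz : IsCoordinateSystem z) {lam : ℂ}
    {g g' : ι → ι → C → Matrix n n ℂ} {A A' : ι → C → Matrix n n ℂ} {M : Matrix n n ℂ}
    (hM : IsUnit M)
    (hg : ∀ α β, ∀ x ∈ (z α).source ∩ (z β).source, M * g α β x = g' α β x * M)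
    (hA : ∀ α, ∀ x ∈ (z α).source, M * A α x = A' α x * M) :
    IsGaugeTransformation z lam g A g' A' fun _ _ => M where
  holomorphic _ _ _ := holOn_const _
  intertwines := hg
  invertible _ _ _ := hM
  commutes α V hVα hV s hs x hx := by
    have h0 : matDeriv (z α) (fun _ => M) x = 0 := by
      ext i j
      simp [matDeriv, coordDeriv_const]
    rw [localOp, localOp, coordDeriv_mulVec (M := fun _ => M) (hz.holomorphic α) (hVα hx)
      hV hx (fun _ _ => holOn_const _) hs, h0, Matrix.zero_mulVec, zero_add, Matrix.mulVec_add,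
      Matrix.mulVec_smul, Matrix.mulVec_mulVec, Matrix.mulVec_mulVec, hA α x (hVα hx)]

theorem tendstoLocallyUniformlyOn_of_forall_eq {X κ : Type*} [TopologicalSpace X] {l : Filter κ}
    {G : κ → X → ℂ} {f : X → ℂ} {S : Set X} (h : ∀ n x, G n x = f x) :
    TendstoLocallyUniformlyOn G f l S := by
  obtain rfl : G = fun _ => f := by
    ext n x
    exact h n x
  exact fun u hu x _ => ⟨univ, univ_mem, Eventually.of_forall fun n y _ => refl_mem_uniformity hu⟩

theorem tendstoLocallyUniformlyOn_cobounded {X : Type*} [TopologicalSpace X] {f : X → ℂ} {S : Set X}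
    (hf : ContinuousOn f S) :
    TendstoLocallyUniformlyOn (fun (ħ : ℂ) x => -(1 / ħ ^ 2 * f x)) (fun _ => 0)
      (Bornology.cobounded ℂ) S := by
  rw [Metric.tendstoLocallyUniformlyOn_iff]
  intro ε hε x hx
  have h1 : ∀ᶠ y in 𝓝[S] x, ‖f y‖ < ‖f x‖ + 1 :=
    (hf x hx).norm.eventually_lt continuousWithinAt_const (by simp)
  refine ⟨_, h1, ?_⟩
  have h2 : Tendsto (fun ħ : ℂ => 1 / ‖ħ‖ ^ 2 * (‖f x‖ + 1)) (Bornology.cobounded ℂ) (𝓝 0) := by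
    have h3 : Tendsto (fun ħ : ℂ => ‖ħ‖ ^ 2) (Bornology.cobounded ℂ) atTop :=
      (tendsto_pow_atTop two_ne_zero).comp tendsto_norm_cobounded_atTop
    simpa using (h3.inv_tendsto_atTop).mul_const (‖f x‖ + 1)
  filter_upwards [h2.eventually (gt_mem_nhds hε)] with ħ hħ y hy
  rw [dist_eq_norm]
  simp only [zero_sub, neg_neg, norm_mul, norm_div, norm_one, norm_pow]
  exact lt_of_le_of_lt (by gcongr) hħ

variable (hz : IsCoordinateSystem z) (hξ : IsThetaCharacteristic z ξ)
include hz hξ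

theorem exists_gauge_tendsto_operForm (hq : ∀ α, HolOn (q α) (z α).source) :
    ∃ (T : ℂ → ι → C → Matrix (Fin 2) (Fin 2) ℂ) (B : ℂ → ι → C → Matrix (Fin 2) (Fin 2) ℂ),
      (∀ ħ : ℂ, ħ ≠ 0 → IsGaugeTransformation z 1 (transE z ξ ħ) (operForm ħ q)
        (transE z ξ 1) (B ħ) (T ħ)) ∧
      ∀ α i j, TendstoLocallyUniformlyOn (fun (ħ : ℂ) (x : C) => B ħ α x i j)
        (fun x => operForm 1 (fun _ _ => 0) α x i j) (Bornology.cobounded ℂ) (z α).source := by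
  refine ⟨fun ħ _ _ => !![1, 0; 0, ħ], fun ħ α x => -higgs (fun α x => 1 / ħ ^ 2 * q α x) α x,
    fun ħ hħ => ?_, fun α i j => ?_⟩
  · refine isGaugeTransformation_const hz ?_ (fun α β x hx => ?_) fun α x hx => ?_
    · rw [Matrix.isUnit_iff_isUnit_det, Matrix.det_fin_two_of]
      simpa using hħ
    · rw [transE_apply hz hξ ħ hx, transE_apply hz hξ 1 hx]
      ext i j
      fin_cases i <;> fin_cases j <;> simp [Matrix.mul_apply, Fin.sum_univ_two, mul_comm]
    · simp only [operForm, higgs_eq]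
      ext i j
      fin_cases i <;> fin_cases j <;> simp [Matrix.mul_apply, Fin.sum_univ_two, hħ]
      field_simp
  · simp only [operForm, higgs_eq]
    fin_cases i <;> fin_cases j <;> simp only [Matrix.neg_apply, Matrix.smul_apply]
    · exact tendstoLocallyUniformlyOn_of_forall_eq (by simp)
    · simpa using tendstoLocallyUniformlyOn_cobounded (hq α).continuousOn
    · exact tendstoLocallyUniformlyOn_of_forall_eq (by simp)
    · exact tendstoLocallyUniformlyOn_of_forall_eq (by simp)

/-- The Higgs bundle `(E_0, φ(q))` is fixed by `ℂ^*` if and only if `q = 0`. -/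
theorem higgs_fixed_iff :
    (∀ lam : ℂ, lam ≠ 0 → ∃ T, IsGaugeTransformation z 0
      (transE z ξ 0) (fun α x => lam • higgs q α x) (transE z ξ 0) (higgs q) T) ↔
      ∀ α, ∀ x ∈ (z α).source, q α x = 0 := by
  constructor
  · intro h α x hx
    obtain ⟨T, hT⟩ := h 2 two_ne_zero
    have h1 : T α x * ((2 : ℂ) • higgs q α x) = higgs q α x * T α x := by
      refine Matrix.ext_of_mulVec_single fun j => ?_
      have := hT.commutes α _ Subset.rfl (z α).open_source (fun _ => Pi.single j 1)
        (holOn_const _) x hx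
      simpa only [localOp, zero_smul, zero_add, Matrix.mulVec_mulVec] using this
    have h2 := congrArg Matrix.det h1
    have h3 := ((Matrix.isUnit_iff_isUnit_det _).1 (hT.invertible α x hx)).ne_zero
    rw [Matrix.det_mul, Matrix.det_mul, Matrix.det_smul, higgs_eq, Matrix.det_fin_two_of] at h2
    have h4 : (T α x).det * (3 * q α x) = 0 := by
      simp only [Fintype.card_fin] at h2
      linear_combination -h2
    simpa [h3] using h4
  · intro h lam hlam
    refine ⟨fun _ _ => !![lam, 0; 0, 1], isGaugeTransformation_const hz ?_ (fun α β x hx => ?_)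
      fun α x hx => ?_⟩
    · rw [Matrix.isUnit_iff_isUnit_det, Matrix.det_fin_two_of]
      simpa using hlam
    · rw [transE_zero hz hξ hx]
      ext i j
      fin_cases i <;> fin_cases j <;> simp [Matrix.mul_apply, Fin.sum_univ_two, mul_comm]
    · rw [higgs_eq, h α x hx]
      ext i j
      fin_cases i <;> fin_cases j <;> simp [Matrix.mul_apply, Fin.sum_univ_two]

end Gauge

section Stability

variable {C : Type*} [TopologicalSpace C] [ChartedSpace ℂ C] [IsManifold 𝓘(ℂ, ℂ) ω C] {ι : Type*}
variable {z : ι → OpenPartialHomeomorph C ℂ} {ξ : ι → ι → C → ℂ} {q : ι → C → ℂ}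
variable (hz : IsCoordinateSystem z) (hξ : IsThetaCharacteristic z ξ)
include hz hξ

/-- The degree formula for a meromorphic connection with integral residues `e` in `K^{k/2}`, compared
with a holomorphic `1`-form with divisor `m`. -/
theorem finsum_residues_logForm [T2Space C] [CompactSpace C] {a : C → ι}
    (ha : ∀ x, x ∈ (z (a x)).source) {η : ι → C → ℂ} {m : C → ℕ} (hη : IsOneForm z η)
    (hne : ∀ α, ∀ x ∈ (z α).source, ∀ᶠ y in 𝓝[≠] x, η α y ≠ 0)
    (hpole : ∀ x, ∃ h : ℂ → ℂ, AnalyticAt ℂ h (z (a x) x) ∧ ∀ᶠ w in 𝓝[≠] (z (a x) x),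
        dlog (z (a x)) (η (a x)) ((z (a x)).symm w) = m x / (w - z (a x) x) + h w)
    (k : ℤ) (ψ : ι → C → ℂ)
    (hψ : ∀ α β, ∀ x ∈ (z α).source ∩ (z β).source, ∀ᶠ y in 𝓝[≠] x,
      ψ α y = canonicalCocycle z α β y * (ψ β y + k * dlogTheta z ξ α β y)) (e : C → ℤ)
    (hres : ∀ x, ∃ h : ℂ → ℂ, AnalyticAt ℂ h (z (a x) x) ∧ ∀ᶠ w in 𝓝[≠] (z (a x) x),
        ψ (a x) ((z (a x)).symm w) = e x / (w - z (a x) x) + h w) :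
    (Function.support fun x => 2 * e x - k * m x).Finite ∧ ∑ᶠ x, (2 * e x - k * m x) = 0 := by
  have h4 := finsum_residues_eq_zero hz
    (fun α x => 2 * ψ α x - k * dlog (z α) (η α) x) ?_ (fun x => ((2 * e x - k * m x : ℤ) : ℂ)) ?_
  · obtain ⟨hfin, hsum⟩ := h4
    have h5 : (Function.support fun x => ((2 * e x - k * m x : ℤ) : ℂ))
        = Function.support fun x => 2 * e x - k * m x := by
      ext x
      simp only [Function.mem_support, ne_eq, Int.cast_eq_zero]
    rw [h5] at hfin
    refine ⟨hfin, ?_⟩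
    rw [finsum_eq_sum_of_support_subset (s := hfin.toFinset) _ (by rw [h5]; simp),
      ← Int.cast_sum, Int.cast_eq_zero] at hsum
    rw [finsum_eq_sum_of_support_subset (s := hfin.toFinset) _ (by simp), hsum]
  · intro α β x hx
    have h6 : ∀ᶠ y in 𝓝 x, y ∈ (z α).source ∩ (z β).source :=
      ((z α).open_source.inter (z β).open_source).mem_nhds hx
    filter_upwards [h6.filter_mono nhdsWithin_le_nhds, hne β x hx.2, hψ α β x hx] with y hy hy0 hψy
    have h7 := dlog_transition hz hξ hy (f := η α) (g := η β) (k := 2)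
      (by
        filter_upwards [((z α).open_source.inter (z β).open_source).mem_nhds hy] with u hu
        rw [hη.transition α β u hu, ← hξ.sq α β u hu]
        norm_cast)
      ((hη.holomorphic β).mdifferentiableAt (z β).open_source hy.2) hy0
    rw [h7, hψy]
    push_cast
    ring
  · intro x
    obtain ⟨h, hh, hev⟩ := hpole x
    obtain ⟨h', hh', hev'⟩ := hres x
    refine ⟨a x, ha x, fun w => 2 * h' w - k * h w,
      (analyticAt_const.mul hh').sub (analyticAt_const.mul hh), ?_⟩
    filter_upwards [hev, hev'] with w hw hw'
    rw [hw, hw']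
    push_cast
    ring

omit hξ in
/-- A function meromorphic near each point has integral order zero off a finite set. -/
theorem finite_support_order [CompactSpace C] {n : Type*} [Fintype n] {s : ι → C → n → ℂ}
    {d : C → ℤ} (hmer : ∀ α, ∀ x ∈ (z α).source, MeromorphicAt (s α ∘ (z α).symm) (z α x))
    (hd : ∀ α, ∀ x ∈ (z α).source,
      meromorphicOrderAt (s α ∘ (z α).symm) (z α x) = (d x : WithTop ℤ)) :
    (Function.support d).Finite := by
  have hiso : ∀ x, ∀ᶠ y in 𝓝[≠] x, d y = 0 := by
    intro x
    obtain ⟨α, hα⟩ := hz.covers x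
    obtain ⟨g, hg, hg0, hev⟩ := (meromorphicOrderAt_eq_int_iff (hmer α x hα)).1 (hd α x hα)
    rw [eventually_nhdsNE_coord hα]
    filter_upwards [eventually_nhdsNE_eventually_nhds hev, self_mem_nhdsWithin,
      mem_nhdsWithin_of_mem_nhds ((z α).open_target.mem_nhds ((z α).map_source hα)),
      hg.eventually_analyticAt.filter_mono nhdsWithin_le_nhds,
      (hg.continuousAt.eventually_ne hg0).filter_mono nhdsWithin_le_nhds] with w hw hwp hwt hgw hgw0
    have h1 := hd α _ ((z α).map_target hwt)
    have h2 : w - z α x ≠ 0 := sub_ne_zero.2 hwp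
    have h3 : AnalyticAt ℂ (fun v => (v - z α x) ^ d x • g v) w :=
      (((analyticAt_id.sub analyticAt_const).zpow h2)).smul hgw
    rw [(z α).right_inv hwt] at h1
    have h4 : AnalyticAt ℂ (s α ∘ (z α).symm) w := h3.congr (hw.mono fun v hv => hv.symm)
    have h5 : (s α ∘ (z α).symm) w ≠ 0 := by
      rw [hw.self_of_nhds]
      exact smul_ne_zero (zpow_ne_zero _ h2) hgw0
    rw [h4.meromorphicOrderAt_eq, h4.analyticOrderAt_eq_zero.2 h5] at h1
    exact WithTop.coe_injective h1.symm
  obtain ⟨t, -, ht⟩ := isCompact_univ.elim_nhds_subcover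
    (fun x => {y | y ∈ ({x}ᶜ : Set C) → d y = 0})
    fun x _ => eventually_nhdsWithin_iff.1 (hiso x)
  refine t.finite_toSet.subset fun y hy => ?_
  obtain ⟨x, hx, hyx⟩ := mem_iUnion₂.1 (ht (mem_univ y))
  by_contra hyt
  exact hy (hyx fun h => hyt (mem_singleton_iff.1 h ▸ hx))

omit hz hξ [TopologicalSpace C] [ChartedSpace ℂ C] [IsManifold 𝓘(ℂ, ℂ) ω C] in
/-- A line invariant under `φ(q)` does not consist of vectors with second component zero. -/
theorem snd_ne_zero_of_invariant {c : ℂ} (hc : c ≠ 0) {α : ι} {x : C}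
    {t v : Fin 2 → ℂ} (hv : v ∈ Submodule.span ℂ {t}) (hv0 : v ≠ 0)
    (hφ : (-(c • higgs q α x)) *ᵥ v ∈ Submodule.span ℂ {t}) : v 1 ≠ 0 := by
  intro h1
  obtain ⟨a, rfl⟩ := Submodule.mem_span_singleton.1 hv
  obtain ⟨b, hb⟩ := Submodule.mem_span_singleton.1 hφ
  have ha : a ≠ 0 := fun h => hv0 (by simp [h])
  have ht1 : t 1 = 0 := by simpa [ha] using h1
  have h2 := congrFun hb 1
  have ht0 : t 0 = 0 := by simpa [Matrix.neg_mulVec, higgs_eq, ht1, ha, hc, Matrix.vecHead] using h2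
  exact hv0 (by ext i; fin_cases i <;> simp [ht0, ht1])

/-- The Higgs bundles `(E_0, c φ(q))`, `c ≠ 0`, are stable. -/
theorem isStableHiggs_higgs [T2Space C] [CompactSpace C] [ConnectedSpace C] (hC : 2 ≤ genus C)
    (hp : IsProjective z) (hq : IsQuadraticDifferential z q) {c : ℂ} (hc : c ≠ 0) :
    IsStableHiggs z (transE z ξ 0) (fun α x => -(c • higgs q α x)) where
  slPair := by simpa using isSLPair_higgs hz hξ hp hq 0 c
  stable L hL hinv N := by
    rintro ⟨s, d, hmer, htr, hsL, hd, rfl⟩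
    choose a ha using hz.covers
    obtain ⟨η, m, hη, hne, hpole, x₁, hx₁⟩ := exists_oneForm_with_divisor hC hz ha
    set b : ι → C → ℂ := fun α y => s α y 1 with hb
    have hs0 : ∀ α, ∀ x ∈ (z α).source, ∀ᶠ y in 𝓝[≠] x, s α y ≠ 0 := by
      intro α x hx
      rw [eventually_nhdsNE_coord hx]
      refine (meromorphicOrderAt_ne_top_iff_eventually_ne_zero (hmer α x hx)).1 ?_
      rw [hd α x hx]
      exact WithTop.coe_ne_top
    have hb0 : ∀ α, ∀ x ∈ (z α).source, ∀ᶠ y in 𝓝[≠] x, b α y ≠ 0 := by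
      intro α x hx
      filter_upwards [hs0 α x hx, hsL α x hx,
        mem_nhdsWithin_of_mem_nhds ((z α).open_source.mem_nhds hx)] with y hy hyL hyα
      obtain ⟨V, -, -, hyV, t, -, ht⟩ := hL.frame α y hyα
      have h1 := hinv α y hyα _ hyL
      rw [(ht y hyV).2] at hyL h1
      exact snd_ne_zero_of_invariant hc hyL hy h1
    have hbmer : ∀ α, ∀ x ∈ (z α).source, ∃ e : ℤ, d x ≤ e ∧
        MeromorphicAt (b α ∘ (z α).symm) (z α x) ∧
        meromorphicOrderAt (b α ∘ (z α).symm) (z α x) = e := by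
      intro α x hx
      obtain ⟨g, hg, hg0, hev⟩ := (meromorphicOrderAt_eq_int_iff (hmer α x hx)).1 (hd α x hx)
      have hg1 : AnalyticAt ℂ (fun w => g w 1) (z α x) :=
        analyticAt_pi_iff.1 hg 1
      have hev1 : (b α ∘ (z α).symm) =ᶠ[𝓝[≠] (z α x)] fun w => (w - z α x) ^ d x * g w 1 := by
        filter_upwards [hev] with w hw
        have := congrFun hw 1
        simpa using this
      have hzp : MeromorphicAt (fun w : ℂ => (w - z α x) ^ d x) (z α x) :=
        ((MeromorphicAt.id _).sub (MeromorphicAt.const _ _)).zpow _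
      have hm : MeromorphicAt (b α ∘ (z α).symm) (z α x) :=
        (hzp.mul hg1.meromorphicAt).congr hev1.symm
      have hfin : meromorphicOrderAt (b α ∘ (z α).symm) (z α x) ≠ ⊤ :=
        (meromorphicOrderAt_ne_top_iff_eventually_ne_zero hm).2
          ((eventually_nhdsNE_coord hx).1 (hb0 α x hx))
      obtain ⟨e, he⟩ := WithTop.ne_top_iff_exists.1 hfin
      refine ⟨e, ?_, hm, he.symm⟩
      have h1 : meromorphicOrderAt (fun w : ℂ => (w - z α x) ^ d x) (z α x) = d x :=
        (meromorphicOrderAt_eq_int_iff hzp).2 ⟨fun _ => 1, analyticAt_const, one_ne_zero, by simp⟩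
      have h2 := meromorphicOrderAt_congr hev1
      have h3 := meromorphicOrderAt_mul hzp hg1.meromorphicAt
      have h4 : (d x : WithTop ℤ) ≤ e := by
        rw [he, h2]
        refine le_trans ?_ h3.ge
        rw [h1]
        exact le_add_of_nonneg_right hg1.meromorphicOrderAt_nonneg
      exact_mod_cast h4
    have hbmer' := fun x => hbmer (a x) x (ha x)
    choose e hde hem heo using hbmer'
    have hψ : ∀ α β, ∀ x ∈ (z α).source ∩ (z β).source, ∀ᶠ y in 𝓝[≠] x,
        dlog (z α) (b α) y = canonicalCocycle z α β y *
          (dlog (z β) (b β) y + (-1 : ℤ) * dlogTheta z ξ α β y) := by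
      intro α β x hx
      have ho := (z α).open_source.inter (z β).open_source
      have h1 : ∀ᶠ y in 𝓝[≠] x, b α y = ξ α β y ^ (-1 : ℤ) * b β y := by
        filter_upwards [htr α β x hx, mem_nhdsWithin_of_mem_nhds (ho.mem_nhds hx)] with y hy hyo
        simp [hb, hy, transE_zero hz hξ hyo, Matrix.mulVec, dotProduct, Fin.sum_univ_two]
      obtain ⟨-, -, hm, -⟩ := hbmer β x hx.2
      have h2 : ∀ᶠ y in 𝓝[≠] x, MDifferentiableAt 𝓘(ℂ, ℂ) 𝓘(ℂ, ℂ) (b β) y := by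
        rw [eventually_nhdsNE_coord hx.2]
        filter_upwards [hm.eventually_analyticAt, mem_nhdsWithin_of_mem_nhds
          ((z β).open_target.mem_nhds ((z β).map_source hx.2))] with w hw hwt
        rw [mdifferentiableAt_iff_coord (hz.holomorphic β) ((z β).map_target hwt),
          (z β).right_inv hwt]
        exact hw.differentiableAt
      filter_upwards [eventually_nhdsNE_eventually_nhds h1, h2, hb0 β x hx.2,
        mem_nhdsWithin_of_mem_nhds (ho.mem_nhds hx)] with y hy1 hy2 hy3 hyo
      exact dlog_transition hz hξ hyo hy1 hy2 hy3
    obtain ⟨hfin, hsum⟩ := finsum_residues_logForm hz hξ ha hη hne hpole (-1)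
      (fun α => dlog (z α) (b α)) hψ e fun x => dlog_simplePole (ha x) (hem x) (heo x)
    have hdfin := finite_support_order hz hmer hd
    classical
    set S : Finset C := hfin.toFinset ∪ hdfin.toFinset ∪ {x₁}
    rw [finsum_eq_sum_of_support_subset (s := S) _
      (fun x hx => by simp only [S, Finset.coe_union]; left; left; simpa using hx)] at hsum
    rw [finsum_eq_sum_of_support_subset (s := S) d
      (fun x hx => by simp only [S, Finset.coe_union]; left; right; simpa using hx)]
    have h1 : ∑ x ∈ S, 2 * d x < ∑ x ∈ S, (2 * e x - (-1) * m x) := by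
      refine Finset.sum_lt_sum (fun x _ => ?_) ⟨x₁, by simp [S], ?_⟩
      · have := hde x
        omega
      · have := hde x₁
        omega
    rw [hsum, ← Finset.mul_sum] at h1
    omega

end Stability

section AlgebraicGroups

open MvPolynomial

/-- Polynomial functions on the space of `2 × 2` matrices. -/
abbrev MatPoly := MvPolynomial (Fin 2 × Fin 2) ℂ

/-- The value of a polynomial function at a matrix. -/
noncomputable abbrev matEval (M : Matrix (Fin 2) (Fin 2) ℂ) : MatPoly →+* ℂ :=
  eval fun k : Fin 2 × Fin 2 => M k.1 k.2

/-- The polynomial function `M ↦ P (g M g')`. -/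
noncomputable def matTranslate (g g' : Matrix (Fin 2) (Fin 2) ℂ) (P : MatPoly) : MatPoly :=
  aeval (fun k : Fin 2 × Fin 2 => ∑ i, ∑ j, C (g k.1 i) * X (i, j) * C (g' j k.2)) P

theorem matEval_matTranslate (g g' M : Matrix (Fin 2) (Fin 2) ℂ) (P : MatPoly) :
    matEval M (matTranslate g g' P) = matEval (g * M * g') P := by
  rw [matTranslate, aeval_def, MvPolynomial.eval_eval₂, eval₂_eq', MvPolynomial.eval_eq']
  refine Finset.sum_congr rfl fun d _ => ?_
  congr 1
  · simp
  · refine Finset.prod_congr rfl fun k _ => ?_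
    congr 1
    simp [Matrix.mul_apply, Fin.sum_univ_two]
    ring

/-- The left-invariant vector field on the matrix algebra with value `X` at `1`. -/
noncomputable def matDer (Y : Matrix (Fin 2) (Fin 2) ℂ) (P : MatPoly) : MatPoly :=
  ∑ k : Fin 2 × Fin 2, (∑ l, X (k.1, l) * C (Y l k.2)) * pderiv k P

theorem matEval_matDer (M Y : Matrix (Fin 2) (Fin 2) ℂ) (P : MatPoly) :
    matEval M (matDer Y P) = ∑ k : Fin 2 × Fin 2, (M * Y) k.1 k.2 * matEval M (pderiv k P) := by
  simp [matDer, Matrix.mul_apply]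

theorem hasDerivAt_matEval (M N : Matrix (Fin 2) (Fin 2) ℂ) (P : MatPoly) (t : ℂ) :
    HasDerivAt (fun t : ℂ => matEval (M + t • N) P)
      (∑ k : Fin 2 × Fin 2, N k.1 k.2 * matEval (M + t • N) (pderiv k P)) t := by
  induction P using MvPolynomial.induction_on with
  | C a => simpa using hasDerivAt_const t a
  | add p q hp hq => simpa [mul_add, Finset.sum_add_distrib] using hp.fun_add hq
  | mul_X p j hp =>
    have h1 : HasDerivAt (fun t : ℂ => M j.1 j.2 + t * N j.1 j.2) (N j.1 j.2) t := by
      simpa using ((hasDerivAt_id t).mul_const (N j.1 j.2)).const_add (M j.1 j.2)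
    have h2 := hp.fun_mul h1
    have h3 : ∑ k : Fin 2 × Fin 2, N k.1 k.2 * matEval (M + t • N) (pderiv k (p * X j))
        = (∑ k : Fin 2 × Fin 2, N k.1 k.2 * matEval (M + t • N) (pderiv k p))
            * (M j.1 j.2 + t * N j.1 j.2) + matEval (M + t • N) p * N j.1 j.2 := by
      have h4 : ∀ k : Fin 2 × Fin 2, N k.1 k.2 * matEval (M + t • N) (pderiv k (p * X j))
          = N k.1 k.2 * matEval (M + t • N) (pderiv k p) * (M j.1 j.2 + t * N j.1 j.2)
            + (if k = j then matEval (M + t • N) p * N j.1 j.2 else 0) := by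
        intro k
        rw [pderiv_mul, pderiv_X]
        by_cases hk : k = j
        · subst hk
          simp
          ring
        · simp [hk, Ne.symm hk]
          ring
      rw [Finset.sum_congr rfl fun k _ => h4 k, Finset.sum_add_distrib, Finset.sum_mul]
      simp
    rw [h3]
    simpa using h2

theorem hasDerivAt_matDer (M Y : Matrix (Fin 2) (Fin 2) ℂ) (P : MatPoly) :
    HasDerivAt (fun t : ℂ => matEval (M + t • (M * Y)) P) (matEval M (matDer Y P)) 0 := by
  have h := hasDerivAt_matEval M (M * Y) P 0
  rw [zero_smul, add_zero] at h
  rwa [matEval_matDer]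

theorem matEval_matDer_matTranslate (g g' M Y : Matrix (Fin 2) (Fin 2) ℂ) (P : MatPoly)
    {Y' : Matrix (Fin 2) (Fin 2) ℂ} (h : Y * g' = g' * Y') :
    matEval M (matDer Y (matTranslate g g' P)) = matEval (g * M * g') (matDer Y' P) := by
  refine (hasDerivAt_matDer M Y _).unique ?_
  have h1 : (fun t : ℂ => matEval (M + t • (M * Y)) (matTranslate g g' P))
      = fun t : ℂ => matEval (g * M * g' + t • (g * M * g' * Y')) P := by
    ext t
    rw [matEval_matTranslate, mul_add, add_mul, mul_smul_comm, smul_mul_assoc]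
    simp only [Matrix.mul_assoc, h]
  rw [h1]
  exact hasDerivAt_matDer (g * M * g') Y' P

/-- Taylor expansion to first order at the identity matrix. -/
theorem exists_hadamard (P : MatPoly) : ∃ Q : Fin 2 × Fin 2 → MatPoly,
    P = C (matEval 1 P) + ∑ k, (X k - C ((1 : Matrix (Fin 2) (Fin 2) ℂ) k.1 k.2)) * Q k := by
  induction P using MvPolynomial.induction_on with
  | C a => exact ⟨0, by simp⟩
  | add p q hp hq =>
    obtain ⟨Q, hQ⟩ := hp
    obtain ⟨Q', hQ'⟩ := hq
    refine ⟨Q + Q', ?_⟩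
    conv_lhs => rw [hQ, hQ']
    simp only [map_add, Pi.add_apply, mul_add, Finset.sum_add_distrib]
    ring
  | mul_X p j hp =>
    obtain ⟨Q, hQ⟩ := hp
    refine ⟨fun k => (if k = j then p else 0)
      + C ((1 : Matrix (Fin 2) (Fin 2) ℂ) j.1 j.2) * Q k, ?_⟩
    have h1 : ∑ k, (X k - C ((1 : Matrix (Fin 2) (Fin 2) ℂ) k.1 k.2)) * ((if k = j then p else 0)
        + C ((1 : Matrix (Fin 2) (Fin 2) ℂ) j.1 j.2) * Q k)
        = (X j - C ((1 : Matrix (Fin 2) (Fin 2) ℂ) j.1 j.2)) * p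
          + C ((1 : Matrix (Fin 2) (Fin 2) ℂ) j.1 j.2)
            * ∑ k, (X k - C ((1 : Matrix (Fin 2) (Fin 2) ℂ) k.1 k.2)) * Q k := by
      simp only [mul_add, Finset.sum_add_distrib, mul_ite, mul_zero, Finset.sum_ite_eq',
        Finset.mem_univ, if_true, Finset.mul_sum]
      congr 1
      exact Finset.sum_congr rfl fun k _ => by ring
    rw [h1]
    have h2 : ∑ k, (X k - C ((1 : Matrix (Fin 2) (Fin 2) ℂ) k.1 k.2)) * Q k
        = p - C (matEval 1 p) := by
      rw [eq_sub_iff_add_eq', ← hQ]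
    rw [h2, map_mul, eval_X, map_mul]
    ring

theorem matEval_pderiv_of_hadamard {P : MatPoly} {c : ℂ} {Q : Fin 2 × Fin 2 → MatPoly}
    (h : P = C c + ∑ k, (X k - C ((1 : Matrix (Fin 2) (Fin 2) ℂ) k.1 k.2)) * Q k)
    (j : Fin 2 × Fin 2) : matEval 1 (pderiv j P) = matEval 1 (Q j) := by
  rw [h, map_add, pderiv_C, zero_add, map_sum, map_sum, Finset.sum_eq_single j]
  · simp
  · intro k _ hk
    simp [pderiv_X, hk]
  · simp

/-- The ideal of polynomial functions vanishing on a set of matrices. -/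
def matIdeal (H : Set (Matrix (Fin 2) (Fin 2) ℂ)) : Ideal MatPoly where
  carrier := {P | ∀ h ∈ H, matEval h P = 0}
  add_mem' ha hb h hh := by rw [map_add, ha h hh, hb h hh, add_zero]
  zero_mem' h _ := map_zero _
  smul_mem' c P hP h hh := by rw [smul_eq_mul, map_mul, hP h hh, mul_zero]

/-- The Lie algebra of the Zariski closure of a group of matrices. -/
def matLie (H : Set (Matrix (Fin 2) (Fin 2) ℂ)) : Submodule ℂ (Matrix (Fin 2) (Fin 2) ℂ) where
  carrier := {Y | ∀ P ∈ matIdeal H, matDer Y P ∈ matIdeal H}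
  add_mem' {Y Y'} hY hY' P hP h hh := by
    have h1 := hY P hP h hh
    have h2 := hY' P hP h hh
    rw [matEval_matDer] at h1 h2 ⊢
    simp only [mul_add, Matrix.add_apply, add_mul, Finset.sum_add_distrib, h1, h2, add_zero]
  zero_mem' P _ h _ := by simp [matEval_matDer]
  smul_mem' c Y hY P hP h hh := by
    have h1 := hY P hP h hh
    rw [matEval_matDer] at h1 ⊢
    simp only [mul_smul_comm, Matrix.smul_apply, smul_eq_mul, mul_assoc, ← Finset.mul_sum, h1,
      mul_zero]

/-- A set of matrices of determinant `1` closed under products and inverses. -/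
structure IsSLGroup (H : Set (Matrix (Fin 2) (Fin 2) ℂ)) : Prop where
  det : ∀ h ∈ H, h.det = 1
  one : 1 ∈ H
  mul : ∀ g ∈ H, ∀ h ∈ H, g * h ∈ H
  inv : ∀ h ∈ H, h⁻¹ ∈ H

variable {H : Set (Matrix (Fin 2) (Fin 2) ℂ)}

theorem IsSLGroup.isUnit_det (hH : IsSLGroup H) {h : Matrix (Fin 2) (Fin 2) ℂ} (hh : h ∈ H) :
    IsUnit h.det := by
  rw [hH.det h hh]
  exact isUnit_one

theorem IsSLGroup.matTranslate_mem (hH : IsSLGroup H) {P : MatPoly} (hP : P ∈ matIdeal H)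
    {g g' : Matrix (Fin 2) (Fin 2) ℂ} (hg : g ∈ H) (hg' : g' ∈ H) :
    matTranslate g g' P ∈ matIdeal H := fun h hh => by
  rw [matEval_matTranslate]
  exact hP _ (hH.mul _ (hH.mul _ hg _ hh) _ hg')

theorem IsSLGroup.mem_matLie_iff (hH : IsSLGroup H) {Y : Matrix (Fin 2) (Fin 2) ℂ} :
    Y ∈ matLie H ↔ ∀ P ∈ matIdeal H, matEval 1 (matDer Y P) = 0 := by
  refine ⟨fun h P hP => h P hP 1 hH.one, fun h P hP g hg => ?_⟩
  have h1 := h _ (hH.matTranslate_mem hP hg hH.one)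
  rw [matEval_matDer_matTranslate g 1 1 Y P (Y' := Y) (by simp)] at h1
  simpa using h1

theorem IsSLGroup.conj_mem_matLie (hH : IsSLGroup H) {Y h : Matrix (Fin 2) (Fin 2) ℂ}
    (hY : Y ∈ matLie H) (hh : h ∈ H) : h * Y * h⁻¹ ∈ matLie H := by
  rw [hH.mem_matLie_iff]
  intro P hP
  have hu := hH.isUnit_det hh
  have h1 := hY _ (hH.matTranslate_mem hP hh (hH.inv h hh)) 1 hH.one
  rw [matEval_matDer_matTranslate h h⁻¹ 1 Y P (Y' := h * Y * h⁻¹)] at h1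
  · simpa [Matrix.mul_nonsing_inv _ hu] using h1
  · rw [Matrix.mul_assoc h, ← Matrix.mul_assoc h⁻¹, Matrix.nonsing_inv_mul _ hu, Matrix.one_mul]

theorem IsSLGroup.trace_eq_zero (hH : IsSLGroup H) {Y : Matrix (Fin 2) (Fin 2) ℂ}
    (hY : Y ∈ matLie H) : Y 1 1 = -Y 0 0 := by
  have h1 := hH.mem_matLie_iff.1 hY (X (0, 0) * X (1, 1) - X (0, 1) * X (1, 0) - 1) fun h hh => by
    have := hH.det h hh
    rw [Matrix.det_fin_two] at this
    simp [this]
  simp [matEval_matDer, Fintype.sum_prod_type, Fin.sum_univ_two, pderiv_X,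
    Pi.single_apply] at h1
  linear_combination h1

/-- Polynomials vanishing on the group are preserved by translation by the unipotents `1 + t Y`,
for nilpotent `Y` in the Lie algebra. -/
theorem matTranslate_unipotent_mem {Y : Matrix (Fin 2) (Fin 2) ℂ} (hY : Y ∈ matLie H)
    (hY2 : Y * Y = 0) {P : MatPoly} (hP : P ∈ matIdeal H) (t : ℂ) :
    matTranslate 1 (1 + t • Y) P ∈ matIdeal H := by
  intro h hh
  rw [matEval_matTranslate, Matrix.one_mul, Matrix.mul_add, Matrix.mul_one, Matrix.mul_smul]
  have h1 : ∀ P : MatPoly, deriv (fun t : ℂ => matEval (h + t • (h * Y)) P)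
      = fun t : ℂ => matEval (h + t • (h * Y)) (matDer Y P) := by
    intro P
    ext t
    rw [(hasDerivAt_matEval h (h * Y) P t).deriv, matEval_matDer, Matrix.add_mul, Matrix.smul_mul,
      Matrix.mul_assoc h, hY2, Matrix.mul_zero, smul_zero, add_zero]
  have h2 : ∀ (n : ℕ) (P : MatPoly), P ∈ matIdeal H →
      iteratedDeriv n (fun t : ℂ => matEval (h + t • (h * Y)) P) 0 = 0 := by
    intro n
    induction n with
    | zero =>
      intro P hP
      simpa using hP h hh
    | succ n ih =>
      intro P hP
      rw [iteratedDeriv_succ', h1]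
      exact ih _ (hY P hP)
  have h3 := Complex.taylorSeries_eq_of_entire' (f := fun t : ℂ => matEval (h + t • (h * Y)) P)
    0 t fun t => (hasDerivAt_matEval h (h * Y) P t).differentiableAt
  rw [← h3]
  simp [h2 _ P hP]

end AlgebraicGroups

section SemiInvariants

open MvPolynomial

variable {H : Set (Matrix (Fin 2) (Fin 2) ℂ)}

/-- A group whose Zariski closure has all of `sl₂` as Lie algebra is Zariski dense. -/
theorem IsSLGroup.isZariskiDense_of_matLie (hH : IsSLGroup H) (hp : Xplus ∈ matLie H)
    (hm : Xminus ∈ matLie H) : IsZariskiDenseInSL H := by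
  refine ⟨fun M hM => hH.det M hM, fun P hP M hM => ?_⟩
  have hpp : Xplus * Xplus = 0 := by
    ext i j; fin_cases i <;> fin_cases j <;> simp [Xplus, Matrix.mul_apply]
  have hmm : Xminus * Xminus = 0 := by
    ext i j; fin_cases i <;> fin_cases j <;> simp [Xminus, Matrix.mul_apply]
  have key : ∀ a b c : ℂ, ∀ P ∈ matIdeal H,
      matTranslate 1 ((1 + a • Xplus) * (1 + b • Xminus) * (1 + c • Xplus)) P ∈ matIdeal H := by
    intro a b c P hP h hh
    have h1 := matTranslate_unipotent_mem hp hpp (matTranslate_unipotent_mem hm hmm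
      (matTranslate_unipotent_mem hp hpp hP c) b) a h hh
    simpa only [matEval_matTranslate, Matrix.one_mul, Matrix.mul_assoc] using h1
  have hform : ∀ a b c : ℂ, (1 + a • Xplus) * (1 + b • Xminus) * (1 + c • Xplus)
      = !![1 + a * b, (1 + a * b) * c + a; b, b * c + 1] := by
    intro a b c
    ext i j
    fin_cases i <;> fin_cases j <;> simp [Xplus, Xminus, Matrix.mul_apply, Fin.sum_univ_two]
  have hgen : ∀ N : Matrix (Fin 2) (Fin 2) ℂ, N.det = 1 → N 1 0 ≠ 0 → ∀ P ∈ matIdeal H,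
      matTranslate 1 N P ∈ matIdeal H := by
    intro N hN hN0 P hP
    have h1 : N = (1 + ((N 0 0 - 1) / N 1 0) • Xplus) * (1 + (N 1 0) • Xminus)
        * (1 + ((N 1 1 - 1) / N 1 0) • Xplus) := by
      rw [Matrix.det_fin_two] at hN
      rw [hform]
      ext i j
      fin_cases i <;> fin_cases j <;> simp <;> field_simp <;>
        first | ring1 | linear_combination -hN
    rw [h1]
    exact key _ _ _ P hP
  have hM2 : matTranslate 1 M P ∈ matIdeal H := by
    by_cases h0 : M 1 0 = 0
    · have hdet : (M * !![(1 : ℂ), 0; 1, 1]).det = 1 := by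
        rw [Matrix.det_mul, hM, Matrix.det_fin_two_of]; norm_num
      have h1 : (M * !![(1 : ℂ), 0; 1, 1]) 1 0 ≠ 0 := by
        rw [Matrix.det_fin_two, h0] at hM
        simp only [Matrix.mul_apply, Fin.sum_univ_two, h0]
        intro h
        simp at h
        simp [h] at hM
      have h2 : !![(1 : ℂ), 0; -1, 1] = 1 + (-1 : ℂ) • Xminus := by
        ext i j; fin_cases i <;> fin_cases j <;> simp [Xminus]
      have h3 := hgen _ hdet h1 _ (matTranslate_unipotent_mem hm hmm hP (-1))
      intro h hh
      have h4 := h3 h hh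
      rw [← h2, matEval_matTranslate, matEval_matTranslate] at h4
      have h5 : !![(1 : ℂ), 0; 1, 1] * !![(1 : ℂ), 0; -1, 1] = 1 := by
        ext i j; fin_cases i <;> fin_cases j <;> simp [Matrix.mul_apply, Fin.sum_univ_two]
      rw [matEval_matTranslate]
      simpa only [Matrix.one_mul, Matrix.mul_assoc, h5, Matrix.mul_one] using h4
    · exact hgen M hM h0 P hP
  have h3 := hM2 1 hH.one
  rw [matEval_matTranslate] at h3
  simpa using h3

/-- A group whose Zariski closure has Lie algebra zero has the identity as an isolated point. -/
theorem IsSLGroup.exists_delta (hH : IsSLGroup H) (h0 : matLie H = ⊥) :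
    ∃ r : MatPoly, matEval 1 r = 1 ∧ ∀ h ∈ H, h ≠ 1 → matEval h r = 0 := by
  set Φ : MatPoly →ₗ[ℂ] (Fin 2 × Fin 2 → ℂ) :=
    { toFun := fun P k => matEval 1 (pderiv k P)
      map_add' := fun P Q => by ext; simp
      map_smul' := fun c P => by ext; simp [smul_eval] } with hΦ
  set I : Submodule ℂ MatPoly := (matIdeal H).restrictScalars ℂ
  have htop : I.map Φ = ⊤ := by
    by_contra hne
    obtain ⟨f, hf0, hf⟩ := Submodule.exists_le_ker_of_lt_top _ (lt_top_iff_ne_top.2 hne)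
    refine hf0 ?_
    set Y : Matrix (Fin 2) (Fin 2) ℂ := Matrix.of fun i j => f (Pi.single (i, j) 1)
    have hfY : ∀ v, f v = ∑ k : Fin 2 × Fin 2, Y k.1 k.2 * v k := by
      intro v
      conv_lhs => rw [pi_eq_sum_univ' v]
      rw [map_sum]
      refine Finset.sum_congr rfl fun k _ => ?_
      rw [map_smul, smul_eq_mul, mul_comm]
      simp only [Y, Matrix.of_apply]
    have hY : Y ∈ matLie H := by
      rw [hH.mem_matLie_iff]
      intro P hP
      have h1 : f (Φ P) = 0 := hf ⟨P, hP, rfl⟩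
      rw [hfY] at h1
      rw [matEval_matDer]
      simpa [hΦ] using h1
    rw [h0, Submodule.mem_bot] at hY
    refine LinearMap.ext fun v => ?_
    rw [hfY, hY]
    simp
  have h1 : ∀ k : Fin 2 × Fin 2, ∃ P ∈ matIdeal H, Φ P = Pi.single k 1 := fun k => by
    have : (Pi.single k 1 : Fin 2 × Fin 2 → ℂ) ∈ I.map Φ := htop ▸ Submodule.mem_top
    obtain ⟨P, hP, h⟩ := this
    exact ⟨P, hP, h⟩
  choose P hP hPΦ using h1
  choose Q hQ using fun k => exists_hadamard (P k)
  set A : Matrix (Fin 2 × Fin 2) (Fin 2 × Fin 2) MatPoly := Matrix.of fun k j => Q k j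
  set x' : Fin 2 × Fin 2 → MatPoly :=
    fun k => X k - C ((1 : Matrix (Fin 2) (Fin 2) ℂ) k.1 k.2)
  have hAx : A *ᵥ x' = P := by
    ext1 k
    have h2 := hQ k
    rw [hP k 1 hH.one, C_0, zero_add] at h2
    rw [h2]
    simp only [Matrix.mulVec, dotProduct, A, Matrix.of_apply, x']
    exact Finset.sum_congr rfl fun j _ => mul_comm _ _
  have hA1 : (matEval 1).mapMatrix A = 1 := by
    ext k j
    have h2 := congrFun (hPΦ k) j
    simp only [hΦ, LinearMap.coe_mk, AddHom.coe_mk] at h2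
    rw [matEval_pderiv_of_hadamard (hQ k) j] at h2
    simp only [RingHom.mapMatrix_apply, Matrix.map_apply, A, Matrix.of_apply, h2]
    simp [Matrix.one_apply, Pi.single_apply, eq_comm]
  refine ⟨A.det, by rw [RingHom.map_det, hA1, Matrix.det_one], fun h hh hne => ?_⟩
  have h3 : ∀ k, A.det * x' k = (A.adjugate *ᵥ P) k := by
    intro k
    rw [← hAx, Matrix.mulVec_mulVec, Matrix.adjugate_mul, Matrix.smul_mulVec, Matrix.one_mulVec]
    rfl
  by_contra hr
  refine hne ?_
  ext i j
  have h4 := congrArg (matEval h) (h3 (i, j))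
  have h5 : matEval h ((A.adjugate *ᵥ P) (i, j)) = 0 := by
    simp only [Matrix.mulVec, dotProduct, map_sum, map_mul]
    exact Finset.sum_eq_zero fun l _ => by rw [hP l h hh, mul_zero]
  rw [h5, map_mul, mul_eq_zero, or_iff_right hr] at h4
  simpa [x', sub_eq_zero] using h4

/-- A group whose Zariski closure has Lie algebra zero is finite. -/
theorem IsSLGroup.finite_of_matLie_eq_bot (hH : IsSLGroup H) (h0 : matLie H = ⊥) : H.Finite := by
  obtain ⟨r, hr1, hr⟩ := hH.exists_delta h0
  set R : Set MatPoly := (fun h => matTranslate h⁻¹ 1 r) '' H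
  obtain ⟨T, hTR, hT⟩ := (Submodule.fg_span_iff_fg_span_finset_subset R).1
    (IsNoetherian.noetherian (Ideal.span R))
  have hTH : ∀ P ∈ T, ∃ h ∈ H, matTranslate h⁻¹ 1 r = P := fun P hP => hTR hP
  choose! k hk hkP using hTH
  refine ((T : Set MatPoly).toFinite.image k).subset fun g hg => ?_
  by_contra hgk
  have hval : ∀ h ∈ H, matEval g (matTranslate h⁻¹ 1 r) = if h = g then 1 else 0 := by
    intro h hh
    rw [matEval_matTranslate, Matrix.mul_one]
    split_ifs with hhg
    · rw [← hhg, Matrix.nonsing_inv_mul _ (hH.isUnit_det hh), hr1]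
    · refine hr _ (hH.mul _ (hH.inv h hh) _ hg) fun h1 => hhg ?_
      have := congrArg (h * ·) h1
      simpa [Matrix.mul_nonsing_inv_cancel_left _ _ (hH.isUnit_det hh)] using this.symm
  have h1 : matTranslate g⁻¹ 1 r ∈ RingHom.ker (matEval g) := by
    have h2 : matTranslate g⁻¹ 1 r ∈ Ideal.span R := Ideal.subset_span ⟨g, hg, rfl⟩
    have h3 : Ideal.span R ≤ RingHom.ker (matEval g) := by
      change Submodule.span _ R ≤ _
      rw [hT, Submodule.span_le]
      intro P hP
      rw [SetLike.mem_coe, RingHom.mem_ker, ← hkP P hP, hval _ (hk P hP), if_neg]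
      exact fun h => hgk ⟨P, hP, h⟩
    exact h3 h2
  rw [RingHom.mem_ker, hval g hg, if_pos rfl] at h1
  exact one_ne_zero h1

end SemiInvariants

section SemiInvariantForms

variable {H : Set (Matrix (Fin 2) (Fin 2) ℂ)}

/-- `F = ∏ l_i` is a binary form of positive degree which is semi-invariant under `H`. -/
def HasSemiInvariant (H : Set (Matrix (Fin 2) (Fin 2) ℂ)) : Prop :=
  ∃ (κ : Type) (_ : Fintype κ) (_ : Nonempty κ) (l : κ → Fin 2 → ℂ), (∀ i, l i ≠ 0) ∧
    ∀ h ∈ H, ∃ χ : ℂ, ∀ v, ∏ i, l i ⬝ᵥ (h *ᵥ v) = χ * ∏ i, l i ⬝ᵥ v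

theorem IsSLGroup.hasSemiInvariant_of_finite (hH : IsSLGroup H) (hf : H.Finite) :
    HasSemiInvariant H := by
  have : Fintype H := hf.fintype
  refine ⟨H, inferInstance, ⟨⟨1, hH.one⟩⟩, fun h => ![1, 0] ᵥ* h.1, fun h h0 => ?_,
    fun g hg => ⟨1, fun v => ?_⟩⟩
  · have h1 := congrArg (· ᵥ* h.1⁻¹) h0
    simp only [Matrix.vecMul_vecMul, Matrix.mul_nonsing_inv _ (hH.isUnit_det h.2),
      Matrix.vecMul_one, Matrix.zero_vecMul] at h1
    simpa using congrFun h1 0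
  · rw [one_mul]
    let e : H ≃ H :=
      { toFun := fun h => ⟨h.1 * g, hH.mul _ h.2 _ hg⟩
        invFun := fun h => ⟨h.1 * g⁻¹, hH.mul _ h.2 _ (hH.inv g hg)⟩
        left_inv := fun h => by
          ext1
          exact Matrix.mul_nonsing_inv_cancel_right _ _ (hH.isUnit_det hg)
        right_inv := fun h => by
          ext1
          exact Matrix.nonsing_inv_mul_cancel_right _ _ (hH.isUnit_det hg) }
    rw [← Equiv.prod_comp e fun h : H => (![1, 0] ᵥ* h.1) ⬝ᵥ v]
    refine Finset.prod_congr rfl fun h _ => ?_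
    simp only [e, Equiv.coe_fn_mk, ← Matrix.dotProduct_mulVec, Matrix.mulVec_mulVec]

/-- A nonzero binary quadratic form is a product of two nonzero linear forms. -/
theorem exists_linear_factors {a b c : ℂ} (h : ¬ (a = 0 ∧ b = 0 ∧ c = 0)) :
    ∃ l : Fin 2 → Fin 2 → ℂ, (∀ i, l i ≠ 0) ∧
      ∀ v : Fin 2 → ℂ, ∏ i, l i ⬝ᵥ v = a * v 0 ^ 2 + b * v 0 * v 1 + c * v 1 ^ 2 := by
  by_cases ha : a = 0
  · refine ⟨![![0, 1], ![b, c]], ?_, fun v => ?_⟩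
    · rw [Fin.forall_fin_two]
      refine ⟨fun h0 => by simpa using congrFun h0 1, fun h0 => h ⟨ha, ?_, ?_⟩⟩
      · simpa using congrFun h0 0
      · simpa using congrFun h0 1
    · simp [Fin.prod_univ_two, dotProduct, Fin.sum_univ_two, ha]
      ring
  · obtain ⟨δ, hδ⟩ := IsAlgClosed.exists_pow_nat_eq (b ^ 2 - 4 * a * c) (n := 2) two_pos
    refine ⟨![![a, (b - δ) / 2], ![1, (b + δ) / (2 * a)]], ?_, fun v => ?_⟩
    · rw [Fin.forall_fin_two]
      exact ⟨fun h0 => ha (by simpa using congrFun h0 0),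
        fun h0 => by simpa using congrFun h0 0⟩
    · simp [Fin.prod_univ_two, dotProduct, Fin.sum_univ_two]
      field_simp
      linear_combination -(v 1) ^ 2 * hδ

/-- A line in `sl₂` stable under conjugation by `H` gives a semi-invariant quadratic form. -/
theorem IsSLGroup.hasSemiInvariant_of_line (hH : IsSLGroup H) {Y : Matrix (Fin 2) (Fin 2) ℂ}
    (hY0 : Y ≠ 0) (htr : Y 1 1 = -Y 0 0) (hY : ∀ h ∈ H, ∃ χ : ℂ, h * Y * h⁻¹ = χ • Y) :
    HasSemiInvariant H := by
  obtain ⟨l, hl, hF⟩ := exists_linear_factors (a := Y 1 0) (b := -2 * Y 0 0) (c := -Y 0 1)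
    (by
      rintro ⟨h1, h2, h3⟩
      have h4 : Y 0 0 = 0 := by simpa using h2
      refine hY0 ?_
      ext i j
      fin_cases i <;> fin_cases j
      exacts [h4, by simpa using h3, h1, by simpa [h4] using htr])
  have hω : ∀ v : Fin 2 → ℂ, ∏ i, l i ⬝ᵥ v = v 0 * (Y *ᵥ v) 1 - v 1 * (Y *ᵥ v) 0 := by
    intro v
    rw [hF]
    simp only [Matrix.mulVec, dotProduct, Fin.sum_univ_two, htr]
    ring
  refine ⟨Fin 2, inferInstance, inferInstance, l, hl, fun h hh => ?_⟩
  have hu := hH.isUnit_det hh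
  obtain ⟨χ, hχ⟩ := hY _ (hH.inv h hh)
  rw [Matrix.nonsing_inv_nonsing_inv _ hu] at hχ
  refine ⟨χ, fun v => ?_⟩
  have h1 : Y *ᵥ (h *ᵥ v) = χ • h *ᵥ (Y *ᵥ v) := by
    have h2 := congrArg (h * ·) hχ
    simp only [Matrix.mul_assoc, Matrix.mul_nonsing_inv_cancel_left _ _ hu, Matrix.mul_smul] at h2
    rw [Matrix.mulVec_mulVec, h2, Matrix.smul_mulVec, Matrix.mulVec_mulVec]
  have hdet := hH.det h hh
  rw [Matrix.det_fin_two] at hdet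
  rw [hω, hω, h1]
  simp only [Matrix.mulVec, dotProduct, Fin.sum_univ_two, Pi.smul_apply, smul_eq_mul]
  linear_combination χ * (v 0 * (Y 1 0 * v 0 + Y 1 1 * v 1)
    - v 1 * (Y 0 0 * v 0 + Y 0 1 * v 1)) * hdet

/-- In `sl₂`, elements commuting with `Y ≠ 0` are multiples of `Y`. -/
theorem mem_span_of_commute {Y Z : Matrix (Fin 2) (Fin 2) ℂ} (hY0 : Y ≠ 0)
    (hY : Y 1 1 = -Y 0 0) (hZ : Z 1 1 = -Z 0 0) (h : Y * Z - Z * Y = 0) :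
    Z ∈ Submodule.span ℂ {Y} := by
  have h00 := congrFun (congrFun h 0) 0
  have h01 := congrFun (congrFun h 0) 1
  have h10 := congrFun (congrFun h 1) 0
  simp only [Matrix.sub_apply, Matrix.mul_apply, Fin.sum_univ_two, hY, hZ, Matrix.zero_apply]
    at h00 h01 h10
  rw [Submodule.mem_span_singleton]
  have hext : ∀ c : ℂ, c * Y 0 0 = Z 0 0 → c * Y 0 1 = Z 0 1 → c * Y 1 0 = Z 1 0 →
      ∃ a : ℂ, a • Y = Z := by
    intro c h1 h2 h3
    refine ⟨c, ?_⟩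
    ext i j
    fin_cases i <;> fin_cases j <;> simp [hY, hZ, h1, h2, h3]
  by_cases h1 : Y 0 0 = 0
  · by_cases h2 : Y 0 1 = 0
    · have h3 : Y 1 0 ≠ 0 := fun h3 => hY0 (by
        ext i j
        fin_cases i <;> fin_cases j <;> simp [h1, h2, h3, hY])
      refine hext (Z 1 0 / Y 1 0) ?_ ?_ ?_ <;> field_simp
      · linear_combination -h10 / 2
      · linear_combination h00
    · refine hext (Z 0 1 / Y 0 1) ?_ ?_ ?_ <;> field_simp
      · linear_combination h01 / 2
      · linear_combination -h00
  · refine hext (Z 0 0 / Y 0 0) ?_ ?_ ?_ <;> field_simp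
    · linear_combination -h01 / 2
    · linear_combination h10 / 2

theorem IsSLGroup.conj_commutator (hH : IsSLGroup H) {h : Matrix (Fin 2) (Fin 2) ℂ} (hh : h ∈ H)
    (Y Z : Matrix (Fin 2) (Fin 2) ℂ) : h * (Y * Z - Z * Y) * h⁻¹
      = (h * Y * h⁻¹) * (h * Z * h⁻¹) - (h * Z * h⁻¹) * (h * Y * h⁻¹) := by
  have hu := hH.isUnit_det hh
  have key : ∀ A B : Matrix (Fin 2) (Fin 2) ℂ, (h * A * h⁻¹) * (h * B * h⁻¹) = h * (A * B) * h⁻¹ := by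
    intro A B
    simp only [Matrix.mul_assoc, Matrix.nonsing_inv_mul_cancel_left _ _ hu]
  rw [key, key, Matrix.mul_sub, Matrix.sub_mul]

/-- A subgroup of `SL₂(ℂ)` that is not Zariski dense has a semi-invariant binary form. -/
theorem IsSLGroup.hasSemiInvariant (hH : IsSLGroup H) (hnd : ¬ IsZariskiDenseInSL H) :
    HasSemiInvariant H := by
  by_cases h0 : matLie H = ⊥
  · exact hH.hasSemiInvariant_of_finite (hH.finite_of_matLie_eq_bot h0)
  obtain ⟨Y, hY, hY0⟩ := Submodule.exists_mem_ne_zero_of_ne_bot h0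
  have htY := hH.trace_eq_zero hY
  by_cases h1 : matLie H ≤ Submodule.span ℂ {Y}
  · refine hH.hasSemiInvariant_of_line hY0 htY fun h hh => ?_
    obtain ⟨χ, hχ⟩ := Submodule.mem_span_singleton.1 (h1 (hH.conj_mem_matLie hY hh))
    exact ⟨χ, hχ.symm⟩
  obtain ⟨Z, hZ, hZY⟩ := SetLike.not_le_iff_exists.1 h1
  have htZ := hH.trace_eq_zero hZ
  by_cases h2 : matLie H ≤ Submodule.span ℂ {Y, Z}
  · refine hH.hasSemiInvariant_of_line (Y := Y * Z - Z * Y)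
      (fun h => hZY (mem_span_of_commute hY0 htY htZ h)) ?_ fun h hh => ?_
    · simp only [Matrix.sub_apply, Matrix.mul_apply, Fin.sum_univ_two]
      ring
    · obtain ⟨a, b, hab⟩ := Submodule.mem_span_pair.1 (h2 (hH.conj_mem_matLie hY hh))
      obtain ⟨c, d, hcd⟩ := Submodule.mem_span_pair.1 (h2 (hH.conj_mem_matLie hZ hh))
      refine ⟨a * d - b * c, ?_⟩
      rw [hH.conj_commutator hh, ← hab, ← hcd]
      simp only [Matrix.add_mul, Matrix.mul_add, Matrix.smul_mul, Matrix.mul_smul]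
      module
  obtain ⟨W, hW, hWYZ⟩ := SetLike.not_le_iff_exists.1 h2
  exfalso
  have hli : LinearIndependent ℂ ![W, Y, Z] := by
    refine linearIndependent_finCons (v := ![Y, Z]) |>.2 ?_
    refine ⟨?_, by simpa [Matrix.range_cons, Matrix.range_empty, pair_comm] using hWYZ⟩
    rw [LinearIndependent.pair_iff]
    intro s t hst
    have ht : t = 0 := by
      by_contra ht
      refine hZY (Submodule.mem_span_singleton.2 ⟨-s / t, ?_⟩)
      have : Z = (1 / t) • (t • Z) := by rw [smul_smul, one_div_mul_cancel ht, one_smul]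
      rw [this, eq_neg_of_add_eq_zero_right hst]
      module
    refine ⟨?_, ht⟩
    rw [ht, zero_smul, add_zero] at hst
    exact (smul_eq_zero.1 hst).resolve_right hY0
  have hmem : ∀ i, ![W, Y, Z] i ∈ matLie H := by
    intro i
    fin_cases i
    exacts [hW, hY, hZ]
  set J : Matrix (Fin 2) (Fin 2) ℂ →ₗ[ℂ] (Fin 3 → ℂ) :=
    { toFun := fun M => ![M 0 0, M 0 1, M 1 0]
      map_add' := fun M N => by ext i; fin_cases i <;> simp
      map_smul' := fun c M => by ext i; fin_cases i <;> simp } with hJ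
  have hker : ∀ M ∈ matLie H, J M = 0 → M = 0 := by
    intro M hM h
    have e0 := congrFun h 0
    have e1 := congrFun h 1
    have e2 := congrFun h 2
    simp [hJ] at e0 e1 e2
    have e3 := hH.trace_eq_zero hM
    ext i j
    fin_cases i <;> fin_cases j <;> simp [e0, e1, e2, e3]
  have hliJ : LinearIndependent ℂ (J ∘ ![W, Y, Z]) := by
    refine hli.map ?_
    rw [Submodule.disjoint_def]
    intro M hM hJM
    refine hker M ?_ hJM
    refine Submodule.span_le.2 ?_ hM
    rintro _ ⟨i, rfl⟩
    exact hmem i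
  have htop := hliJ.span_eq_top_of_card_eq_finrank (by simp)
  have hall : ∀ M : Matrix (Fin 2) (Fin 2) ℂ, M 1 1 = -M 0 0 → M ∈ matLie H := by
    intro M hM
    have h3 : J M ∈ (matLie H).map J := by
      have h4 : (⊤ : Submodule ℂ (Fin 3 → ℂ)) ≤ (matLie H).map J := by
        rw [← htop, Submodule.span_le]
        rintro _ ⟨i, rfl⟩
        exact ⟨_, hmem i, rfl⟩
      exact h4 Submodule.mem_top
    obtain ⟨N, hN, hNM⟩ := h3
    have e3 := hH.trace_eq_zero hN
    have e0 := congrFun hNM 0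
    have e1 := congrFun hNM 1
    have e2 := congrFun hNM 2
    simp [hJ] at e0 e1 e2
    have : M = N := by
      ext i j
      fin_cases i <;> fin_cases j <;> simp [e0, e1, e2, e3, hM]
    rwa [this]
  exact hnd (hH.isZariskiDense_of_matLie (hall _ (by simp [Xplus])) (hall _ (by simp [Xminus])))

end SemiInvariantForms

section LinearODE

variable {E : Type*} [NormedAddCommGroup E] [NormedSpace ℂ E] [CompleteSpace E]

/-- A holomorphic linear differential equation has solutions on a small disc. -/
theorem exists_linear_ode_solution {L : ℂ → E →L[ℂ] E} {w₀ : ℂ} {R M : ℝ} (hR : 0 < R)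
    (hRM : M * R ≤ 1 / 2) (hM : ∀ w ∈ Metric.ball w₀ R, ∀ v, ‖L w v‖ ≤ M * ‖v‖)
    (hL : ∀ y : ℂ → E, DifferentiableOn ℂ y (Metric.ball w₀ R) →
      DifferentiableOn ℂ (fun w => L w (y w)) (Metric.ball w₀ R)) (v : E) :
    ∃ y : ℂ → E, y w₀ = v ∧ ∀ w ∈ Metric.ball w₀ R, HasDerivAt y (L w (y w)) w := by
  set B := Metric.ball w₀ R
  have hw₀ : w₀ ∈ B := Metric.mem_ball_self hR
  have hM0 : ‖v‖ = 0 ∨ 0 ≤ M := by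
    by_cases h : ‖v‖ = 0
    · exact Or.inl h
    · right
      have h1 := (norm_nonneg _).trans (hM w₀ hw₀ v)
      exact nonneg_of_mul_nonneg_left h1 (lt_of_le_of_ne (norm_nonneg v) (Ne.symm h))
  rcases hM0 with hv | hM0
  · exact ⟨fun _ => 0, (norm_eq_zero.1 hv).symm, fun w _ => by simpa using hasDerivAt_const w (0 : E)⟩
  have hstep : ∀ y : {y : ℂ → E // DifferentiableOn ℂ y B}, ∃ y' : {y : ℂ → E // DifferentiableOn ℂ y B},
      y'.1 w₀ = 0 ∧ ∀ w ∈ B, HasDerivAt y'.1 (L w (y.1 w)) w := by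
    rintro ⟨y, hy⟩
    obtain ⟨g, hg0, hg⟩ := (hL y hy).isExactOn_ball.with_val_at w₀ 0
    exact ⟨⟨g, fun w hw => (hg w hw).differentiableAt.differentiableWithinAt⟩, hg0, hg⟩
  choose Ψ hΨ0 hΨ using hstep
  set Y : ℕ → {y : ℂ → E // DifferentiableOn ℂ y B} := fun n =>
    Nat.rec ⟨fun _ => v, differentiableOn_const v⟩ (fun _ y => Ψ y) n with hY
  have hbound : ∀ n, ∀ w ∈ B, ‖(Y n).1 w‖ ≤ ‖v‖ * (1 / 2) ^ n := by
    intro n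
    induction n with
    | zero => intro w _; simp [hY]
    | succ n ih =>
      intro w hw
      have h1 := Convex.norm_image_sub_le_of_norm_deriv_le (f := (Y (n + 1)).1) (s := B)
        (C := M * (‖v‖ * (1 / 2) ^ n)) (fun x hx => (hΨ (Y n) x hx).differentiableAt)
        (fun x hx => by
          rw [(hΨ (Y n) x hx).deriv]
          exact (hM x hx _).trans (mul_le_mul_of_nonneg_left (ih x hx) hM0))
        (convex_ball w₀ R) hw₀ hw
      rw [show (Y (n + 1)).1 w₀ = 0 from hΨ0 (Y n), sub_zero] at h1
      have h2 : ‖w - w₀‖ ≤ R := by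
        rw [← dist_eq_norm]
        exact (Metric.mem_ball.1 hw).le
      calc ‖(Y (n + 1)).1 w‖ ≤ M * (‖v‖ * (1 / 2) ^ n) * ‖w - w₀‖ := h1
        _ ≤ M * (‖v‖ * (1 / 2) ^ n) * R := by gcongr
        _ = (‖v‖ * (1 / 2) ^ n) * (M * R) := by ring
        _ ≤ (‖v‖ * (1 / 2) ^ n) * (1 / 2) := by gcongr
        _ = ‖v‖ * (1 / 2) ^ (n + 1) := by ring
  have hgeo : Summable fun n : ℕ => (1 / 2 : ℝ) ^ n := summable_geometric_two
  have hsum : ∀ w ∈ B, Summable fun n => (Y n).1 w := fun w hw =>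
    Summable.of_norm_bounded (hgeo.mul_left ‖v‖) fun n => hbound n w hw
  have hsucc0 : ∀ n, (Y (n + 1)).1 w₀ = 0 := fun n => hΨ0 (Y n)
  refine ⟨fun w => v + ∑' n, (Y (n + 1)).1 w, by simp [hsucc0], fun w hw => ?_⟩
  have h1 := hasDerivAt_tsum_of_isPreconnected (g := fun n => (Y (n + 1)).1)
    (g' := fun n w => L w ((Y n).1 w)) (u := fun n => M * (‖v‖ * (1 / 2) ^ n)) (t := B) (y₀ := w₀)
    ((hgeo.mul_left ‖v‖).mul_left M) Metric.isOpen_ball (convex_ball w₀ R).isPreconnected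
    (fun n x hx => hΨ (Y n) x hx)
    (fun n x hx => (hM x hx _).trans (mul_le_mul_of_nonneg_left (hbound n x hx) hM0)) hw₀
    (by simp [hsucc0]) hw
  have h2 : ∑' n, L w ((Y n).1 w) = L w (v + ∑' n, (Y (n + 1)).1 w) := by
    rw [← ContinuousLinearMap.map_tsum _ (hsum w hw), (hsum w hw).tsum_eq_zero_add]
    rfl
  rw [← h2]
  exact h1.const_add v

/-- Local fundamental solutions of a holomorphic linear system. -/
theorem exists_fundamental_solution {n : Type*} [Fintype n] [DecidableEq n] {A : ℂ → Matrix n n ℂ}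
    {w₀ : ℂ} {U : Set ℂ} (hU : U ∈ 𝓝 w₀) (hA : ∀ i j, DifferentiableOn ℂ (fun w => A w i j) U) :
    ∃ R > 0, Metric.ball w₀ R ⊆ U ∧ ∀ v : n → ℂ, ∃ y : ℂ → n → ℂ, y w₀ = v ∧
      ∀ w ∈ Metric.ball w₀ R, HasDerivAt y (-(A w *ᵥ y w)) w := by
  set K : ℝ := ∑ i, ∑ j, (‖A w₀ i j‖ + 1)
  have hK : 0 ≤ K := Finset.sum_nonneg fun i _ => Finset.sum_nonneg fun j _ => by positivity
  have hev : ∀ᶠ w in 𝓝 w₀, w ∈ U ∧ ∀ i j, ‖A w i j‖ ≤ ‖A w₀ i j‖ + 1 := by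
    refine (eventually_mem_set.2 hU).and (eventually_all.2 fun i => eventually_all.2 fun j => ?_)
    have hc : ContinuousAt (fun w => ‖A w i j‖) w₀ :=
      ((hA i j).differentiableAt hU).continuousAt.norm
    exact (hc.eventually (gt_mem_nhds (lt_add_one _))).mono fun w hw => le_of_lt hw
  obtain ⟨R₀, hR₀, hball⟩ := Metric.eventually_nhds_iff_ball.1 hev
  have hR : 0 < min R₀ (1 / (2 * (K + 1))) := by positivity
  refine ⟨_, hR, fun w hw => (hball w (Metric.ball_subset_ball (min_le_left _ _) hw)).1,
    fun v => ?_⟩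
  refine exists_linear_ode_solution (M := K)
    (L := fun w => LinearMap.toContinuousLinearMap (-(Matrix.mulVecLin (A w)))) hR ?_
    (fun w hw v => ?_) (fun y hy => ?_) v
  · calc K * min R₀ (1 / (2 * (K + 1))) ≤ K * (1 / (2 * (K + 1))) := by gcongr; exact min_le_right _ _
      _ ≤ 1 / 2 := by
        rw [mul_one_div, div_le_div_iff₀ (by positivity) two_pos]
        linarith
  · have hw' := hball w (Metric.ball_subset_ball (min_le_left _ _) hw)
    change ‖-(A w *ᵥ v)‖ ≤ K * ‖v‖
    rw [norm_neg, pi_norm_le_iff_of_nonneg (by positivity)]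
    intro i
    calc ‖(A w *ᵥ v) i‖ ≤ ∑ j, ‖A w i j * v j‖ := norm_sum_le _ _
      _ ≤ ∑ j, (‖A w₀ i j‖ + 1) * ‖v‖ := by
        refine Finset.sum_le_sum fun j _ => ?_
        rw [norm_mul]
        exact mul_le_mul (hw'.2 i j) (norm_le_pi_norm v j) (norm_nonneg _) (by positivity)
      _ = (∑ j, (‖A w₀ i j‖ + 1)) * ‖v‖ := by rw [Finset.sum_mul]
      _ ≤ K * ‖v‖ := by
        refine mul_le_mul_of_nonneg_right ?_ (norm_nonneg v)
        exact Finset.single_le_sum (f := fun i => ∑ j, (‖A w₀ i j‖ + 1))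
          (fun i _ => Finset.sum_nonneg fun j _ => by positivity) (Finset.mem_univ i)
  · change DifferentiableOn ℂ (fun w => -(A w *ᵥ y w)) _
    refine DifferentiableOn.fun_neg ?_
    rw [differentiableOn_pi]
    intro i
    simp only [Matrix.mulVec, dotProduct]
    refine DifferentiableOn.fun_sum fun j _ => DifferentiableOn.fun_mul ?_ ?_
    · exact (hA i j).mono fun w hw => (hball w (Metric.ball_subset_ball (min_le_left _ _) hw)).1
    · exact (differentiableOn_pi.1 hy) j

end LinearODE

section FlatFrames

variable {C : Type*} [TopologicalSpace C] [ChartedSpace ℂ C] [IsManifold 𝓘(ℂ, ℂ) ω C] {ι : Type*}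
variable {z : ι → OpenPartialHomeomorph C ℂ}

/-- A trace-free connection matrix has a flat frame of determinant `1` near each point. -/
theorem exists_flat_frame {e : OpenPartialHomeomorph C ℂ}
    (he : e ∈ IsManifold.maximalAtlas 𝓘(ℂ, ℂ) ω C) {A : C → Matrix (Fin 2) (Fin 2) ℂ}
    (hA : HolMatrixOn A e.source) (htr : ∀ x ∈ e.source, (A x).trace = 0) {p : C}
    (hp : p ∈ e.source) :
    ∃ V ⊆ e.source, IsOpen V ∧ IsPathConnected V ∧ p ∈ V ∧
      ∃ Y : C → Matrix (Fin 2) (Fin 2) ℂ, HolMatrixOn Y V ∧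
        (∀ y ∈ V, matDeriv e Y y = -(A y * Y y)) ∧ Y p = 1 ∧ ∀ y ∈ V, (Y y).det = 1 := by
  obtain ⟨R, hR, hball, hsol⟩ := exists_fundamental_solution (A := fun w => A (e.symm w))
    (w₀ := e p) (e.open_target.mem_nhds (e.map_source hp)) (fun i j w hw => by
      have h1 := (hA i j).differentiableAt e.open_source (e.map_target hw) he (e.map_target hw)
      rw [e.right_inv hw] at h1
      exact h1.differentiableWithinAt)
  choose y hy0 hy using hsol
  set V : Set C := e.symm '' Metric.ball (e p) R
  have hVs : V ⊆ e.source := by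
    rintro _ ⟨w, hw, rfl⟩
    exact e.map_target (hball hw)
  have hVo : IsOpen V := e.symm.isOpen_image_of_subset_source Metric.isOpen_ball hball
  have hpV : p ∈ V := ⟨e p, Metric.mem_ball_self hR, e.left_inv hp⟩
  have hVc : IsPathConnected V := (Metric.isPathConnected_ball hR).image' (e.continuousOn_symm.mono hball)
  have hmem : ∀ x ∈ V, e x ∈ Metric.ball (e p) R := by
    rintro _ ⟨w, hw, rfl⟩
    rwa [e.right_inv (hball hw)]
  set Y : C → Matrix (Fin 2) (Fin 2) ℂ := fun x => Matrix.of fun i j => y (Pi.single j 1) (e x) i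
  have hd : ∀ x ∈ V, ∀ i j, HasDerivAt ((fun u => Y u i j) ∘ e.symm)
      (-(A x *ᵥ y (Pi.single j 1) (e x)) i) (e x) := by
    intro x hx i j
    have h1 := hasDerivAt_pi.1 (hy (Pi.single j 1) (e x) (hmem x hx)) i
    rw [e.left_inv (hVs hx)] at h1
    refine h1.congr_of_eventuallyEq ?_
    filter_upwards [e.open_target.mem_nhds (e.map_source (hVs hx))] with w hw
    simp only [Function.comp_apply, Y, Matrix.of_apply, e.right_inv hw]
  have hYh : HolMatrixOn Y V := fun i j => holOn_of_differentiableAt fun x hx =>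
    ⟨e, he, hVs hx, (hd x hx i j).differentiableAt⟩
  have hYd : ∀ x ∈ V, matDeriv e Y x = -(A x * Y x) := by
    intro x hx
    ext i j
    rw [matDeriv, Matrix.of_apply, coordDeriv, (hd x hx i j).deriv]
    rfl
  have hYp : Y p = 1 := by
    ext i j
    simp [Y, hy0, Matrix.one_apply, Pi.single_apply]
  refine ⟨V, hVs, hVo, hVc, hpV, Y, hYh, hYd, hYp, fun x hx => ?_⟩
  have hdet : HolOn (fun x => Y x 0 0 * Y x 1 1 - Y x 0 1 * Y x 1 0) V :=
    ((hYh 0 0).mul (hYh 1 1)).sub ((hYh 0 1).mul (hYh 1 0))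
  have h1 := eq_of_coordDeriv_eq_zero he hVo hVs hdet (fun u hu => ?_) hVc.isConnected.isPreconnected
    hx hpV
  · rw [Matrix.det_fin_two]
    simp only [hYp] at h1
    simpa using h1
  · have hm : ∀ i j, MDifferentiableAt 𝓘(ℂ, ℂ) 𝓘(ℂ, ℂ) (fun x => Y x i j) u := fun i j =>
      (hYh i j).mdifferentiableAt hVo hu
    have he' : ∀ i j, coordDeriv e (fun x => Y x i j) u = -(A u * Y u) i j := fun i j => by
      rw [← Matrix.neg_apply, ← hYd u hu]; rfl
    have ht := htr u (hVs hu)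
    rw [Matrix.trace_fin_two] at ht
    rw [coordDeriv_sub (f := fun x => Y x 0 0 * Y x 1 1) (g := fun x => Y x 0 1 * Y x 1 0) he
        (hVs hu) ((hm 0 0).mul (hm 1 1)) ((hm 0 1).mul (hm 1 0)),
      coordDeriv_mul he (hVs hu) (hm 0 0) (hm 1 1), coordDeriv_mul he (hVs hu) (hm 0 1) (hm 1 0)]
    simp only [he', Matrix.mul_apply, Fin.sum_univ_two]
    linear_combination -(Y u 0 0 * Y u 1 1 - Y u 0 1 * Y u 1 0) * ht

end FlatFrames

section FlatSections

variable {C : Type*} [TopologicalSpace C] [ChartedSpace ℂ C] [IsManifold 𝓘(ℂ, ℂ) ω C] {ι : Type*}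
variable {n : Type*} [Fintype n] [DecidableEq n]

/-- `s` is a flat holomorphic section over `V` of the bundle with connection `d + A_α dz_α`. -/
structure IsFlatSection (z : ι → OpenPartialHomeomorph C ℂ) (g : ι → ι → C → Matrix n n ℂ)
    (A : ι → C → Matrix n n ℂ) (V : Set C) (s : ι → C → n → ℂ) : Prop where
  isSection : IsSection z g V s
  flat : ∀ α, ∀ y ∈ V ∩ (z α).source, localOp z 1 A α (s α) y = 0

theorem IsFlatSection.mono {z : ι → OpenPartialHomeomorph C ℂ} {g : ι → ι → C → Matrix n n ℂ}
    {A : ι → C → Matrix n n ℂ} {V W : Set C} {s : ι → C → n → ℂ}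
    (hs : IsFlatSection z g A V s) (hWV : W ⊆ V) : IsFlatSection z g A W s :=
  ⟨⟨fun α => (hs.isSection.1 α).mono (inter_subset_inter_left _ hWV),
    fun α β x hx => hs.isSection.2 α β x ⟨hWV hx.1, hx.2⟩⟩, fun α y hy => hs.flat α y ⟨hWV hy.1, hy.2⟩⟩

variable {z : ι → OpenPartialHomeomorph C ℂ}

theorem IsFlatSection.add_smul (hz : IsCoordinateSystem z) {g : ι → ι → C → Matrix n n ℂ}
    {A : ι → C → Matrix n n ℂ} {V : Set C} (hV : IsOpen V)
    {s s' : ι → C → n → ℂ} (hs : IsFlatSection z g A V s) (hs' : IsFlatSection z g A V s') (a b : ℂ) :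
    IsFlatSection z g A V fun α y => a • s α y + b • s' α y where
  isSection := ⟨fun α => ((hs.isSection.1 α).const_smul a).add ((hs'.isSection.1 α).const_smul b),
    fun α β x hx => by
      beta_reduce
      rw [hs.isSection.2 α β x hx, hs'.isSection.2 α β x hx, Matrix.mulVec_add, Matrix.mulVec_smul,
        Matrix.mulVec_smul]⟩
  flat α y hy := by
    have ho := hV.inter (z α).open_source
    have h1 := (hs.isSection.1 α).mdifferentiableAt ho hy
    have h2 := (hs'.isSection.1 α).mdifferentiableAt ho hy
    have hd : ∀ (c : ℂ) {f : C → n → ℂ}, MDifferentiableAt 𝓘(ℂ, ℂ) 𝓘(ℂ, n → ℂ) f y →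
        coordDeriv (z α) (fun x => c • f x) y = c • coordDeriv (z α) f y := fun c f hf =>
      deriv_fun_const_smul c ((mdifferentiableAt_iff_coord (hz.holomorphic α) hy.2).1 hf)
    have e1 := hs.flat α y hy
    have e2 := hs'.flat α y hy
    simp only [localOp, one_smul] at e1 e2 ⊢
    rw [coordDeriv_add (f := fun x => a • s α x) (g := fun x => b • s' α x) (hz.holomorphic α) hy.2
      (((hs.isSection.1 α).const_smul a).mdifferentiableAt ho hy)
      (((hs'.isSection.1 α).const_smul b).mdifferentiableAt ho hy), hd a h1, hd b h2,
      Matrix.mulVec_add, Matrix.mulVec_smul, Matrix.mulVec_smul, eq_neg_of_add_eq_zero_left e1,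
      eq_neg_of_add_eq_zero_left e2]
    module

/-- The standard symplectic form on `ℂ²`. -/
def symp (v w : Fin 2 → ℂ) : ℂ := v 0 * w 1 - v 1 * w 0

theorem symp_mulVec {M : Matrix (Fin 2) (Fin 2) ℂ} (hM : M.det = 1) (v w : Fin 2 → ℂ) :
    symp (M *ᵥ v) (M *ᵥ w) = symp v w := by
  rw [Matrix.det_fin_two] at hM
  simp only [symp, Matrix.mulVec, dotProduct, Fin.sum_univ_two]
  linear_combination (v 0 * w 1 - v 1 * w 0) * hM

theorem eq_zero_of_symp_of_symp_ne_zero {u u' v : Fin 2 → ℂ} (h : symp u u' ≠ 0)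
    (h0 : symp u v = 0) (h1 : symp u' v = 0) : v = 0 := by
  simp only [symp] at h h0 h1
  ext i
  fin_cases i
  · refine (mul_eq_zero.1 (?_ : (u 0 * u' 1 - u 1 * u' 0) * v 0 = 0)).resolve_left h
    linear_combination u' 0 * h0 - u 0 * h1
  · refine (mul_eq_zero.1 (?_ : (u 0 * u' 1 - u 1 * u' 0) * v 1 = 0)).resolve_left h
    linear_combination u' 1 * h0 - u 1 * h1

variable {g : ι → ι → C → Matrix (Fin 2) (Fin 2) ℂ} {A : ι → C → Matrix (Fin 2) (Fin 2) ℂ}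

theorem IsFlatSection.eventually_symp_eq (hz : IsCoordinateSystem z) (hS : IsSLPair z g 1 A)
    {V V' : Set C} (hV : IsOpen V) (hV' : IsOpen V') {s s' : ι → C → Fin 2 → ℂ}
    (hs : IsFlatSection z g A V s) (hs' : IsFlatSection z g A V' s') {α : ι} {x : C} (hx : x ∈ V)
    (hx' : x ∈ V') (hxα : x ∈ (z α).source) :
    ∀ᶠ y in 𝓝 x, symp (s α y) (s' α y) = symp (s α x) (s' α x) := by
  set W := V ∩ V' ∩ (z α).source
  have hW : IsOpen W := (hV.inter hV').inter (z α).open_source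
  have hsW : HolOn (s α) W := (hs.isSection.1 α).mono fun y hy => ⟨hy.1.1, hy.2⟩
  have hsW' : HolOn (s' α) W := (hs'.isSection.1 α).mono fun y hy => ⟨hy.1.2, hy.2⟩
  rw [holOn_pi] at hsW hsW'
  refine eventually_eq_of_coordDeriv_eq_zero (f := fun y => symp (s α y) (s' α y))
    (hz.holomorphic α) hW (fun y hy => hy.2)
    (((hsW 0).mul (hsW' 1)).sub ((hsW 1).mul (hsW' 0))) (fun y hy => ?_) ⟨⟨hx, hx'⟩, hxα⟩
  have m : ∀ i, MDifferentiableAt 𝓘(ℂ, ℂ) 𝓘(ℂ, ℂ) (fun y => s α y i) y := fun i =>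
    (hsW i).mdifferentiableAt hW hy
  have m' : ∀ i, MDifferentiableAt 𝓘(ℂ, ℂ) 𝓘(ℂ, ℂ) (fun y => s' α y i) y := fun i =>
    (hsW' i).mdifferentiableAt hW hy
  have d : ∀ i, coordDeriv (z α) (fun y => s α y i) y = -(A α y *ᵥ s α y) i := fun i => by
    have h1 := hs.flat α y ⟨hy.1.1, hy.2⟩
    rw [localOp, one_smul] at h1
    rw [← coordDeriv_apply (hz.holomorphic α) hy.2
      ((holOn_pi.2 hsW).mdifferentiableAt hW hy), eq_neg_of_add_eq_zero_left h1]
    rfl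
  have d' : ∀ i, coordDeriv (z α) (fun y => s' α y i) y = -(A α y *ᵥ s' α y) i := fun i => by
    have h1 := hs'.flat α y ⟨hy.1.2, hy.2⟩
    rw [localOp, one_smul] at h1
    rw [← coordDeriv_apply (hz.holomorphic α) hy.2
      ((holOn_pi.2 hsW').mdifferentiableAt hW hy), eq_neg_of_add_eq_zero_left h1]
    rfl
  have ht := hS.trace_eq_zero α y hy.2
  rw [Matrix.trace_fin_two] at ht
  simp only [symp]
  rw [coordDeriv_sub (f := fun y => s α y 0 * s' α y 1) (g := fun y => s α y 1 * s' α y 0)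
    (hz.holomorphic α) hy.2 ((m 0).mul (m' 1)) ((m 1).mul (m' 0)),
    coordDeriv_mul (hz.holomorphic α) hy.2 (m 0) (m' 1),
    coordDeriv_mul (hz.holomorphic α) hy.2 (m 1) (m' 0)]
  simp only [d, d', Matrix.mulVec, dotProduct, Fin.sum_univ_two]
  linear_combination -(s α y 0 * s' α y 1 - s α y 1 * s' α y 0) * ht

/-- Flat sections from a flat frame over a coordinate domain. -/
theorem isFlatSection_of_frame (hz : IsCoordinateSystem z) (hS : IsSLPair z g 1 A) {β : ι}
    {V : Set C} (hVβ : V ⊆ (z β).source) (hV : IsOpen V) {Y : C → Matrix (Fin 2) (Fin 2) ℂ}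
    (hY : HolMatrixOn Y V) (hd : ∀ y ∈ V, matDeriv (z β) Y y = -(A β y * Y y)) (c : Fin 2 → ℂ) :
    IsFlatSection z g A V fun γ y => g γ β y *ᵥ (Y y *ᵥ c) := by
  have hsec : IsSection z g V fun γ y => g γ β y *ᵥ (Y y *ᵥ c) := by
    refine ⟨fun γ => ?_, fun γ δ y hy => ?_⟩
    · refine HolMatrixOn.mulVec (fun i j => (hS.bundle.holomorphic γ β i j).mono
        fun y hy => ⟨hy.2, hVβ hy.1⟩) ?_
      exact HolMatrixOn.mulVec (fun i j => (hY i j).mono inter_subset_left) (holOn_const c)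
    · rw [Matrix.mulVec_mulVec (Y y *ᵥ c), hS.bundle.cocycle γ δ β y ⟨hy.2, hVβ hy.1⟩]
  refine ⟨hsec, fun γ y hy => ?_⟩
  have h1 := (hS.connection.glue V hV _ hsec).2 γ β y ⟨hy.1, hy.2, hVβ hy.1⟩
  beta_reduce at h1
  rw [h1]
  have h2 : localOp z 1 A β (fun y => g β β y *ᵥ (Y y *ᵥ c)) y = 0 := by
    have h3 : ∀ u ∈ V, g β β u *ᵥ (Y u *ᵥ c) = Y u *ᵥ c := fun u hu => by
      rw [hS.bundle.one β u (hVβ hu), Matrix.one_mulVec]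
    rw [localOp, coordDeriv_congr_of_eqOn (g := fun u => Y u *ᵥ c) (hVβ hy.1) hV hy.1 h3,
      coordDeriv_mulVec (hz.holomorphic β) (hVβ hy.1) hV hy.1 hY (holOn_const c), coordDeriv_const,
      hd y hy.1, h3 y hy.1, Matrix.mulVec_zero, add_zero, one_smul, Matrix.neg_mulVec,
      Matrix.mulVec_mulVec, neg_add_cancel]
  rw [h2, Matrix.mulVec_zero]

theorem IsSLPair.transition_inv (hS : IsSLPair z g 1 A) {α β : ι} {x : C}
    (hx : x ∈ (z α).source ∩ (z β).source) : g α β x * g β α x = 1 := by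
  rw [hS.bundle.cocycle α β α x ⟨hx, hx.1⟩, hS.bundle.one α x hx.1]

theorem exists_flat_sections (hz : IsCoordinateSystem z) (hS : IsSLPair z g 1 A) (p : C) :
    ∃ V, IsOpen V ∧ p ∈ V ∧ ∀ x ∈ V, ∀ α, x ∈ (z α).source → ∀ w, ∃ s,
      IsFlatSection z g A V s ∧ s α x = w := by
  obtain ⟨β, hβ⟩ := hz.covers p
  obtain ⟨V, hVβ, hV, -, hpV, Y, hY, hd, -, hdet⟩ := exists_flat_frame (hz.holomorphic β)
    (hS.connection.holomorphic β) (hS.trace_eq_zero β) hβ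
  refine ⟨V, hV, hpV, fun x hx α hα w => ⟨_, isFlatSection_of_frame hz hS hVβ hV hY hd
    ((Y x)⁻¹ *ᵥ (g β α x *ᵥ w)), ?_⟩⟩
  have hu : IsUnit (Y x).det := by rw [hdet x hx]; exact isUnit_one
  rw [Matrix.mulVec_mulVec _ (Y x), Matrix.mul_nonsing_inv _ hu, Matrix.one_mulVec,
    Matrix.mulVec_mulVec, hS.transition_inv ⟨hα, hVβ hx⟩, Matrix.one_mulVec]

/-- Flat sections that agree at a point agree near this point. -/
theorem IsFlatSection.eventually_eq (hz : IsCoordinateSystem z) (hS : IsSLPair z g 1 A)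
    {V V' : Set C} (hV : IsOpen V) (hV' : IsOpen V') {s s' : ι → C → Fin 2 → ℂ}
    (hs : IsFlatSection z g A V s) (hs' : IsFlatSection z g A V' s') {α : ι} {x : C} (hx : x ∈ V)
    (hx' : x ∈ V') (hxα : x ∈ (z α).source) (h : s α x = s' α x) :
    ∀ᶠ y in 𝓝 x, ∀ β, y ∈ (z β).source → s β y = s' β y := by
  have hW : IsOpen (V ∩ V') := hV.inter hV'
  set d : ι → C → Fin 2 → ℂ := fun α y => (1 : ℂ) • s α y + (-1 : ℂ) • s' α y
  have hd : IsFlatSection z g A (V ∩ V') d :=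
    (hs.mono inter_subset_left).add_smul hz hW (hs'.mono inter_subset_right) 1 (-1)
  have hdx : d α x = 0 := by simp [d, h]
  obtain ⟨W, hWo, hxW, hfl⟩ := exists_flat_sections hz hS x
  obtain ⟨u, hu, hux⟩ := hfl x hxW α hxα (Pi.single 0 1)
  obtain ⟨u', hu', hux'⟩ := hfl x hxW α hxα (Pi.single 1 1)
  have e1 := hu.eventually_symp_eq hz hS hWo hW hd hxW ⟨hx, hx'⟩ hxα
  have e2 := hu'.eventually_symp_eq hz hS hWo hW hd hxW ⟨hx, hx'⟩ hxα
  have e3 := hu.eventually_symp_eq hz hS hWo hWo hu' hxW hxW hxα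
  filter_upwards [e1, e2, e3, hW.mem_nhds ⟨hx, hx'⟩, (z α).open_source.mem_nhds hxα]
    with y h1 h2 h3 hyW hyα β hyβ
  have h4 : d α y = 0 := by
    refine eq_zero_of_symp_of_symp_ne_zero (u := u α y) (u' := u' α y) ?_ ?_ ?_
    · rw [h3, hux, hux']
      simp [symp]
    · rw [h1, hdx]
      simp [symp]
    · rw [h2, hdx]
      simp [symp]
  have h5 : s α y = s' α y := by
    simpa [d, ← sub_eq_add_neg, sub_eq_zero] using h4
  rw [hs.isSection.2 β α y ⟨hyW.1, hyβ, hyα⟩, hs'.isSection.2 β α y ⟨hyW.2, hyβ, hyα⟩, h5]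

end FlatSections

section ParallelTransport

variable {C : Type*} [TopologicalSpace C] [ChartedSpace ℂ C] [IsManifold 𝓘(ℂ, ℂ) ω C] {ι : Type*}
variable {z : ι → OpenPartialHomeomorph C ℂ}
variable {g : ι → ι → C → Matrix (Fin 2) (Fin 2) ℂ} {A : ι → C → Matrix (Fin 2) (Fin 2) ℂ}
variable {x y u : C}

theorem IsParallelAlong.transition {γ : Path x y} {v : unitInterval → ι → Fin 2 → ℂ}
    (hv : IsParallelAlong z g A γ v) {t : unitInterval} {α β : ι}
    (ht : γ t ∈ (z α).source ∩ (z β).source) : v t α = g α β (γ t) *ᵥ v t β := by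
  obtain ⟨V, -, htV, s, hs, -, hev⟩ := hv t
  have h := hev.self_of_nhds
  rw [h α ht.1, h β ht.2, hs.2 α β _ ⟨htV, ht⟩]

theorem IsParallelAlong.comp {x' y' : C} {γ : Path x y} {v : unitInterval → ι → Fin 2 → ℂ}
    (hv : IsParallelAlong z g A γ v) {γ' : Path x' y'} {φ : unitInterval → unitInterval}
    (hφ : Continuous φ) (hγ : ∀ t, γ' t = γ (φ t)) :
    IsParallelAlong z g A γ' fun t => v (φ t) := by
  intro t₀
  obtain ⟨V, hV, htV, s, hs, hfl, hev⟩ := hv (φ t₀)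
  refine ⟨V, hV, by rwa [hγ], s, hs, hfl, ?_⟩
  filter_upwards [hφ.continuousAt.eventually hev] with t ht α hα
  rw [hγ] at hα ⊢
  exact ht α hα

theorem IsFlatSection.isParallelAlong {V : Set C} (hV : IsOpen V) {s : ι → C → Fin 2 → ℂ}
    (hs : IsFlatSection z g A V s) {γ : Path x y} (hγ : ∀ t, γ t ∈ V) :
    IsParallelAlong z g A γ fun t α => s α (γ t) := fun t₀ =>
  ⟨V, hV, hγ t₀, s, hs.isSection, hs.flat, Eventually.of_forall fun _ _ _ => rfl⟩

theorem IsParallelAlong.add_smul (hz : IsCoordinateSystem z) {γ : Path x y}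
    {v v' : unitInterval → ι → Fin 2 → ℂ} (hv : IsParallelAlong z g A γ v)
    (hv' : IsParallelAlong z g A γ v') (a b : ℂ) :
    IsParallelAlong z g A γ fun t α => a • v t α + b • v' t α := by
  intro t₀
  obtain ⟨V, hV, htV, s, hs, hfl, hev⟩ := hv t₀
  obtain ⟨V', hV', htV', s', hs', hfl', hev'⟩ := hv' t₀
  have h := ((IsFlatSection.mk hs hfl).mono (inter_subset_left (t := V'))).add_smul hz
    (hV.inter hV') ((IsFlatSection.mk hs' hfl').mono inter_subset_right) a b
  refine ⟨V ∩ V', hV.inter hV', ⟨htV, htV'⟩, _, h.isSection, h.flat, ?_⟩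
  filter_upwards [hev, hev'] with t h1 h2 α hα
  rw [h1 α hα, h2 α hα]

/-- The symplectic form is preserved by parallel transport. -/
theorem IsParallelAlong.symp_eq (hz : IsCoordinateSystem z) (hS : IsSLPair z g 1 A) {γ : Path x y}
    {v v' : unitInterval → ι → Fin 2 → ℂ} (hv : IsParallelAlong z g A γ v)
    (hv' : IsParallelAlong z g A γ v') {α β : ι} (hα : x ∈ (z α).source) (hβ : y ∈ (z β).source) :
    symp (v 0 α) (v' 0 α) = symp (v 1 β) (v' 1 β) := by
  choose a ha using hz.covers
  have hch : ∀ t α, γ t ∈ (z α).source →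
      symp (v t (a (γ t))) (v' t (a (γ t))) = symp (v t α) (v' t α) := fun t α hα => by
    rw [hv.transition ⟨ha _, hα⟩, hv'.transition ⟨ha _, hα⟩,
      symp_mulVec (hS.det_eq_one _ _ _ ⟨ha _, hα⟩)]
  have hloc : IsLocallyConstant fun t => symp (v t (a (γ t))) (v' t (a (γ t))) := by
    rw [IsLocallyConstant.iff_eventually_eq]
    intro t₀
    obtain ⟨V, hV, htV, s, hs, hfl, hev⟩ := hv t₀
    obtain ⟨V', hV', htV', s', hs', hfl', hev'⟩ := hv' t₀
    have h1 := (IsFlatSection.mk hs hfl).eventually_symp_eq hz hS hV hV' ⟨hs', hfl'⟩ htV htV'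
      (ha (γ t₀))
    have hγ : ContinuousAt γ t₀ := γ.continuous.continuousAt
    filter_upwards [hev, hev', hγ.eventually h1,
      hγ.eventually ((z (a (γ t₀))).open_source.mem_nhds (ha _))] with t e1 e2 e3 e4
    rw [hch t _ e4, e1 _ e4, e2 _ e4, e3, hev.self_of_nhds _ (ha _), hev'.self_of_nhds _ (ha _)]
  rw [← hch 0 α (by rwa [γ.source]), ← hch 1 β (by rwa [γ.target])]
  exact hloc.apply_eq_of_preconnectedSpace 0 1

/-- Parallel transport exists along every path. -/
theorem exists_isParallelAlong (hz : IsCoordinateSystem z) (hS : IsSLPair z g 1 A) (γ : Path x y)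
    {α : ι} (hα : x ∈ (z α).source) (w : Fin 2 → ℂ) :
    ∃ v, IsParallelAlong z g A γ v ∧ v 0 α = w := by
  classical
  choose V hV hmem hfl using exists_flat_sections hz hS
  choose a ha using hz.covers
  obtain ⟨t, ht0, htm, ⟨N, hN⟩, hcov⟩ := exists_monotone_Icc_subset_open_cover_unitInterval
    (c := fun p : C => γ ⁻¹' V p) (fun p => (hV p).preimage γ.continuous)
    (fun τ _ => mem_iUnion.2 ⟨γ τ, hmem (γ τ)⟩)
  have key : ∀ k, ∃ v : unitInterval → ι → Fin 2 → ℂ, v 0 α = w ∧ ∀ τ₀ ≤ t k, ∃ W : Set C,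
      IsOpen W ∧ γ τ₀ ∈ W ∧ ∃ s, IsFlatSection z g A W s ∧
        ∀ᶠ τ in 𝓝 τ₀, τ ≤ t k → ∀ β, γ τ ∈ (z β).source → v τ β = s β (γ τ) := by
    intro k
    induction k with
    | zero =>
      have hα0 : γ 0 ∈ (z α).source := by rwa [γ.source]
      obtain ⟨s, hs, hsw⟩ := hfl (γ 0) (γ 0) (hmem _) α hα0 w
      refine ⟨fun τ β => s β (γ τ), hsw, fun τ₀ hτ₀ => ?_⟩
      rw [ht0] at hτ₀
      obtain rfl : τ₀ = 0 := le_antisymm hτ₀ unitInterval.nonneg'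
      exact ⟨V (γ 0), hV _, hmem _, s, hs, Eventually.of_forall fun _ _ _ _ => rfl⟩
    | succ k ih =>
      obtain ⟨v, hv0, hv⟩ := ih
      obtain ⟨p, hp⟩ := hcov k
      have hle : t k ≤ t (k + 1) := htm (Nat.le_succ k)
      have hpk : γ (t k) ∈ V p := hp ⟨le_rfl, hle⟩
      obtain ⟨s', hs', hsw'⟩ := hfl p (γ (t k)) hpk (a (γ (t k))) (ha _) (v (t k) (a (γ (t k))))
      refine ⟨fun τ β => if τ ≤ t k then v τ β else s' β (γ τ),
        by simp [hv0], fun τ₀ hτ₀ => ?_⟩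
      rcases lt_trichotomy τ₀ (t k) with hlt | heq | hgt
      · obtain ⟨W, hW, hτW, s, hs, hev⟩ := hv τ₀ hlt.le
        refine ⟨W, hW, hτW, s, hs, ?_⟩
        filter_upwards [hev, gt_mem_nhds hlt] with τ h1 h2 _ β hβ
        rw [if_pos (le_of_lt h2)]
        exact h1 (le_of_lt h2) β hβ
      · obtain ⟨W, hW, hτW, s, hs, hev⟩ := hv (t k) le_rfl
        rw [heq]
        refine ⟨V p, hV p, hpk, s', hs', ?_⟩
        have h0 := hs.eventually_eq hz hS hW (hV p) hs' hτW hpk (ha _)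
          (by rw [hsw', ← hev.self_of_nhds le_rfl _ (ha _)])
        filter_upwards [hev, γ.continuous.continuousAt.eventually h0] with τ h1 h2 _ β hβ
        split_ifs with hτ
        · rw [h1 hτ β hβ, h2 β hβ]
        · rfl
      · refine ⟨V p, hV p, hp ⟨hgt.le, hτ₀⟩, s', hs', ?_⟩
        filter_upwards [lt_mem_nhds hgt] with τ h2 _ β hβ
        rw [if_neg (not_le.2 h2)]
  obtain ⟨v, hv0, hv⟩ := key N
  rw [hN N le_rfl] at hv
  refine ⟨v, fun τ₀ => ?_, hv0⟩
  obtain ⟨W, hW, hτW, s, hs, hev⟩ := hv τ₀ unitInterval.le_one'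
  exact ⟨W, hW, hτW, s, hs.isSection, hs.flat, hev.mono fun τ h => h unitInterval.le_one'⟩

theorem IsParallelAlong.unique (hz : IsCoordinateSystem z) (hS : IsSLPair z g 1 A) {γ : Path x y}
    {v v' : unitInterval → ι → Fin 2 → ℂ} (hv : IsParallelAlong z g A γ v)
    (hv' : IsParallelAlong z g A γ v') {α β : ι} (hα : x ∈ (z α).source) (hβ : y ∈ (z β).source)
    (h : v 0 α = v' 0 α) : v 1 β = v' 1 β := by
  have hd := hv.add_smul hz hv' 1 (-1)
  have hd0 : (1 : ℂ) • v 0 α + (-1 : ℂ) • v' 0 α = 0 := by simp [h]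
  obtain ⟨e, he, he0⟩ := exists_isParallelAlong hz hS γ hα (Pi.single 0 1)
  obtain ⟨e', he', he0'⟩ := exists_isParallelAlong hz hS γ hα (Pi.single 1 1)
  have h1 := he.symp_eq hz hS hd hα hβ
  have h2 := he'.symp_eq hz hS hd hα hβ
  have h3 := he.symp_eq hz hS he' hα hβ
  rw [hd0] at h1 h2
  have h4 := eq_zero_of_symp_of_symp_ne_zero (u := e 1 β) (u' := e' 1 β)
    (by rw [← h3, he0, he0']; simp [symp]) (h1.symm.trans (by simp [symp]))
    (h2.symm.trans (by simp [symp]))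
  simpa [← sub_eq_add_neg, sub_eq_zero] using h4

/-- `M` is the matrix of parallel transport along `γ`, from the trivialization over `U_α` to the one
over `U_β`. -/
def IsTransport (z : ι → OpenPartialHomeomorph C ℂ) (g : ι → ι → C → Matrix (Fin 2) (Fin 2) ℂ)
    (A : ι → C → Matrix (Fin 2) (Fin 2) ℂ) (α β : ι) (γ : Path x y)
    (M : Matrix (Fin 2) (Fin 2) ℂ) : Prop :=
  ∀ w, ∃ v, IsParallelAlong z g A γ v ∧ v 0 α = w ∧ v 1 β = M *ᵥ w

variable (hz : IsCoordinateSystem z) (hS : IsSLPair z g 1 A)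
include hz hS

theorem exists_isTransport (γ : Path x y) {α : ι} (β : ι) (hα : x ∈ (z α).source) :
    ∃ M, IsTransport z g A α β γ M := by
  obtain ⟨e, he, he0⟩ := exists_isParallelAlong hz hS γ hα (Pi.single 0 1)
  obtain ⟨e', he', he0'⟩ := exists_isParallelAlong hz hS γ hα (Pi.single 1 1)
  refine ⟨Matrix.of fun i j => ![e 1 β i, e' 1 β i] j, fun w => ⟨_, he.add_smul hz he' (w 0) (w 1),
    ?_, ?_⟩⟩
  · rw [he0, he0']
    ext i
    fin_cases i <;> simp
  · ext i
    simp [Matrix.mulVec, dotProduct, Fin.sum_univ_two, mul_comm]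

theorem IsTransport.det {γ : Path x y} {α β : ι} {M : Matrix (Fin 2) (Fin 2) ℂ}
    (hM : IsTransport z g A α β γ M) (hα : x ∈ (z α).source) (hβ : y ∈ (z β).source) :
    M.det = 1 := by
  obtain ⟨e, he, he0, he1⟩ := hM (Pi.single 0 1)
  obtain ⟨e', he', he0', he1'⟩ := hM (Pi.single 1 1)
  have h := he.symp_eq hz hS he' hα hβ
  rw [he0, he0', he1, he1'] at h
  rw [Matrix.det_fin_two]
  simp [symp] at h
  linear_combination -h

theorem IsTransport.trans {γ : Path x y} {γ' : Path y u} {α β δ : ι}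
    {M M' : Matrix (Fin 2) (Fin 2) ℂ} (hM : IsTransport z g A α β γ M)
    (hM' : IsTransport z g A β δ γ' M') (hα : x ∈ (z α).source) (hβ : y ∈ (z β).source)
    (hδ : u ∈ (z δ).source) : IsTransport z g A α δ (γ.trans γ') (M' * M) := by
  intro w
  obtain ⟨v, hv, hv0⟩ := exists_isParallelAlong hz hS (γ.trans γ') hα w
  refine ⟨v, hv, hv0, ?_⟩
  set φ : unitInterval → unitInterval := fun t => ⟨t / 2, by
    constructor <;> linarith [t.2.1, t.2.2]⟩
  set φ' : unitInterval → unitInterval := fun t => ⟨(t + 1) / 2, by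
    constructor <;> linarith [t.2.1, t.2.2]⟩
  have hφ : Continuous φ := by fun_prop
  have hφ' : Continuous φ' := by fun_prop
  have h1 := hv.comp (γ' := γ) hφ fun t => by
    have ht : ((φ t : unitInterval) : ℝ) ≤ 1 / 2 := by
      change (t : ℝ) / 2 ≤ 1 / 2
      linarith [t.2.2]
    rw [Path.trans_apply, dif_pos ht]
    congr 1
    ext
    change (t : ℝ) = 2 * (t / 2)
    ring
  have h2 := hv.comp (γ' := γ') hφ' fun t => by
    by_cases ht : ((φ' t : unitInterval) : ℝ) ≤ 1 / 2
    · have ht0 : t = 0 := by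
        ext
        change ((t : ℝ) + 1) / 2 ≤ 1 / 2 at ht
        change (t : ℝ) = 0
        linarith [t.2.1]
      have h3 : φ' t = ⟨1 / 2, by norm_num, by norm_num⟩ := by
        rw [ht0]
        ext
        simp [φ']
      rw [h3, ht0, γ'.source, Path.trans_apply, dif_pos le_rfl]
      have h4 : (⟨2 * (1 / 2), by norm_num⟩ : unitInterval) = 1 := by
        ext
        norm_num
      exact (congrArg γ h4).trans γ.target |>.symm
    · rw [Path.trans_apply, dif_neg ht]
      congr 1
      ext
      change (t : ℝ) = 2 * ((t + 1) / 2) - 1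
      ring
  have e0 : φ 0 = 0 := by ext; simp [φ]
  have e1 : φ 1 = φ' 0 := by ext; simp [φ, φ']
  have e2 : φ' 1 = 1 := by ext; simp [φ']
  obtain ⟨v₁, hv₁, hv₁0, hv₁1⟩ := hM w
  obtain ⟨v₂, hv₂, hv₂0, hv₂1⟩ := hM' (M *ᵥ w)
  have h3 := hv₁.unique hz hS h1 hα hβ (by rw [hv₁0, e0, hv0])
  have h4 := hv₂.unique hz hS h2 hβ hδ (by rw [hv₂0, ← hv₁1, h3, e1])
  rw [← Matrix.mulVec_mulVec, ← hv₂1, h4, e2]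

theorem IsTransport.symm {γ : Path x y} {α β : ι} {M : Matrix (Fin 2) (Fin 2) ℂ}
    (hM : IsTransport z g A α β γ M) (hα : x ∈ (z α).source) (hβ : y ∈ (z β).source) :
    IsTransport z g A β α γ.symm M⁻¹ := by
  have hu : IsUnit M.det := by rw [hM.det hz hS hα hβ]; exact isUnit_one
  intro w
  obtain ⟨v, hv, hv0, hv1⟩ := hM (M⁻¹ *ᵥ w)
  refine ⟨_, hv.comp (γ' := γ.symm) unitInterval.continuous_symm fun t => rfl, ?_, ?_⟩
  · rw [unitInterval.symm_zero, hv1, Matrix.mulVec_mulVec, Matrix.mul_nonsing_inv _ hu,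
      Matrix.one_mulVec]
  · rw [unitInterval.symm_one, hv0]

/-- Flat frames give the parallel transport along short paths. -/
theorem isTransport_of_frame {β : ι} {V : Set C} (hVβ : V ⊆ (z β).source) (hV : IsOpen V)
    {Y : C → Matrix (Fin 2) (Fin 2) ℂ} (hY : HolMatrixOn Y V)
    (hd : ∀ y ∈ V, matDeriv (z β) Y y = -(A β y * Y y)) (hx : Y x = 1) {γ : Path x y}
    (hγ : ∀ t, γ t ∈ V) : IsTransport z g A β β γ (Y y) := by
  intro w
  have h0 := hγ 0
  have h1 := hγ 1
  rw [γ.source] at h0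
  rw [γ.target] at h1
  refine ⟨_, (isFlatSection_of_frame hz hS hVβ hV hY hd w).isParallelAlong hV hγ, ?_, ?_⟩
  · rw [γ.source, hS.bundle.one β x (hVβ h0), hx, Matrix.one_mulVec, Matrix.one_mulVec]
  · rw [γ.target, hS.bundle.one β y (hVβ h1), Matrix.one_mulVec]

theorem IsTransport.change {γ : Path x y} {α β δ : ι} {M : Matrix (Fin 2) (Fin 2) ℂ}
    (hM : IsTransport z g A α β γ M) (hβ : y ∈ (z β).source) (hδ : y ∈ (z δ).source) :
    IsTransport z g A α δ γ (g δ β y * M) := by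
  intro w
  obtain ⟨v, hv, hv0, hv1⟩ := hM w
  have h := hv.transition (t := 1) (α := δ) (β := β) (by rw [γ.target]; exact ⟨hδ, hβ⟩)
  rw [γ.target] at h
  exact ⟨v, hv, hv0, by rw [h, hv1, Matrix.mulVec_mulVec]⟩

theorem isTransport_refl {α : ι} (hα : x ∈ (z α).source) :
    IsTransport z g A α α (Path.refl x) 1 := by
  intro w
  obtain ⟨V, hV, hxV, h⟩ := exists_flat_sections hz hS x
  obtain ⟨s, hs, hsw⟩ := h x hxV α hα w
  exact ⟨_, hs.isParallelAlong hV (γ := Path.refl x) fun _ => hxV, hsw, by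
    rw [Matrix.one_mulVec]; exact hsw⟩

/-- The holonomy matrices form a subgroup of `SL₂(ℂ)`. -/
theorem isSLGroup_holonomy {α : ι} (hα : x ∈ (z α).source) : IsSLGroup (holonomy z g A α x) where
  det := by
    rintro M ⟨γ, hM⟩
    exact IsTransport.det hz hS (γ := γ) hM hα hα
  one := ⟨_, isTransport_refl hz hS hα⟩
  mul := by
    rintro M ⟨γ, hM⟩ M' ⟨γ', hM'⟩
    exact ⟨_, IsTransport.trans hz hS (γ := γ') (γ' := γ) hM' hM hα hα hα⟩
  inv := by
    rintro M ⟨γ, hM⟩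
    exact ⟨_, IsTransport.symm hz hS (γ := γ) hM hα hα⟩

end ParallelTransport

section LogarithmicDerivatives

variable {κ : Type*} [Fintype κ] {l : κ → Fin 2 → ℂ}

/-- The columns of `S⁻¹`, for `S ∈ SL₂(ℂ)`. -/
def invCol (S : Matrix (Fin 2) (Fin 2) ℂ) : Fin 2 → Fin 2 → ℂ := ![![S 1 1, -S 1 0], ![-S 0 1, S 0 0]]

theorem invCol_eq {S : Matrix (Fin 2) (Fin 2) ℂ} (hS : S.det = 1) (j : Fin 2) :
    invCol S j = S⁻¹ *ᵥ Pi.single j 1 := by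
  ext i
  rw [Matrix.inv_def, hS, Ring.inverse_one, one_smul, Matrix.adjugate_fin_two]
  fin_cases i <;> fin_cases j <;> simp [invCol]

theorem hasDerivAt_prod_linear {a b : Fin 2 → ℂ} (ha : ∏ i, l i ⬝ᵥ a ≠ 0) :
    HasDerivAt (fun t : ℂ => ∏ i, l i ⬝ᵥ (a + t • b))
      ((∏ i, l i ⬝ᵥ a) * ∑ i, (l i ⬝ᵥ b) / (l i ⬝ᵥ a)) 0 := by
  classical
  have h1 : ∀ i ∈ Finset.univ, HasDerivAt (fun t : ℂ => l i ⬝ᵥ (a + t • b)) (l i ⬝ᵥ b) 0 := by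
    intro i _
    simp only [dotProduct_add, dotProduct_smul, smul_eq_mul]
    simpa using ((hasDerivAt_id (0 : ℂ)).mul_const (l i ⬝ᵥ b)).const_add (l i ⬝ᵥ a)
  have h2 := HasDerivAt.fun_finsetProd h1
  simp only [zero_smul, add_zero, smul_eq_mul] at h2
  refine h2.congr_deriv ?_
  rw [Finset.mul_sum]
  refine Finset.sum_congr rfl fun i hi => ?_
  have h3 : l i ⬝ᵥ a ≠ 0 := Finset.prod_ne_zero_iff.1 ha i hi
  rw [← Finset.mul_prod_erase _ _ hi]
  field_simp

theorem sum_div_eq_of_semiInvariant {h : Matrix (Fin 2) (Fin 2) ℂ} {χ : ℂ}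
    (hχ : ∀ v, ∏ i, l i ⬝ᵥ (h *ᵥ v) = χ * ∏ i, l i ⬝ᵥ v) {a b : Fin 2 → ℂ}
    (ha : ∏ i, l i ⬝ᵥ (h *ᵥ a) ≠ 0) :
    ∑ i, (l i ⬝ᵥ (h *ᵥ b)) / (l i ⬝ᵥ (h *ᵥ a)) = ∑ i, (l i ⬝ᵥ b) / (l i ⬝ᵥ a) := by
  have ha' : ∏ i, l i ⬝ᵥ a ≠ 0 := by
    intro h0
    rw [hχ, h0, mul_zero] at ha
    exact ha rfl
  have h1 := hasDerivAt_prod_linear (b := h *ᵥ b) ha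
  have h2 := (hasDerivAt_prod_linear (b := b) ha').const_mul χ
  have h3 : (fun t : ℂ => ∏ i, l i ⬝ᵥ (h *ᵥ a + t • h *ᵥ b))
      = fun t : ℂ => χ * ∏ i, l i ⬝ᵥ (a + t • b) := by
    ext t
    rw [← hχ, Matrix.mulVec_add, Matrix.mulVec_smul]
  rw [h3] at h1
  have h4 := h1.unique h2
  rw [← mul_assoc, ← hχ a] at h4
  exact mul_left_cancel₀ ha h4

/-- `-ħ` times the logarithmic derivative of `∏ l_i (S⁻¹ e₁)`, for a flat frame `S` of an oper. -/
noncomputable def logSum (l : κ → Fin 2 → ℂ) (S : Matrix (Fin 2) (Fin 2) ℂ) : ℂ :=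
  ∑ i, (l i ⬝ᵥ invCol S 1) / (l i ⬝ᵥ invCol S 0)

theorem logSum_upper {t u : ℂ} (ht : t ≠ 0) {S : Matrix (Fin 2) (Fin 2) ℂ}
    (h0 : ∏ i, l i ⬝ᵥ invCol S 0 ≠ 0) :
    logSum l (!![t, u; 0, t⁻¹] * S) = t ^ 2 * (logSum l S) - Fintype.card κ * (t * u) ∧
      ∏ i, l i ⬝ᵥ invCol (!![t, u; 0, t⁻¹] * S) 0 ≠ 0 := by
  have e1 : invCol (!![t, u; 0, t⁻¹] * S) 0 = t⁻¹ • invCol S 0 := by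
    ext i
    fin_cases i <;> simp [invCol, Matrix.mul_apply, Fin.sum_univ_two]
  have e2 : invCol (!![t, u; 0, t⁻¹] * S) 1 = t • invCol S 1 - u • invCol S 0 := by
    ext i
    fin_cases i <;> simp [invCol, Matrix.mul_apply, Fin.sum_univ_two]
    all_goals ring
  have h0' : ∀ i, l i ⬝ᵥ invCol S 0 ≠ 0 := fun i => Finset.prod_ne_zero_iff.1 h0 i (Finset.mem_univ i)
  constructor
  · simp only [logSum, e1, e2, dotProduct_sub, dotProduct_smul, smul_eq_mul]
    have h1 : ∀ i, (t * (l i ⬝ᵥ invCol S 1) - u * (l i ⬝ᵥ invCol S 0)) / (t⁻¹ * (l i ⬝ᵥ invCol S 0))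
        = t ^ 2 * ((l i ⬝ᵥ invCol S 1) / (l i ⬝ᵥ invCol S 0)) - t * u := by
      intro i
      have := h0' i
      field_simp
    simp only [h1, Finset.sum_sub_distrib, Finset.mul_sum, Finset.sum_const, Finset.card_univ,
      nsmul_eq_mul]
  · simp only [e1, dotProduct_smul, smul_eq_mul]
    exact Finset.prod_ne_zero_iff.2 fun i _ => mul_ne_zero (inv_ne_zero ht) (h0' i)

end LogarithmicDerivatives

section Irreducibility

variable {C : Type*} [TopologicalSpace C] [ChartedSpace ℂ C] [IsManifold 𝓘(ℂ, ℂ) ω C] {ι : Type*}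
variable {z : ι → OpenPartialHomeomorph C ℂ} {ξ : ι → ι → C → ℂ} {q : ι → C → ℂ}
variable {κ : Type*} [Fintype κ] {l : κ → Fin 2 → ℂ}

/-- The logarithmic derivative of a linear form evaluated on `S⁻¹ e₁`, for a flat frame `S`. -/
theorem simplePole_linear_of_flat {e : OpenPartialHomeomorph C ℂ}
    (he : e ∈ IsManifold.maximalAtlas 𝓘(ℂ, ℂ) ω C) {V : Set C} (hV : IsOpen V) (hVe : V ⊆ e.source)
    {ħ : ℂ} (hħ : ħ ≠ 0) {f : C → ℂ} {S : C → Matrix (Fin 2) (Fin 2) ℂ} (hS : HolMatrixOn S V)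
    (hd : ∀ y ∈ V, matDeriv e S y = ((1 / ħ) • !![0, f y; 1, 0]) * S y) {p : C} (hp : p ∈ V)
    (hdet : (S p).det = 1) {c : Fin 2 → ℂ} (hc : c ≠ 0) :
    (∀ᶠ y in 𝓝[≠] p, c ⬝ᵥ invCol (S y) 0 ≠ 0) ∧ ∃ (n : ℕ) (h : ℂ → ℂ), AnalyticAt ℂ h (e p) ∧
      ∀ᶠ w in 𝓝[≠] (e p), -(1 / ħ) * ((c ⬝ᵥ invCol (S (e.symm w)) 1)
        / (c ⬝ᵥ invCol (S (e.symm w)) 0)) = n / (w - e p) + h w := by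
  set b : C → ℂ := fun y => c ⬝ᵥ invCol (S y) 0
  have hb_eq : b = fun y => c 0 * S y 1 1 - c 1 * S y 1 0 := by
    ext y
    simp [b, invCol, dotProduct, Fin.sum_univ_two]
    ring
  have hb : HolOn b V := by
    rw [hb_eq]
    exact ((holOn_const _).mul (hS 1 1)).sub ((holOn_const _).mul (hS 1 0))
  have hbd : ∀ y ∈ V, coordDeriv e b y = -(1 / ħ) * (c ⬝ᵥ invCol (S y) 1) := by
    intro y hy
    have hm : ∀ i j, MDifferentiableAt 𝓘(ℂ, ℂ) 𝓘(ℂ, ℂ) (fun x => S x i j) y := fun i j =>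
      (hS i j).mdifferentiableAt hV hy
    have hd' : ∀ i j, coordDeriv e (fun x => S x i j) y
        = (((1 / ħ) • !![0, f y; 1, 0]) * S y) i j := fun i j => by rw [← hd y hy]; rfl
    rw [hb_eq, coordDeriv_sub (f := fun y => c 0 * S y 1 1) (g := fun y => c 1 * S y 1 0) he
      (hVe hy) (((holOn_const _).mul (hS 1 1)).mdifferentiableAt hV hy)
      (((holOn_const _).mul (hS 1 0)).mdifferentiableAt hV hy),
      coordDeriv_mul he (hVe hy) mdifferentiableAt_const (hm 1 1),
      coordDeriv_mul he (hVe hy) mdifferentiableAt_const (hm 1 0), coordDeriv_const,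
      coordDeriv_const, hd', hd']
    simp [invCol, Matrix.mul_apply, dotProduct, Fin.sum_univ_two]
    ring
  have han : AnalyticAt ℂ (b ∘ e.symm) (e p) := hb.analyticAt hV hp he (hVe hp)
  have hne : ∀ᶠ w in 𝓝[≠] (e p), (b ∘ e.symm) w ≠ 0 := by
    refine han.eventually_eq_zero_or_eventually_ne_zero.resolve_left fun h0 => hc ?_
    have h1 : b p = 0 := by
      have := h0.self_of_nhds
      simpa [e.left_inv (hVe hp)] using this
    have h2 : coordDeriv e b p = 0 := by
      have h3 : b ∘ e.symm =ᶠ[𝓝 (e p)] fun _ => 0 := h0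
      rw [coordDeriv, h3.deriv_eq, deriv_const]
    rw [hbd p hp] at h2
    have h3 : c ⬝ᵥ invCol (S p) 1 = 0 := by simpa [hħ] using h2
    rw [Matrix.det_fin_two] at hdet
    simp only [b, invCol, dotProduct, Fin.sum_univ_two, Matrix.cons_val_zero,
      Matrix.cons_val_one] at h1 h3
    ext i
    fin_cases i
    · simp only [Fin.zero_eta, Pi.zero_apply]
      linear_combination S p 0 0 * h1 + S p 1 0 * h3 - c 0 * hdet
    · simp only [Fin.mk_one, Pi.zero_apply]
      linear_combination S p 0 1 * h1 + S p 1 1 * h3 - c 1 * hdet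
  have htop : analyticOrderAt (b ∘ e.symm) (e p) ≠ ⊤ := by
    intro h
    exact ((analyticOrderAt_eq_top.1 h).filter_mono nhdsWithin_le_nhds |>.and hne).exists.elim
      fun w hw => hw.2 hw.1
  have hord : meromorphicOrderAt (b ∘ e.symm) (e p)
      = ((analyticOrderNatAt (b ∘ e.symm) (e p) : ℕ) : ℤ) := by
    rw [han.meromorphicOrderAt_eq, ← Nat.cast_analyticOrderNatAt htop]
    rfl
  obtain ⟨h, hh, hev⟩ := dlog_simplePole (hVe hp) han.meromorphicAt hord
  refine ⟨(eventually_nhdsNE_coord (hVe hp)).2 ?_, analyticOrderNatAt (b ∘ e.symm) (e p), h, hh,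
    ?_⟩
  · exact hne
  filter_upwards [hev, mem_nhdsWithin_of_mem_nhds
    ((e.isOpen_inter_preimage_symm hV).mem_nhds ⟨e.map_source (hVe hp), by
      simpa [e.left_inv (hVe hp)] using hp⟩)] with w hw hwV
  rw [dlog, hbd _ hwV.2, mul_div_assoc, Int.cast_natCast] at hw
  exact hw

variable (hz : IsCoordinateSystem z) (hξ : IsThetaCharacteristic z ξ)
include hz hξ

/-- The connections `∇^ħ(q)` are irreducible. -/
theorem isIrreducibleConnection_operForm [T2Space C] [CompactSpace C] [ConnectedSpace C]
    (hC : 2 ≤ genus C) (hp : IsProjective z) (hq : IsQuadraticDifferential z q) {ħ : ℂ}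
    (hħ : ħ ≠ 0) : IsIrreducibleConnection z (transE z ξ ħ) (operForm ħ q) := by
  have hS := isSLPair_operForm hz hξ hp hq hħ
  have : LocallyPathConnectedSpace C := ChartedSpace.locallyPathConnectedSpace ℂ C
  have : PathConnectedSpace C := pathConnectedSpace_iff_connectedSpace.2 inferInstance
  intro α₀ x₀ hx₀
  by_contra hnd
  obtain ⟨κ, _, hκ, l, hl, hF⟩ := (isSLGroup_holonomy hz hS hx₀).hasSemiInvariant hnd
  choose a ha using hz.covers
  obtain ⟨η, m, hη, hne, hpole, x₁, hx₁⟩ := exists_oneForm_with_divisor hC hz ha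
  let Reach : ι → C → Matrix (Fin 2) (Fin 2) ℂ → Prop := fun β p S =>
    ∃ γ : Path x₀ p, IsTransport z (transE z ξ ħ) (operForm ħ q) α₀ β γ S
  have hex : ∀ β p, ∃ S, Reach β p S := fun β p => by
    obtain ⟨S, h⟩ := exists_isTransport hz hS (PathConnectedSpace.somePath x₀ p) β hx₀
    exact ⟨S, _, h⟩
  choose S₀ hS₀ using hex
  have hReq : ∀ β p, p ∈ (z β).source → ∀ S S', Reach β p S → Reach β p S' →
      ∏ i, l i ⬝ᵥ invCol S 0 ≠ 0 → logSum l S = logSum l S' ∧ ∏ i, l i ⬝ᵥ invCol S' 0 ≠ 0 := by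
    rintro β p hpβ S S' ⟨γ, hγ⟩ ⟨γ', hγ'⟩ h0
    have hh : S⁻¹ * S' ∈ holonomy z (transE z ξ ħ) (operForm ħ q) α₀ x₀ :=
      ⟨_, hγ'.trans hz hS (hγ.symm hz hS hx₀ hpβ) hx₀ hpβ hx₀⟩
    have hdet := hγ.det hz hS hx₀ hpβ
    have hdet' := hγ'.det hz hS hx₀ hpβ
    have hu' : IsUnit S'.det := by rw [hdet']; exact isUnit_one
    obtain ⟨χ, hχ⟩ := hF _ hh
    have hcol : ∀ j, invCol S j = (S⁻¹ * S') *ᵥ invCol S' j := fun j => by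
      rw [invCol_eq hdet, invCol_eq hdet', Matrix.mulVec_mulVec, Matrix.mul_assoc,
        Matrix.mul_nonsing_inv _ hu', Matrix.mul_one]
    rw [hcol 0] at h0
    refine ⟨?_, fun h => h0 (by rw [hχ, h, mul_zero])⟩
    rw [logSum, hcol 0, hcol 1, sum_div_eq_of_semiInvariant hχ h0, logSum]
  have hlocal : ∀ β p, p ∈ (z β).source →
      (∀ᶠ y in 𝓝[≠] p, ∏ i, l i ⬝ᵥ invCol (S₀ β y) 0 ≠ 0) ∧
      ∃ (n : ℕ) (h : ℂ → ℂ), AnalyticAt ℂ h (z β p) ∧ ∀ᶠ w in 𝓝[≠] (z β p),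
        -(1 / ħ) * logSum l (S₀ β ((z β).symm w)) = n / (w - z β p) + h w := by
    intro β p hpβ
    obtain ⟨V, hVβ, hV, hVc, hpV, Y, hY, hYd, hYp, hYdet⟩ := exists_flat_frame (hz.holomorphic β)
      (hS.connection.holomorphic β) (hS.trace_eq_zero β) hpβ
    obtain ⟨γ, hγ⟩ := hS₀ β p
    have hdetp := hγ.det hz hS hx₀ hpβ
    set S : C → Matrix (Fin 2) (Fin 2) ℂ := fun y => Y y * S₀ β p
    have hSh : HolMatrixOn S V := fun i j => by
      simp only [S, Matrix.mul_apply]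
      exact holOn_sum _ fun k _ => (hY i k).mul (holOn_const _)
    have hreach : ∀ y ∈ V, Reach β y (S y) := fun y hy => by
      have hj := hVc.joinedIn p hpV y hy
      exact ⟨_, hγ.trans hz hS (isTransport_of_frame hz hS hVβ hV hY hYd hYp hj.somePath_mem)
        hx₀ hpβ (hVβ hy)⟩
    have hSd : ∀ y ∈ V, matDeriv (z β) S y = ((1 / ħ) • !![0, q β y; 1, 0]) * S y := by
      intro y hy
      have h1 : matDeriv (z β) S y = matDeriv (z β) Y y * S₀ β p := by
        ext i j
        have hm : ∀ i k, MDifferentiableAt 𝓘(ℂ, ℂ) 𝓘(ℂ, ℂ) (fun x => Y x i k) y := fun i k =>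
          (hY i k).mdifferentiableAt hV hy
        simp only [matDeriv, Matrix.of_apply, S, Matrix.mul_apply]
        rw [coordDeriv_sum (f := fun k y => Y y i k * S₀ β p k j) (hz.holomorphic β) (hVβ hy) _
          fun k _ => (hm i k).mul mdifferentiableAt_const]
        refine Finset.sum_congr rfl fun k _ => ?_
        rw [coordDeriv_mul (hz.holomorphic β) (hVβ hy) (hm i k) mdifferentiableAt_const,
          coordDeriv_const, mul_zero, add_zero]
      rw [h1, hYd y hy, operForm, higgs_eq]
      simp only [Matrix.neg_mul, neg_neg, Matrix.mul_assoc, S]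
    have hi := fun i => simplePole_linear_of_flat (hz.holomorphic β) hV hVβ hħ hSh hSd hpV
      (by simpa [S, hYp] using hdetp) (hl i)
    have hprod : ∀ᶠ y in 𝓝[≠] p, ∏ i, l i ⬝ᵥ invCol (S y) 0 ≠ 0 := by
      filter_upwards [eventually_all.2 fun i => (hi i).1] with y hy
      exact Finset.prod_ne_zero_iff.2 fun i _ => hy i
    have hS₀S : ∀ᶠ y in 𝓝[≠] p, logSum l (S y) = logSum l (S₀ β y) ∧
        ∏ i, l i ⬝ᵥ invCol (S₀ β y) 0 ≠ 0 := by
      filter_upwards [hprod, mem_nhdsWithin_of_mem_nhds (hV.mem_nhds hpV)] with y hy hyV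
      exact hReq β y (hVβ hyV) _ _ (hreach y hyV) (hS₀ β y) hy
    choose n h hh hev using fun i => (hi i).2
    refine ⟨hS₀S.mono fun y hy => hy.2, ∑ i, n i, fun w => ∑ i, h i w,
      Finset.analyticAt_fun_sum _ fun i _ => hh i, ?_⟩
    filter_upwards [(eventually_nhdsNE_coord hpβ).1 hS₀S, eventually_all.2 hev] with w h1 h2
    rw [← h1.1, logSum, Finset.mul_sum, Finset.sum_congr rfl fun i _ => h2 i,
      Finset.sum_add_distrib, Nat.cast_sum, Finset.sum_div]
  have hψ : ∀ α β, ∀ x ∈ (z α).source ∩ (z β).source, ∀ᶠ y in 𝓝[≠] x,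
      -(1 / ħ) * logSum l (S₀ α y) = canonicalCocycle z α β y *
        (-(1 / ħ) * logSum l (S₀ β y) + (-(Fintype.card κ : ℤ) : ℤ) * dlogTheta z ξ α β y) := by
    intro α β x hx
    filter_upwards [(hlocal β x hx.2).1, mem_nhdsWithin_of_mem_nhds
      (((z α).open_source.inter (z β).open_source).mem_nhds hx)] with y hy hyo
    have h0 := theta_ne_zero hz hξ hyo
    obtain ⟨γ, hγ⟩ := hS₀ β y
    have h1 := hγ.change hz hS hyo.2 hyo.1
    rw [transE_apply hz hξ ħ hyo] at h1
    obtain ⟨h2, h3⟩ := logSum_upper (u := -ħ * dTheta z ξ α β y) h0 hy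
    rw [← (hReq α y hyo.1 _ _ ⟨γ, h1⟩ (hS₀ α y) h3).1, h2, ← hξ.sq α β y hyo, dlogTheta]
    push_cast
    rw [dTheta]
    field_simp
    ring
  choose n h hh hev using fun x => (hlocal (a x) x (ha x)).2
  obtain ⟨hfin, hsum⟩ := finsum_residues_logForm hz hξ ha hη hne hpole (-(Fintype.card κ : ℤ))
    (fun β y => -(1 / ħ) * logSum l (S₀ β y)) hψ (fun x => (n x : ℤ))
    fun x => ⟨h x, hh x, by simpa using hev x⟩
  have hpos : 0 < (Fintype.card κ : ℤ) * m x₁ := by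
    have := Fintype.card_pos (α := κ)
    have := Nat.pos_of_ne_zero hx₁
    positivity
  rw [finsum_eq_sum_of_support_subset (s := hfin.toFinset) _ (by simp)] at hsum
  have h1 := (Finset.sum_eq_zero_iff_of_nonneg fun x _ => by
    have : 0 ≤ (Fintype.card κ : ℤ) * m x := by positivity
    linarith [Int.natCast_nonneg (n x)]).1 hsum x₁ (by
      simp only [Finite.mem_toFinset, Function.mem_support]
      linarith [Int.natCast_nonneg (n x₁)])
  linarith [Int.natCast_nonneg (n x₁)]

/-- The pairs `(E_ħ, ∇^ħ(q))` are opers. -/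
theorem isOper_operForm [T2Space C] [CompactSpace C] [ConnectedSpace C]
    (hC : 2 ≤ genus C) (hp : IsProjective z) (hq : IsQuadraticDifferential z q) {ħ : ℂ}
    (hħ : ħ ≠ 0) : IsOper z (transE z ξ ħ) (operForm ħ q) where
  slPair := isSLPair_operForm hz hξ hp hq hħ
  irreducible := isIrreducibleConnection_operForm hz hξ hC hp hq hħ
  exists_line := ⟨_, isLineSubbundle_e1 hz hξ ħ, inducesIsoOnQuotient_operForm hz hħ⟩

end Irreducibility

theorem mainTheorem6 {C : Type*} [TopologicalSpace C] [T2Space C] [CompactSpace C]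
    [ConnectedSpace C] [ChartedSpace ℂ C] [IsManifold 𝓘(ℂ, ℂ) ω C] (hC : 2 ≤ genus C)
    {ι : Type*} (z : ι → OpenPartialHomeomorph C ℂ) (hz : IsCoordinateSystem z)
    (ξ : ι → ι → C → ℂ) (hξ : IsThetaCharacteristic z ξ) :
    -- `ħ ∂ log ξ` is a `1`-cocycle with values in `K_C`
    (∀ ħ : ℂ, IsCanonicalOneCocycle z (fun α β x => ħ * dlogTheta z ξ α β x)) ∧
    -- `g^ħ` is a cocycle, and defines an extension `E_ħ` of `K^{-1/2}` by `K^{1/2}`,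
    -- which is non-trivial for `ħ ≠ 0`; the family depends holomorphically on `ħ`
    (∀ ħ : ℂ, IsBundle z (transE z ξ ħ) ∧
      IsShortExact z (transHalf ξ) (transE z ξ ħ) (transNegHalf ξ)
        (inclHalf ι C) (projNegHalf ι C)) ∧
    (∀ ħ : ℂ, ħ ≠ 0 → ¬ Splits z (transE z ξ ħ) (transNegHalf ξ) (projNegHalf ι C)) ∧
    (∀ α β i j, MDifferentiableOn (𝓘(ℂ, ℂ).prod 𝓘(ℂ, ℂ)) 𝓘(ℂ, ℂ)
      (fun p : C × ℂ => transE z ξ p.2 α β p.1 i j)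
      (((z α).source ∩ (z β).source) ×ˢ univ)) ∧
    -- `d - (1/ħ) X₋ dz_α` defines a global connection if and only if `z` is projective
    (∀ ħ : ℂ, ħ ≠ 0 →
      (IsConnection z (transE z ξ ħ) (fun _ _ => -((1 / ħ) • Xminus)) ↔ IsProjective z)) ∧
    (IsProjective z →
      (∀ q : ι → C → ℂ, IsQuadraticDifferential z q →
        -- the opers `(E_ħ, ∇^ħ(q))`
        (∀ ħ : ℂ, ħ ≠ 0 → IsOper z (transE z ξ ħ) (operForm ħ q)) ∧
        -- the `ħ`-connection `ħ d - φ(q)` exists for all `ħ`; it is `ħ ∇^ħ(q)` for `ħ ≠ 0`, the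
        -- Higgs pair `(E_0, -φ(q))` for `ħ = 0`, and an oper for `ħ = 1`
        (∀ ħ : ℂ, IsLambdaConnection z (transE z ξ ħ) ħ (fun α x => -higgs q α x)) ∧
        (∀ ħ : ℂ, ħ ≠ 0 → ∀ α (s : C → Fin 2 → ℂ) (x : C),
          localOp z ħ (fun α x => -higgs q α x) α s x = ħ • localOp z 1 (operForm ħ q) α s x) ∧
        (∀ α β, ∀ x ∈ (z α).source ∩ (z β).source,
          transE z ξ 0 α β x = !![ξ α β x, 0; 0, (ξ α β x)⁻¹]) ∧
        IsStableHiggs z (transE z ξ 0) (higgs q) ∧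
        IsStableHiggs z (transE z ξ 0) (fun α x => -higgs q α x) ∧
        IsOper z (transE z ξ 1) (fun α x => -higgs q α x) ∧
        -- after a gauge transformation, `∇^ħ(q)` tends to `∇^1(0)` on `E_1` as `ħ → ∞`
        (∃ (T : ℂ → ι → C → Matrix (Fin 2) (Fin 2) ℂ) (B : ℂ → ι → C → Matrix (Fin 2) (Fin 2) ℂ),
          (∀ ħ : ℂ, ħ ≠ 0 → IsGaugeTransformation z 1 (transE z ξ ħ) (operForm ħ q)
            (transE z ξ 1) (B ħ) (T ħ)) ∧
          ∀ α i j, TendstoLocallyUniformlyOn (fun (ħ : ℂ) (x : C) => B ħ α x i j)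
            (fun x => operForm 1 (fun _ _ => 0) α x i j) (Bornology.cobounded ℂ) (z α).source) ∧
        -- `q = 0` is the fixed point of `ℂ^*` on the Hitchin section
        ((∀ lam : ℂ, lam ≠ 0 → ∃ T, IsGaugeTransformation z 0
            (transE z ξ 0) (fun α x => lam • higgs q α x) (transE z ξ 0) (higgs q) T) ↔
          ∀ α, ∀ x ∈ (z α).source, q α x = 0))) := by
  refine ⟨isCanonicalOneCocycle_dlogTheta hz hξ,
    fun ħ => ⟨isBundle_transE hz hξ ħ, isShortExact_transE hz hξ ħ⟩,
    fun ħ hħ => not_splits_transE hz hξ hC hħ, mdifferentiableOn_transE hz hξ,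
    fun ħ hħ => isConnection_Xminus_iff hz hξ hħ, fun hp q hq =>
    ⟨fun ħ hħ => isOper_operForm hz hξ hC hp hq hħ, fun ħ => ?_,
    fun ħ hħ => localOp_higgs hħ q, fun α β x hx => transE_zero hz hξ hx, ?_, ?_, ?_,
    exists_gauge_tendsto_operForm hz hξ hq.holomorphic, higgs_fixed_iff hz hξ⟩⟩
  · simpa using isLambdaConnection_higgs hz hξ hp hq ħ 1
  · simpa using isStableHiggs_higgs hz hξ hC hp hq (c := -1) (by simp)
  · simpa using isStableHiggs_higgs hz hξ hC hp hq (c := 1) one_ne_zero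
  · rw [← operForm_one]
    exact isOper_operForm hz hξ hC hp hq one_ne_zero
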